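/- **Setting.** An instance consists of finitely many machines $i$ and finitely many jobs $j$; job $j$ has release time $r_j\ge 0$, size $p_j>0$, weight $w_j>0$, and machine $i$ processes $j$ at speed $\lambda_{ij}\ge 0$, where for each $j$ some $\lambda_{ij}>0$. Put $p_{ij}=p_j/\lambda_{ij}$. A (preemptive, migratory) schedule gives at each time $t$ a fractional matching $y_{ij}(t)\ge 0$, $\sum_j y_{ij}(t)\le 1$, $\sum_i y_{ij}(t)\le 1$, measurable in $t$, with $y_{ij}(t)=0$ for $t<r_j$. With speed $s$, job $j$ is processed at rate $s\sum_i\lambda_{ij}y_{ij}(t)$. Let $p_j(t)$ be its remaining size at time $t$ (set to $0$ for $t<r_j$) and $C_j\in[0,\infty]$ its completion time. The total weighted flow time is $\sum_j w_j(C_j-r_j)$, and $\mathrm{OPT}$ is its infimum over all schedules with speed $1$. Let $\tilde W(t)=\sum_j \frac{w_j}{p_j}p_j(t)$ and $W(t)=\sum_{j:\,p_j(t)>0}w_j$; the total fractional weighted flow time is $\int_0^\infty \tilde W(t)\,dt$. Superscripts $A$ and $O$ denote the algorithm and an arbitrary speed-$1$ schedule. **Residual LP.** For $x\ge 0$ let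 $$f(x)=\min \sum_{i,j}\frac{w_j}{p_{ij}}\int_0^\infty \tilde t\,z_{ij}(\tilde t)\,d\tilde t+\sum_{i,j}w_j\int_0^\infty z_{ij}(\tilde t)\,d\tilde t$$ over measurable $z\ge 0$ with $\sum_j z_{ij}(\tilde t)\le 1$ for all $i,\tilde t$ and $\sum_i\int_0^\infty\lambda_{ij}z_{ij}(\tilde t)\,d\tilde t=x_j$ for all $j$. **Approximate gradient descent.** Given an optimal solution $z$ for the current remaining sizes, let $\tilde t_i\in[0,\infty]$ be the earliest time with $\sum_j\int_0^{\tilde t_i} z_{ij}/p_{ij}=1$ ($\infty$ if there is none), and let $\hat z_{ij}=\int_0^{\tilde t_i}z_{ij}/p_{ij}$. The algorithm, with speed $s$, processes $y_{ij}=\hat z_{ij}$ until a job is released or, for some $i,j$ with $\hat z_{ij}>0$, the fraction $\hat z_{ij}$ of job $j$ has been completed on machine $i$ (i.e. after time $p_{ij}/s$); then it re-solves the LP. Ties between optimal solutions are broken arbitrarily. The times at which the LP is solved (starting with time $0$) are the decision times. **Theorem.** There is an absolute constant $C>0$ such that the following hold. 1. For every instance: $f(x)$ is finite and attained for every $x\ge0$.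 If $0\le x_j\le p_j$ for all $j$, then $\hat z$ is a fractional matching for every optimal $z$. For all $\tilde t\ge 0$ and $B\in\mathbb R$ the generalized-flow valuation $$v_{\tilde t}(x)=\max\Big\{\sum_{i,j}\Big(B\lambda_{ij}-\frac{w_j\tilde t}{p_{ij}}-w_j\Big)z_{ij}:\ z\ge0,\ \sum_i\lambda_{ij}z_{ij}\le x_j\ \forall j,\ \sum_j z_{ij}\le1\ \forall i\Big\}$$ is linear-substitute: for prices $0\le q\le q'$ and every $x\ge 0$ maximizing $v_{\tilde t}(x)-q\cdot x$ there is $x'\ge 0$ maximizing $v_{\tilde t}(x')-q'\cdot x'$ with $x'_j\ge x_j$ whenever $q'_j=q_j$. The function $f$ is supermodular: $f(x)+f(y)\le f(x\vee y)+f(x\wedge y)$ for $x,y\ge0$; in particular $S\mapsto f(x\odot 1_S)$ is a supermodular set function. 2. Let $0<\varepsilon<1/8$ with $1/\varepsilon$ an integer, $s=1+2\varepsilon$, and $$\Phi(t)=\frac2\varepsilon\Big(f(p^A(t))-\varepsilon f\big(p^A(t)\,\|\,(\tfrac1\varepsilon-1)\,p^O(t)\big)\Big),$$ where the second $f$ refers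 to one copy of each job $j$ with remaining size $p^A_j(t)$ and $\frac1\varepsilon-1$ further copies of it, each with remaining size $p_j^O(t)$. At every time $t\ge0$ from which on the speed-$s$ algorithm processes, for some positive amount of time, the rates $\hat z$ of an optimal solution of the LP for $p^A(t)$ (in particular at every decision time), for all sufficiently small $h>0$, $$\frac{\Phi(t+h)-\Phi(t)}h\le-\tilde W^A(t)+\frac{C}{\varepsilon^2}W^O(t).$$ Moreover, along every run of approximate gradient descent with speed $s$, if $T$ is a decision time and $t\ge T$ lies before the next one, then $\Phi(t)-\Phi(T)\le\int_T^t\big(-\tilde W^A(u)+\frac C{\varepsilon^2}W^O(u)\big)\,du$. 3. For every $0<\varepsilon<1/8$, every run of approximate gradient descent with speed $1+2\varepsilon$ satisfies $\int_0^\infty\tilde W^A(t)\,dt\le\frac{C}{\varepsilon^2}\,\mathrm{OPT}$. 4. For every $0<\varepsilon\le1$ and every set of machines there is a deterministic online (clairvoyant) algorithm, whose decisions up to time $t$ depend only on the jobs released by time $t$, that with speed $1+\varepsilon$ has total weighted flow time at most $\frac{C}{\varepsilon^3}\,\mathrm{OPT}$ on every instance. For some $0<\delta<1/8$ with $1+2\delta<1+\varepsilon$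 depending only on $\varepsilon$ and the set of machines, on each instance it copies the rates $y_{ij}(t)$ of a run of approximate gradient descent with speed $1+2\delta$, except that it stops processing a job once it has itself completed that job. -/

import Mathlib

open MeasureTheory Filter Topology
open scoped ENNReal

noncomputable section

namespace UnrelatedFlow

/-- An instance of weighted flow time scheduling on unrelated machines `M` with jobs `J`:
release time `r j`, size `p j`, weight `w j`, and `lam i j`, the speed at which machine `i`
processes job `j` (so `p j / lam i j` is the processing time of `j` on `i`, infinite if
`lam i j = 0`). -/
structure Instance (M J : Type) where
  r : J → ℝ
  p : J → ℝ
  w : J → ℝ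
  lam : M → J → ℝ
  r_nonneg : ∀ j, 0 ≤ r j
  p_pos : ∀ j, 0 < p j
  w_pos : ∀ j, 0 < w j
  lam_nonneg : ∀ i j, 0 ≤ lam i j
  exists_lam_pos : ∀ j, ∃ i, 0 < lam i j

/-- Relabelling or copying of jobs: the job `k` of the new instance is a copy of `g k`. -/
def Instance.comap {M J K : Type} (I : Instance M J) (g : K → J) : Instance M K where
  r k := I.r (g k)
  p k := I.p (g k)
  w k := I.w (g k)
  lam i k := I.lam i (g k)
  r_nonneg k := I.r_nonneg (g k)
  p_pos k := I.p_pos (g k)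
  w_pos k := I.w_pos (g k)
  lam_nonneg i k := I.lam_nonneg i (g k)
  exists_lam_pos k := I.exists_lam_pos (g k)

/-! ### Schedules and their costs -/

/-- A preemptive migratory schedule: at every time `t` the numbers `rate t i j` (the share of
machine `i` given to job `j`) form a fractional matching of jobs and machines, and no job is
processed before its release. -/
structure Schedule {M J : Type} [Fintype M] [Fintype J] (I : Instance M J) where
  rate : ℝ → M → J → ℝ
  measurable_rate : ∀ i j, Measurable fun t => rate t i j
  rate_nonneg : ∀ t i j, 0 ≤ rate t i j
  machine_le_one : ∀ t i, ∑ j, rate t i j ≤ 1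
  job_le_one : ∀ t j, ∑ i, rate t i j ≤ 1
  rate_before_release : ∀ t i j, t < I.r j → rate t i j = 0

namespace Schedule

variable {M J : Type} [Fintype M] [Fintype J] {I : Instance M J}

/-- The amount of job `j` processed up to time `t` by machines of speed `s`. -/
def processed (σ : Schedule I) (s : ℝ) (j : J) (t : ℝ) : ℝ :=
  s * ∫ u in (0 : ℝ)..t, ∑ i, I.lam i j * σ.rate u i j

open Classical in
/-- The remaining size of `j` at time `t`; it is `0` as long as `j` is not released. -/
def residual (σ : Schedule I) (s : ℝ) (t : ℝ) (j : J) : ℝ :=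
  if I.r j ≤ t then max 0 (I.p j - σ.processed s j t) else 0

/-- The completion time of `j` (`∞` if `j` is never completed). -/
def completionTime (σ : Schedule I) (s : ℝ) (j : J) : ℝ≥0∞ :=
  ⨅ (t : ℝ) (_ : I.r j ≤ t ∧ I.p j ≤ σ.processed s j t), ENNReal.ofReal t

/-- Total (integral) weighted flow time `∑ j, w j * (C j - r j)`. -/
def weightedFlow (σ : Schedule I) (s : ℝ) : ℝ≥0∞ :=
  ∑ j, ENNReal.ofReal (I.w j) * (σ.completionTime s j - ENNReal.ofReal (I.r j))

/-- The total fractional weight at time `t`. -/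
def fracWeight (σ : Schedule I) (s : ℝ) (t : ℝ) : ℝ :=
  ∑ j, I.w j / I.p j * σ.residual s t j

open Classical in
/-- The total weight of the jobs that are released and not completed at time `t`. -/
def aliveWeight (σ : Schedule I) (s : ℝ) (t : ℝ) : ℝ :=
  ∑ j, if 0 < σ.residual s t j then I.w j else 0

/-- Total fractional weighted flow time. -/
def fracFlow (σ : Schedule I) (s : ℝ) : ℝ≥0∞ :=
  ∫⁻ t in Set.Ici (0 : ℝ), ENNReal.ofReal (σ.fracWeight s t)

end Schedule

/-- The optimal total weighted flow time with machines of speed `1`. -/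
def Instance.opt {M J : Type} [Fintype M] [Fintype J] (I : Instance M J) : ℝ≥0∞ :=
  ⨅ σ : Schedule I, σ.weightedFlow 1

/-! ### The time-indexed residual linear program -/

namespace Instance

variable {M J : Type} [Fintype M] [Fintype J]

/-- Feasibility of `z` for the residual program with remaining sizes `x`. -/
structure LPFeasible (I : Instance M J) (x : J → ℝ) (z : M → J → ℝ → ℝ) : Prop where
  measurable : ∀ i j, Measurable (z i j)
  nonneg : ∀ i j t, 0 ≤ t → 0 ≤ z i j t
  machine_le_one : ∀ i t, 0 ≤ t → ∑ j, z i j t ≤ 1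
  volume_eq : ∀ j, ∑ i, ∫⁻ t in Set.Ici (0 : ℝ), ENNReal.ofReal (I.lam i j * z i j t)
    = ENNReal.ofReal (x j)

/-- The objective of the residual program. -/
def lpCost (I : Instance M J) (z : M → J → ℝ → ℝ) : ℝ≥0∞ :=
  (∑ i, ∑ j, ENNReal.ofReal (I.w j * I.lam i j / I.p j)
      * ∫⁻ t in Set.Ici (0 : ℝ), ENNReal.ofReal (t * z i j t))
    + ∑ i, ∑ j, ENNReal.ofReal (I.w j) * ∫⁻ t in Set.Ici (0 : ℝ), ENNReal.ofReal (z i j t)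

/-- The residual optimum `f`: the optimal value of the residual program. -/
def lpValue (I : Instance M J) (x : J → ℝ) : ℝ≥0∞ :=
  ⨅ (z : M → J → ℝ → ℝ) (_ : I.LPFeasible x z), I.lpCost z

/-- `z` is an optimal solution of the residual program. -/
def LPOptimal (I : Instance M J) (x : J → ℝ) (z : M → J → ℝ → ℝ) : Prop :=
  I.LPFeasible x z ∧ I.lpCost z = I.lpValue x

/-- The set function `S ↦ f (x ⊙ 1_S)`. -/
def lpSetValue (I : Instance M J) (x : J → ℝ) (S : Set J) : ℝ≥0∞ :=
  I.lpValue (S.indicator x)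

/-- The generalized flow valuation at local time `t`: the largest value of
`∑ (B λ_ij - w_j t / p_ij - w_j) z_ij` over `z ≥ 0` with `∑_i λ_ij z_ij ≤ x_j` for all jobs
and `∑_j z_ij ≤ 1` for all machines, where `p_ij = p_j / λ_ij`. -/
def flowValuation (I : Instance M J) (B t : ℝ) (x : J → ℝ) : ℝ :=
  sSup {v : ℝ | ∃ z : M → J → ℝ, (∀ i j, 0 ≤ z i j) ∧ (∀ j, ∑ i, I.lam i j * z i j ≤ x j) ∧
    (∀ i, ∑ j, z i j ≤ 1) ∧
    v = ∑ i, ∑ j, (B * I.lam i j - I.w j * I.lam i j / I.p j * t - I.w j) * z i j}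

/-- The fraction of jobs placed by `z` on machine `i` during the local times `[0, t]`. -/
def fractionUpTo (I : Instance M J) (z : M → J → ℝ → ℝ) (i : M) (t : ℝ) : ℝ :=
  ∑ j, ∫ u in (0 : ℝ)..t, I.lam i j * z i j u / I.p j

/-- The earliest local time at which `z` has placed a unit fraction of jobs on machine `i`
(`⊤` if this never happens). -/
def cutTime (I : Instance M J) (z : M → J → ℝ → ℝ) (i : M) : EReal :=
  sInf ((fun t : ℝ => (t : EReal)) '' {t : ℝ | 0 ≤ t ∧ 1 ≤ I.fractionUpTo z i t})

/-- Approximate gradient descent: the fraction of job `j` among the earliest unit fraction of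
jobs that `z` places on machine `i`. -/
def gdRate (I : Instance M J) (z : M → J → ℝ → ℝ) (i : M) (j : J) : ℝ :=
  ∫ u in {u : ℝ | 0 ≤ u ∧ (u : EReal) < I.cutTime z i}, I.lam i j * z i j u / I.p j

/-- The times after `t₀` at which the plan `z`, started at `t₀` with machines of speed `s`, is
revised: the fraction `gdRate z i j` of job `j` has been completed on machine `i` (which takes
time `p_ij / s` at the rate `gdRate z i j`), or a job is released. -/
def revisionTimes (I : Instance M J) (s t₀ : ℝ) (z : M → J → ℝ → ℝ) : Set ℝ :=
  {t | ∃ i j, 0 < I.gdRate z i j ∧ t = t₀ + I.p j / I.lam i j / s} ∪ {t | t₀ < t ∧ ∃ j, t = I.r j}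

end Instance

/-- `σ` is a run of approximate gradient descent with machines of speed `s`: at the times
`T 0 = 0 < T 1 < ...` it computes an optimal solution `z k` of the residual program for the
current remaining sizes and processes `gdRate (z k)` until the earliest revision time. (If there
is no revision time, then nothing is left to do, and `T (k + 1)` is irrelevant.) -/
structure IsApproxGD {M J : Type} [Fintype M] [Fintype J] {I : Instance M J} (s : ℝ)
    (σ : Schedule I) (T : ℕ → ℝ) (z : ℕ → M → J → ℝ → ℝ) : Prop where
  start : T 0 = 0
  mono : StrictMono T
  unbounded : Tendsto T atTop atTop
  optimal : ∀ k, I.LPOptimal (σ.residual s (T k)) (z k)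
  rate_eq : ∀ k t, T k ≤ t → t < T (k + 1) → ∀ i j, σ.rate t i j = I.gdRate (z k) i j
  next : ∀ k, (I.revisionTimes s (T k) (z k)).Nonempty →
    IsLeast (I.revisionTimes s (T k) (z k)) (T (k + 1))

/-- The potential `(2/ε) (f(p^A) - ε f(p^A ‖ (1/ε - 1) p^O))` for `ε = 1 / n`, where the second
term has `n - 1` copies of every job of the adversary; `xA`, `xO` are the remaining sizes. -/
def potential {M J : Type} [Fintype M] [Fintype J] (I : Instance M J) (n : ℕ)
    (xA xO : J → ℝ) : ℝ :=
  2 * (n : ℝ) * ((I.lpValue xA).toReal - (1 / (n : ℝ)) *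
    ((I.comap (Sum.elim id Prod.snd : J ⊕ (Fin (n - 1) × J) → J)).lpValue
      (Sum.elim xA fun c => xO c.2)).toReal)

/-! ### Linear substitutes -/

/-- The bundles `x ≥ 0` that maximize the quasi-linear utility `v x - q · x`. -/
def demand {J : Type} [Fintype J] (v : (J → ℝ) → ℝ) (q : J → ℝ) : Set (J → ℝ) :=
  {x | 0 ≤ x ∧ ∀ y : J → ℝ, 0 ≤ y → v y - ∑ j, q j * y j ≤ v x - ∑ j, q j * x j}

/-- Linear substitutes: when some prices are raised, the demand for the divisible goods whose
prices are unchanged does not decrease. -/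
def LinearSubstitutes {J : Type} [Fintype J] (v : (J → ℝ) → ℝ) : Prop :=
  ∀ q q' : J → ℝ, 0 ≤ q → q ≤ q' → ∀ x ∈ demand v q,
    ∃ x' ∈ demand v q', ∀ j, q j = q' j → x j ≤ x' j

/-! ### Online algorithms -/

/-- Every job that `I` releases by time `t` is, with the same data, a job of `I'`. -/
def ReleasedWithin {M : Type} {S S' : Finset ℕ} (t : ℝ) (I : Instance M S)
    (I' : Instance M S') : Prop :=
  ∀ (j : ℕ) (h : j ∈ S), I.r ⟨j, h⟩ ≤ t → ∃ h' : j ∈ S',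
    I'.r ⟨j, h'⟩ = I.r ⟨j, h⟩ ∧ I'.p ⟨j, h'⟩ = I.p ⟨j, h⟩ ∧ I'.w ⟨j, h'⟩ = I.w ⟨j, h⟩ ∧
      ∀ i, I'.lam i ⟨j, h'⟩ = I.lam i ⟨j, h⟩

/-- A deterministic online (clairvoyant) algorithm: it maps every instance, whose jobs are named
by natural numbers, to a schedule, and its decisions up to time `t` depend only on the jobs
released by time `t`. -/
structure OnlineAlgorithm (M : Type) [Fintype M] where
  run : ∀ {S : Finset ℕ} (I : Instance M S), Schedule I
  causal : ∀ {S S' : Finset ℕ} (I : Instance M S) (I' : Instance M S') (t : ℝ),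
    ReleasedWithin t I I' → ReleasedWithin t I' I →
    ∀ u ≤ t, ∀ (i : M) (j : ℕ) (h : j ∈ S) (h' : j ∈ S'),
      (run I).rate u i ⟨j, h⟩ = (run I').rate u i ⟨j, h'⟩

open Classical in
/-- `σ`, on machines of speed `s`, copies the rates of `ρ`, except that it stops processing a job
once the job is completed by `σ` itself. -/
def FollowsUntilDone {M J : Type} [Fintype M] [Fintype J] {I : Instance M J} (s : ℝ)
    (σ ρ : Schedule I) : Prop :=
  ∀ t i j, σ.rate t i j = if 0 < σ.residual s t j then ρ.rate t i j else 0

end UnrelatedFlow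

end

/-! Reduction to a quadratic program. On one machine with prescribed total times y_j, running the
jobs by decreasing density ρ_j is optimal, and the resulting first moment is half of the quadratic
form with kernel min(ρ_j, ρ_k) (`pairing_le`, `exists_density_order`). The time-indexed program thus
collapses to the minimization of `quad` over the finitely many total times y_ij. This gives
attainment, convexity in the form of subgradients, and explicit dual solutions: a multiplier α_j for
each volume and, for machine i at local time t, the density-weighted load β_i(t) still to come. A
dual constraint contains one α_j and one β_i(t), so two dual solutions can be combined by pointwise
maxima and minima; with weak duality and a rearrangement inequality this yields supermodularity
(`value_supermodular`). The substitutes property is independent of this: prices decouple the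
machines, and one machine facing lower profits has a best response that keeps the shares of the
unaffected jobs (`exists_best_response`).

Potential. Copies of a job merge (`value_comap`), so for ε = 1/n the potential is 2n f(x^A) - 2
f(x^A + (n-1) x^O). Three estimates control it. (a) Descent (`value_sub_le`): gradient steps lower
f(x^A) at rate at least s times the fractional weight. Work planned before the cut pays through the
weight term; work planned after it has a unit fraction of denser jobs in front. (b) Insertion
(`value_insert_le`, `value_combined_le`): putting processed work back in front of an optimal plan
costs its own weight plus the delay of the rest, so the second f falls at rate at most (2s+n-1) W̃^A
plus a term of order n² W^O. As the speed surplus 2ε is multiplied by 2n, the net coefficient of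
W̃^A is at most -1. (c) Releases (`value_release`): supermodularity and convexity show that they do
not raise the potential. The potential is nonpositive at time 0 and nonnegative once the adversary
has finished, so the drift telescopes to the fractional bound (`fracFlow_le`).

Integral objective. The same rates on slightly faster machines leave unfinished only those jobs that
still have a fraction of order ε on the slower ones, so the alive weight is O(1/ε) times the
fractional weight (`weightedFlow_truncate_le`). The run is made online by choosing each optimal
solution as a function of the released jobs and the amounts processed so far
(`ReleasedWithin.gdStepRate_eq`). -/

noncomputable section

namespace UnrelatedFlow

/-! ### One machine: moments, tail loads and the density order -/

section SingleMachine

variable {J : Type} [Fintype J]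

/-- The density-weighted amount of work that `ζ` places on a machine from time `t` on. -/
def tailLoad (ρ : J → ℝ≥0∞) (ζ : J → ℝ → ℝ≥0∞) (t : ℝ) : ℝ≥0∞ :=
  ∑ k, ρ k * ∫⁻ u in Set.Ici t, ζ k u

/-- The density-weighted sum of the first moments of `ζ`. -/
def momentCost (ρ : J → ℝ≥0∞) (ζ : J → ℝ → ℝ≥0∞) : ℝ≥0∞ :=
  ∑ k, ρ k * ∫⁻ u in Set.Ici (0 : ℝ), ENNReal.ofReal u * ζ k u

lemma tailLoad_antitone (ρ : J → ℝ≥0∞) (ζ : J → ℝ → ℝ≥0∞) : Antitone (tailLoad ρ ζ) := by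
  intro s t hst
  unfold tailLoad
  gcongr

lemma sum_lintegral_Ico_le {ζ : J → ℝ → ℝ≥0∞} (hm : ∀ j, Measurable (ζ j))
    (h1 : ∀ t, 0 ≤ t → ∑ j, ζ j t ≤ 1) (t : ℝ) :
    ∑ j, ∫⁻ u in Set.Ico 0 t, ζ j u ≤ ENNReal.ofReal t := by
  rw [← lintegral_finsetSum _ fun j _ => hm j]
  calc ∫⁻ u in Set.Ico 0 t, ∑ j, ζ j u ≤ ∫⁻ u in Set.Ico 0 t, 1 :=
        setLIntegral_mono measurable_const fun u hu => h1 u hu.1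
    _ = ENNReal.ofReal t := by simp

lemma lintegral_Ici_split (g : ℝ → ℝ≥0∞) {t : ℝ} (ht : 0 ≤ t) :
    ∫⁻ u in Set.Ici (0 : ℝ), g u = (∫⁻ u in Set.Ico 0 t, g u) + ∫⁻ u in Set.Ici t, g u := by
  rw [← lintegral_union measurableSet_Ici, Set.Ico_union_Ici_eq_Ici ht]
  exact Set.disjoint_left.2 fun x hx hx' => not_le.2 hx.2 hx'

/-- Volume placed before `t` is charged `r`, and at most `t` units fit there; volume placed later is
charged its own density. This is dual feasibility of the tail load, viewed as the price of machine
capacity at local time `t`. -/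
lemma sum_min_le_tailLoad (ρ : J → ℝ≥0∞) {ζ : J → ℝ → ℝ≥0∞} (hm : ∀ j, Measurable (ζ j))
    (h1 : ∀ t, 0 ≤ t → ∑ j, ζ j t ≤ 1) (r : ℝ≥0∞) {t : ℝ} (ht : 0 ≤ t) :
    ∑ k, min r (ρ k) * ∫⁻ u in Set.Ici (0 : ℝ), ζ k u
      ≤ r * ENNReal.ofReal t + tailLoad ρ ζ t := by
  calc ∑ k, min r (ρ k) * ∫⁻ u in Set.Ici (0 : ℝ), ζ k u
      ≤ ∑ k, (r * (∫⁻ u in Set.Ico 0 t, ζ k u) + ρ k * ∫⁻ u in Set.Ici t, ζ k u) := by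
        refine Finset.sum_le_sum fun k _ => ?_
        rw [lintegral_Ici_split _ ht, mul_add]
        gcongr
        · exact min_le_left _ _
        · exact min_le_right _ _
    _ ≤ _ := by
        rw [Finset.sum_add_distrib, ← Finset.mul_sum]
        gcongr
        · exact sum_lintegral_Ico_le hm h1 t
        · exact le_rfl

lemma lintegral_lintegral_Ici {g : ℝ → ℝ≥0∞} (hg : Measurable g) :
    ∫⁻ t in Set.Ici (0 : ℝ), ∫⁻ u in Set.Ici t, g u
      = ∫⁻ u in Set.Ici (0 : ℝ), ENNReal.ofReal u * g u := by
  have h0 : ∀ t ∈ Set.Ici (0 : ℝ), ∫⁻ u in Set.Ici t, g u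
      = ∫⁻ u in Set.Ici (0 : ℝ), (Set.Ici t).indicator g u := by
    intro t ht
    rw [lintegral_indicator measurableSet_Ici, Measure.restrict_restrict measurableSet_Ici,
      Set.inter_eq_left.2 (Set.Ici_subset_Ici.2 ht)]
  rw [setLIntegral_congr_fun measurableSet_Ici h0, lintegral_lintegral_swap]
  · refine setLIntegral_congr_fun measurableSet_Ici fun u hu => ?_
    have : ∀ t, (Set.Ici t).indicator g u = (Set.Iic u).indicator (fun _ => g u) t := by
      intro t; by_cases h : t ≤ u <;> simp [h]
    simp only [this]
    rw [lintegral_indicator measurableSet_Iic, Measure.restrict_restrict measurableSet_Iic,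
      lintegral_const, Set.Iic_inter_Ici]
    simp [mul_comm]
  · apply Measurable.aemeasurable
    have : (Function.uncurry fun t u => (Set.Ici t).indicator g u)
        = {p : ℝ × ℝ | p.1 ≤ p.2}.indicator (fun p => g p.2) := by
      ext ⟨t, u⟩
      by_cases h : t ≤ u <;> simp [h]
    rw [this]
    exact (hg.comp measurable_snd).indicator (measurableSet_le measurable_fst measurable_snd)

lemma measurable_tailLoad (ρ : J → ℝ≥0∞) (ζ : J → ℝ → ℝ≥0∞) : Measurable (tailLoad ρ ζ) :=
  (tailLoad_antitone ρ ζ).measurable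

/-- Tonelli: work done at local time u is counted by the tail load throughout [0, u]. The total
price of capacity therefore equals the moment. -/
lemma lintegral_tailLoad (ρ : J → ℝ≥0∞) {ζ : J → ℝ → ℝ≥0∞} (hm : ∀ j, Measurable (ζ j)) :
    ∫⁻ t in Set.Ici (0 : ℝ), tailLoad ρ ζ t = momentCost ρ ζ := by
  have hk : ∀ k, Measurable fun t : ℝ => ∫⁻ u in Set.Ici t, ζ k u := fun k =>
    Antitone.measurable fun s t hst => lintegral_mono_set (Set.Ici_subset_Ici.2 hst)
  unfold tailLoad momentCost
  rw [lintegral_finsetSum _ fun k _ => (hk k).const_mul _]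
  refine Finset.sum_congr rfl fun k _ => ?_
  rw [lintegral_const_mul _ (hk k), lintegral_lintegral_Ici (hm k)]

lemma lintegral_pairing_eq (ρ : J → ℝ≥0∞) {ζ ζ' : J → ℝ → ℝ≥0∞} (hm' : ∀ j, Measurable (ζ' j)) :
    ∑ j, ∑ k, min (ρ j) (ρ k) * (∫⁻ u in Set.Ici (0 : ℝ), ζ k u)
        * (∫⁻ u in Set.Ici (0 : ℝ), ζ' j u)
      = ∫⁻ t in Set.Ici (0 : ℝ), ∑ j, (∑ k, min (ρ j) (ρ k) * ∫⁻ u in Set.Ici (0 : ℝ), ζ k u)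
          * ζ' j t := by
  rw [lintegral_finsetSum _ fun j _ => (hm' j).const_mul _]
  refine Finset.sum_congr rfl fun j _ => ?_
  rw [lintegral_const_mul _ (hm' j), Finset.sum_mul]

/-- The plan `ζ'` uses at most one unit of capacity at each time, so it pays at most the integral of
the tail load of `ζ`. -/
lemma lintegral_dual_le (ρ : J → ℝ≥0∞) {ζ ζ' : J → ℝ → ℝ≥0∞} (hm : ∀ j, Measurable (ζ j))
    (hm' : ∀ j, Measurable (ζ' j)) (h1' : ∀ t, 0 ≤ t → ∑ j, ζ' j t ≤ 1) :
    ∫⁻ t in Set.Ici (0 : ℝ), ∑ j, (ρ j * ENNReal.ofReal t + tailLoad ρ ζ t) * ζ' j t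
      ≤ momentCost ρ ζ' + momentCost ρ ζ := by
  have hof : Measurable fun t : ℝ => ENNReal.ofReal t := ENNReal.measurable_ofReal
  have hofm : ∀ j, Measurable fun t => ENNReal.ofReal t * ζ' j t := fun j => hof.mul (hm' j)
  calc ∫⁻ t in Set.Ici (0 : ℝ), ∑ j, (ρ j * ENNReal.ofReal t + tailLoad ρ ζ t) * ζ' j t
      ≤ ∫⁻ t in Set.Ici (0 : ℝ), ((∑ j, ρ j * (ENNReal.ofReal t * ζ' j t)) + tailLoad ρ ζ t) := by
        refine setLIntegral_mono ((Finset.measurable_fun_sum _ fun j _ =>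
          (hof.mul (hm' j)).const_mul _).add (measurable_tailLoad ρ ζ)) fun t ht => ?_
        calc ∑ j, (ρ j * ENNReal.ofReal t + tailLoad ρ ζ t) * ζ' j t
            = (∑ j, ρ j * (ENNReal.ofReal t * ζ' j t)) + tailLoad ρ ζ t * ∑ j, ζ' j t := by
              rw [Finset.mul_sum, ← Finset.sum_add_distrib]
              exact Finset.sum_congr rfl fun j _ => by ring
          _ ≤ (∑ j, ρ j * (ENNReal.ofReal t * ζ' j t)) + tailLoad ρ ζ t * 1 := by
              gcongr
              exact h1' t ht
          _ = _ := by rw [mul_one]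
    _ = _ := by
        rw [lintegral_add_right _ (measurable_tailLoad ρ ζ), lintegral_tailLoad ρ hm,
          lintegral_finsetSum _ fun j _ => (hofm j).const_mul _]
        unfold momentCost
        congr 1
        exact Finset.sum_congr rfl fun j _ => lintegral_const_mul _ (hofm j)

/-- Weak duality, with the tail load of one plan tested against another plan. For `ζ' = ζ` it is the
lower bound on the moment by half the quadratic form in the volumes; for two different plans it
yields semidefiniteness of the kernel. -/
lemma pairing_le (ρ : J → ℝ≥0∞) {ζ ζ' : J → ℝ → ℝ≥0∞} (hm : ∀ j, Measurable (ζ j))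
    (h1 : ∀ t, 0 ≤ t → ∑ j, ζ j t ≤ 1) (hm' : ∀ j, Measurable (ζ' j))
    (h1' : ∀ t, 0 ≤ t → ∑ j, ζ' j t ≤ 1) :
    ∑ j, ∑ k, min (ρ j) (ρ k) * (∫⁻ u in Set.Ici (0 : ℝ), ζ k u)
        * (∫⁻ u in Set.Ici (0 : ℝ), ζ' j u)
      ≤ momentCost ρ ζ' + momentCost ρ ζ := by
  rw [lintegral_pairing_eq ρ hm']
  refine le_trans (lintegral_mono_ae ?_) (lintegral_dual_le ρ hm hm' h1')
  filter_upwards [ae_restrict_mem measurableSet_Ici] with t ht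
  gcongr with j
  exact sum_min_le_tailLoad ρ hm h1 _ ht

/-- Complementary slackness: if the moments of `ζ` are as small as its volumes permit, then almost
everywhere a job is processed only when its dual constraint is tight. -/
lemma ae_tight (ρ : J → ℝ≥0∞) {ζ : J → ℝ → ℝ≥0∞} (hm : ∀ j, Measurable (ζ j))
    (h1 : ∀ t, 0 ≤ t → ∑ j, ζ j t ≤ 1) (hfin : momentCost ρ ζ ≠ ∞)
    (hle : 2 * momentCost ρ ζ ≤ ∑ j, ∑ k, min (ρ j) (ρ k) * (∫⁻ u in Set.Ici (0 : ℝ), ζ k u)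
        * (∫⁻ u in Set.Ici (0 : ℝ), ζ j u)) :
    ∀ᵐ t ∂(volume.restrict (Set.Ici (0 : ℝ))), ∀ j, ζ j t ≠ 0 →
      ∑ k, min (ρ j) (ρ k) * ∫⁻ u in Set.Ici (0 : ℝ), ζ k u
        = ρ j * ENNReal.ofReal t + tailLoad ρ ζ t := by
  have hof : Measurable fun t : ℝ => ENNReal.ofReal t := ENNReal.measurable_ofReal
  have hF : Measurable fun t => ∑ j, (∑ k, min (ρ j) (ρ k) * ∫⁻ u in Set.Ici (0 : ℝ), ζ k u)
      * ζ j t := Finset.measurable_fun_sum _ fun j _ => (hm j).const_mul _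
  have hG : Measurable fun t => ∑ j, (ρ j * ENNReal.ofReal t + tailLoad ρ ζ t) * ζ j t :=
    Finset.measurable_fun_sum _ fun j _ =>
      ((hof.const_mul _).add (measurable_tailLoad ρ ζ)).mul (hm j)
  have hdual := lintegral_dual_le ρ hm hm h1
  rw [lintegral_pairing_eq ρ hm, two_mul] at hle
  have hFG : (fun t => ∑ j, (∑ k, min (ρ j) (ρ k) * ∫⁻ u in Set.Ici (0 : ℝ), ζ k u) * ζ j t)
      ≤ᵐ[volume.restrict (Set.Ici (0 : ℝ))]
      fun t => ∑ j, (ρ j * ENNReal.ofReal t + tailLoad ρ ζ t) * ζ j t := by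
    filter_upwards [ae_restrict_mem measurableSet_Ici] with t ht
    gcongr with j
    exact sum_min_le_tailLoad ρ hm h1 _ ht
  have hGfin : ∫⁻ t in Set.Ici (0 : ℝ), ∑ j, (ρ j * ENNReal.ofReal t + tailLoad ρ ζ t) * ζ j t
      ≠ ∞ := ne_top_of_le_ne_top (by simpa using hfin) hdual
  -- The integrands are ordered pointwise, while the hypothesis orders the finite integrals the
  -- other way; hence they agree almost everywhere.
  have heq := ae_eq_of_ae_le_of_lintegral_le hFG
    (ne_top_of_le_ne_top hGfin (lintegral_mono_ae hFG)) hG.aemeasurable (hdual.trans hle)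
  filter_upwards [heq, ae_lt_top hG hGfin, ae_restrict_mem measurableSet_Ici] with t hteq htfin ht
  intro j hj
  -- A single strict inequality at a job with nonzero rate would make the two sums differ.
  by_contra hne
  have hlt := lt_of_le_of_ne (sum_min_le_tailLoad ρ hm h1 (ρ j) ht) hne
  have hζ : ζ j t ≠ ∞ := ne_top_of_le_ne_top ENNReal.one_ne_top
    ((Finset.single_le_sum (f := fun j => ζ j t) (fun _ _ => zero_le) (Finset.mem_univ j)).trans
      (h1 t ht))
  have hle' : ∀ k, (∑ l, min (ρ k) (ρ l) * ∫⁻ u in Set.Ici (0 : ℝ), ζ l u) * ζ k t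
      ≤ (ρ k * ENNReal.ofReal t + tailLoad ρ ζ t) * ζ k t := fun k => by
    gcongr
    exact sum_min_le_tailLoad ρ hm h1 _ ht
  classical
  refine absurd hteq (ne_of_lt ?_)
  rw [← Finset.add_sum_erase Finset.univ (fun k => (∑ l, min (ρ k) (ρ l)
      * ∫⁻ u in Set.Ici (0 : ℝ), ζ l u) * ζ k t) (Finset.mem_univ j),
    ← Finset.add_sum_erase Finset.univ (fun k => (ρ k * ENNReal.ofReal t + tailLoad ρ ζ t)
      * ζ k t) (Finset.mem_univ j)]
  refine ENNReal.add_lt_add_of_lt_of_le ?_ ((ENNReal.mul_lt_mul_iff_left hj hζ).2 hlt) ?_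
  · refine ne_top_of_le_ne_top (ne_of_lt htfin)
      (le_trans (Finset.sum_le_sum fun k _ => hle' k)
      (Finset.sum_le_sum_of_subset (Finset.erase_subset _ _)))
  · exact Finset.sum_le_sum fun k _ => hle' k

/-- Processing the jobs by decreasing density attains the lower bound on the moments. -/
lemma exists_density_order (ρ y : J → ℝ) (hρ : ∀ j, 0 ≤ ρ j) (hy : ∀ j, 0 ≤ y j) :
    ∃ z : J → ℝ → ℝ, (∀ j, Measurable (z j)) ∧ (∀ j t, 0 ≤ z j t) ∧ (∀ t, ∑ j, z j t ≤ 1) ∧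
      (∀ j, ∫⁻ t in Set.Ici (0 : ℝ), ENNReal.ofReal (z j t) = ENNReal.ofReal (y j)) ∧
      momentCost (fun j => ENNReal.ofReal (ρ j)) (fun j t => ENNReal.ofReal (z j t))
        = ENNReal.ofReal (1 / 2 * ∑ j, ∑ k, min (ρ j) (ρ k) * y j * y k) := by
  classical
  -- The induction also records that the machine is idle after local time ∑ y over `s`, which leaves
  -- room for the next job.
  suffices H : ∀ s : Finset J, ∃ z : J → ℝ → ℝ, (∀ j, Measurable (z j)) ∧ (∀ j t, 0 ≤ z j t) ∧
      (∀ j, j ∉ s → z j = 0) ∧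
      (∀ t, ∑ j ∈ s, z j t ≤ if t < ∑ j ∈ s, y j then 1 else 0) ∧
      (∀ j ∈ s, ∫⁻ t in Set.Ici (0 : ℝ), ENNReal.ofReal (z j t) = ENNReal.ofReal (y j)) ∧
      ∑ j ∈ s, ENNReal.ofReal (ρ j) * ∫⁻ t in Set.Ici (0 : ℝ),
          ENNReal.ofReal t * ENNReal.ofReal (z j t)
        = ENNReal.ofReal (1 / 2 * ∑ j ∈ s, ∑ k ∈ s, min (ρ j) (ρ k) * y j * y k) by
    obtain ⟨z, h1, h2, -, h3, h4, h5⟩ := H Finset.univ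
    refine ⟨z, h1, h2, fun t => (h3 t).trans ?_, fun j => h4 j (Finset.mem_univ j), h5⟩
    split_ifs <;> norm_num
  intro s
  -- The job inserted last has the least density: it goes behind all others, and each minimum with
  -- it is its own density.
  induction s using Finset.induction_on_max_value (fun j => -ρ j) with
  | empty => exact ⟨fun _ _ => 0, by simp [measurable_const], by simp, fun _ _ => rfl,
      fun t => by rw [Finset.sum_empty]; split <;> simp, by simp, by simp⟩
  | insert a s ha hmax ih =>
    obtain ⟨z, h1, h2, h3, h4, h5, h6⟩ := ih
    set Y := ∑ j ∈ s, y j with hY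
    have hY0 : 0 ≤ Y := Finset.sum_nonneg fun j _ => hy j
    set b : ℝ → ℝ := (Set.Ico Y (Y + y a)).indicator (fun _ => 1) with hb
    have hbm : Measurable b := measurable_const.indicator measurableSet_Ico
    have hzs : ∀ j ∈ s, Function.update z a b j = z j := fun j hj =>
      Function.update_of_ne (ne_of_mem_of_not_mem hj ha) _ _
    have hsub : Set.Ico Y (Y + y a) ⊆ Set.Ici (0 : ℝ) := fun t ht => hY0.trans ht.1
    have hbof : ∀ t, ENNReal.ofReal (b t) = (Set.Ico Y (Y + y a)).indicator (fun _ => 1) t := by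
      intro t
      by_cases h : t ∈ Set.Ico Y (Y + y a) <;> simp [hb, h]
    have hint : ∫⁻ t in Set.Ici (0 : ℝ), ENNReal.ofReal t * ENNReal.ofReal (b t)
        = ENNReal.ofReal (Y * y a + y a ^ 2 / 2) := by
      have : ∀ t, ENNReal.ofReal t * ENNReal.ofReal (b t)
          = (Set.Ico Y (Y + y a)).indicator (fun t => ENNReal.ofReal t) t := by
        intro t
        by_cases h : t ∈ Set.Ico Y (Y + y a) <;> simp [hb, h]
      simp only [this]
      rw [lintegral_indicator measurableSet_Ico, Measure.restrict_restrict measurableSet_Ico,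
        Set.inter_eq_left.2 hsub, ← ofReal_integral_eq_lintegral_ofReal]
      · rw [integral_Ico_eq_integral_Ioc, ← intervalIntegral.integral_of_le (by linarith [hy a]),
          integral_id]
        congr 1; ring
      · exact (continuous_id.integrableOn_Icc).mono_set Set.Ico_subset_Icc_self
      · filter_upwards [ae_restrict_mem measurableSet_Ico] with t ht
        exact hsub ht
    refine ⟨Function.update z a b, ?_, ?_, ?_, ?_, ?_, ?_⟩
    · intro j
      by_cases h : j = a
      · subst h; simpa using hbm
      · simpa [Function.update_of_ne h] using h1 j
    · intro j t
      by_cases h : j = a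
      · subst h; simpa [hb] using Set.indicator_nonneg (fun _ _ => zero_le_one) t
      · simpa [Function.update_of_ne h] using h2 j t
    · intro j hj
      rw [Finset.mem_insert, not_or] at hj
      rw [Function.update_of_ne hj.1, h3 j hj.2]
    · intro t
      rw [Finset.sum_insert ha, Finset.sum_insert ha, Function.update_self,
        Finset.sum_congr rfl fun j hj => by rw [hzs j hj], ← hY]
      have := h4 t
      by_cases h : t < Y
      · have h' : t < y a + Y := by linarith [hy a]
        have : b t = 0 := by simp [hb, h]
        rw [if_pos h']; rw [if_pos h] at *; linarith
      · rw [if_neg h] at this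
        by_cases h' : t < y a + Y
        · have : b t = 1 := by simp [hb, not_lt.1 h]; linarith
          rw [if_pos h']; linarith
        · have : b t = 0 := by
            rw [hb, Set.indicator_of_notMem]
            intro ht; exact h' (by linarith [ht.2])
          rw [if_neg h']; linarith
    · intro j hj
      rcases Finset.mem_insert.1 hj with rfl | hj
      · simp only [Function.update_self, hbof]
        rw [lintegral_indicator measurableSet_Ico, Measure.restrict_restrict measurableSet_Ico,
        Set.inter_eq_left.2 hsub]
        simp
      · rw [hzs j hj, h5 j hj]
    · rw [Finset.sum_insert ha, Function.update_self, hint,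
        Finset.sum_congr rfl fun j hj => by rw [hzs j hj], h6, ← ENNReal.ofReal_mul (hρ a),
        ← ENNReal.ofReal_add]
      · congr 1
        rw [Finset.sum_insert ha, Finset.sum_insert ha]
        have e1 : ∑ k ∈ s, min (ρ a) (ρ k) * y a * y k = ρ a * y a * Y := by
          rw [hY, Finset.mul_sum]
          refine Finset.sum_congr rfl fun k hk => ?_
          rw [min_eq_left (by have := hmax k hk; linarith)]
        have e2 : ∑ j ∈ s, ∑ k ∈ insert a s, min (ρ j) (ρ k) * y j * y k
            = ρ a * y a * Y + ∑ j ∈ s, ∑ k ∈ s, min (ρ j) (ρ k) * y j * y k := by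
          rw [hY, Finset.mul_sum, ← Finset.sum_add_distrib]
          refine Finset.sum_congr rfl fun k hk => ?_
          rw [Finset.sum_insert ha, min_eq_right (by have := hmax k hk; linarith)]
          ring
        rw [e1, e2, min_self]
        ring
      · have := hρ a; have := hy a; positivity
      · have : 0 ≤ ∑ j ∈ s, ∑ k ∈ s, min (ρ j) (ρ k) * y j * y k :=
          Finset.sum_nonneg fun j _ => Finset.sum_nonneg fun k _ =>
            mul_nonneg (mul_nonneg (le_min (hρ j) (hρ k)) (hy j)) (hy k)
        positivity

end SingleMachine

/-! ### The quadratic form of the minimum kernel -/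

/-- The bilinear form with kernel `min (ρ j) (ρ k)`; half of its diagonal is the cost of processing
volumes `y` on one machine by decreasing density. -/
def minForm {J : Type} [Fintype J] (ρ y y' : J → ℝ) : ℝ :=
  ∑ j, ∑ k, min (ρ j) (ρ k) * y j * y' k

section MinForm

variable {J : Type} [Fintype J]

lemma minForm_comm (ρ y y' : J → ℝ) : minForm ρ y y' = minForm ρ y' y := by
  unfold minForm
  rw [Finset.sum_comm]
  refine Finset.sum_congr rfl fun j _ => Finset.sum_congr rfl fun k _ => ?_
  rw [min_comm]; ring

lemma minForm_add_left (ρ y d y' : J → ℝ) :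
    minForm ρ (y + d) y' = minForm ρ y y' + minForm ρ d y' := by
  simp only [minForm, ← Finset.sum_add_distrib, Pi.add_apply]
  exact Finset.sum_congr rfl fun j _ => Finset.sum_congr rfl fun k _ => by ring

lemma minForm_smul_left (ρ y y' : J → ℝ) (c : ℝ) : minForm ρ (c • y) y' = c * minForm ρ y y' := by
  simp only [minForm, Finset.mul_sum, Pi.smul_apply, smul_eq_mul]
  exact Finset.sum_congr rfl fun j _ => Finset.sum_congr rfl fun k _ => by ring

lemma minForm_add_self (ρ y d : J → ℝ) :
    minForm ρ (y + d) (y + d) = minForm ρ y y + 2 * minForm ρ y d + minForm ρ d d := by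
  rw [minForm_add_left, minForm_comm ρ y (y + d), minForm_comm ρ d (y + d), minForm_add_left,
    minForm_add_left, minForm_comm ρ d y]
  ring

lemma minForm_mono {ρ y d y' d' : J → ℝ} (hρ : 0 ≤ ρ) (hy : 0 ≤ y) (hyd : y ≤ d) (hy' : 0 ≤ y')
    (hyd' : y' ≤ d') : minForm ρ y y' ≤ minForm ρ d d' := by
  unfold minForm
  refine Finset.sum_le_sum fun j _ => Finset.sum_le_sum fun k _ => ?_
  have h0 : 0 ≤ min (ρ j) (ρ k) := le_min (hρ j) (hρ k)
  exact mul_le_mul (mul_le_mul_of_nonneg_left (hyd j) h0) (hyd' k) (hy' k)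
    (mul_nonneg h0 ((hy j).trans (hyd j)))

lemma minForm_nonneg {ρ y y' : J → ℝ} (hρ : 0 ≤ ρ) (hy : 0 ≤ y) (hy' : 0 ≤ y') :
    0 ≤ minForm ρ y y' :=
  Finset.sum_nonneg fun j _ => Finset.sum_nonneg fun k _ =>
    mul_nonneg (mul_nonneg (le_min (hρ j) (hρ k)) (hy j)) (hy' k)

lemma ofReal_minForm {ρ y y' : J → ℝ} (hρ : 0 ≤ ρ) (hy : 0 ≤ y) (hy' : 0 ≤ y') :
    ENNReal.ofReal (minForm ρ y y') = ∑ j, ∑ k, min (ENNReal.ofReal (ρ j)) (ENNReal.ofReal (ρ k))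
      * ENNReal.ofReal (y' k) * ENNReal.ofReal (y j) := by
  have h0 : ∀ j k, 0 ≤ min (ρ j) (ρ k) * y j * y' k := fun j k =>
    mul_nonneg (mul_nonneg (le_min (hρ j) (hρ k)) (hy j)) (hy' k)
  unfold minForm
  rw [ENNReal.ofReal_sum_of_nonneg fun j _ => Finset.sum_nonneg fun k _ => h0 j k]
  refine Finset.sum_congr rfl fun j _ => ?_
  rw [ENNReal.ofReal_sum_of_nonneg fun k _ => h0 j k]
  refine Finset.sum_congr rfl fun k _ => ?_
  rw [ENNReal.ofReal_mul' (hy' k), ENNReal.ofReal_mul' (hy j), ENNReal.ofReal_mono.map_min]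
  ring

/-- Positive semidefiniteness of the kernel `min (ρ j) (ρ k)`, on nonnegative vectors. -/
lemma minForm_le_half_add_half {ρ y y' : J → ℝ} (hρ : 0 ≤ ρ) (hy : 0 ≤ y) (hy' : 0 ≤ y') :
    minForm ρ y y' ≤ 1 / 2 * minForm ρ y y + 1 / 2 * minForm ρ y' y' := by
  obtain ⟨z, hm, h0, h1, hv, hc⟩ := exists_density_order ρ y hρ hy
  obtain ⟨z', hm', h0', h1', hv', hc'⟩ := exists_density_order ρ y' hρ hy'
  -- Pair the density orders of the two vectors; the moment of each is exactly half of its diagonal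
  -- form.
  have key := pairing_le (fun j => ENNReal.ofReal (ρ j))
    (ζ := fun j t => ENNReal.ofReal (z' j t)) (ζ' := fun j t => ENNReal.ofReal (z j t))
    (fun j => (hm' j).ennreal_ofReal)
    (fun t _ => by
      rw [← ENNReal.ofReal_sum_of_nonneg fun j _ => h0' j t]
      exact ENNReal.ofReal_le_one.2 (h1' t))
    (fun j => (hm j).ennreal_ofReal)
    (fun t _ => by
      rw [← ENNReal.ofReal_sum_of_nonneg fun j _ => h0 j t]
      exact ENNReal.ofReal_le_one.2 (h1 t))
  simp only [hv, hv'] at key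
  rw [← ofReal_minForm hρ hy hy', hc, hc'] at key
  have h2 := minForm_nonneg hρ hy hy
  have h3 := minForm_nonneg hρ hy' hy'
  unfold minForm at h2 h3 ⊢
  rw [← ENNReal.ofReal_add (by positivity) (by positivity),
    ENNReal.ofReal_le_ofReal_iff (by positivity)] at key
  exact key

end MinForm

/-! ### The residual program as a quadratic program in the total times -/

namespace Instance

/-- The density `w_j / p_ij` of job `j` on machine `i`. -/
def dens {M J : Type} (I : Instance M J) (i : M) (j : J) : ℝ := I.w j * I.lam i j / I.p j

lemma dens_nonneg {M J : Type} (I : Instance M J) (i : M) : 0 ≤ I.dens i := fun j =>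
  div_nonneg (mul_nonneg (I.w_pos j).le (I.lam_nonneg i j)) (I.p_pos j).le

variable {M J : Type} [Fintype M] [Fintype J]

/-- The residual program in terms of the total time `y i j` that machine `i` spends on `j`. -/
def quad (I : Instance M J) (y : M → J → ℝ) : ℝ :=
  ∑ i, (1 / 2 * minForm (I.dens i) (y i) (y i) + ∑ j, I.w j * y i j)

/-- `y` distributes the volumes `x` over the machines. -/
structure Splits (I : Instance M J) (x : J → ℝ) (y : M → J → ℝ) : Prop where
  nonneg : 0 ≤ y
  volume : ∀ j, ∑ i, I.lam i j * y i j = x j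

/-- The partial derivatives of `quad`. -/
def marginal (I : Instance M J) (y : M → J → ℝ) (i : M) (j : J) : ℝ :=
  I.w j + ∑ k, min (I.dens i j) (I.dens i k) * y i k

lemma sum_marginal_mul (I : Instance M J) (y d : M → J → ℝ) :
    ∑ i, ∑ j, I.marginal y i j * d i j
      = ∑ i, (minForm (I.dens i) (y i) (d i) + ∑ j, I.w j * d i j) := by
  refine Finset.sum_congr rfl fun i _ => ?_
  rw [minForm_comm]
  simp only [marginal, minForm, add_mul, Finset.sum_add_distrib, Finset.sum_mul]
  rw [add_comm]
  congr 1
  exact Finset.sum_congr rfl fun j _ => Finset.sum_congr rfl fun k _ => by ring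

lemma quad_add (I : Instance M J) (y d : M → J → ℝ) :
    I.quad (y + d) = I.quad y + ∑ i, ∑ j, I.marginal y i j * d i j
      + 1 / 2 * ∑ i, minForm (I.dens i) (d i) (d i) := by
  rw [sum_marginal_mul, quad, quad, Finset.mul_sum, ← Finset.sum_add_distrib,
    ← Finset.sum_add_distrib]
  refine Finset.sum_congr rfl fun i _ => ?_
  simp only [Pi.add_apply, minForm_add_self, mul_add, Finset.sum_add_distrib]
  ring

lemma quad_mono (I : Instance M J) {y d : M → J → ℝ} (hy : 0 ≤ y) (hyd : y ≤ d) :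
    I.quad y ≤ I.quad d := by
  refine Finset.sum_le_sum fun i _ => add_le_add ?_ (Finset.sum_le_sum fun j _ => ?_)
  · exact mul_le_mul_of_nonneg_left
      (minForm_mono (I.dens_nonneg i) (hy i) (hyd i) (hy i) (hyd i)) (by norm_num)
  · exact mul_le_mul_of_nonneg_left (hyd i j) (I.w_pos j).le

lemma mul_le_quad (I : Instance M J) {y : M → J → ℝ} (hy : 0 ≤ y) (i : M) (j : J) :
    I.w j * y i j ≤ I.quad y := by
  have h1 : ∀ i, 0 ≤ 1 / 2 * minForm (I.dens i) (y i) (y i) := fun i =>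
    mul_nonneg (by norm_num) (minForm_nonneg (I.dens_nonneg i) (hy i) (hy i))
  have h2 : ∀ i j, 0 ≤ I.w j * y i j := fun i j => mul_nonneg (I.w_pos j).le (hy i j)
  calc I.w j * y i j ≤ ∑ j, I.w j * y i j :=
        Finset.single_le_sum (f := fun j => I.w j * y i j) (fun j _ => h2 i j) (Finset.mem_univ j)
    _ ≤ 1 / 2 * minForm (I.dens i) (y i) (y i) + ∑ j, I.w j * y i j := le_add_of_nonneg_left (h1 i)
    _ ≤ _ := Finset.single_le_sum
        (f := fun i => 1 / 2 * minForm (I.dens i) (y i) (y i) + ∑ j, I.w j * y i j)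
        (fun i _ => add_nonneg (h1 i) (Finset.sum_nonneg fun j _ => h2 i j)) (Finset.mem_univ i)

lemma quad_nonneg (I : Instance M J) {y : M → J → ℝ} (hy : 0 ≤ y) : 0 ≤ I.quad y :=
  Finset.sum_nonneg fun i _ => add_nonneg
    (mul_nonneg (by norm_num) (minForm_nonneg (I.dens_nonneg i) (hy i) (hy i)))
    (Finset.sum_nonneg fun j _ => mul_nonneg (I.w_pos j).le (hy i j))

lemma continuous_quad (I : Instance M J) : Continuous I.quad := by
  unfold quad minForm
  fun_prop

lemma lpCost_eq (I : Instance M J) (z : M → J → ℝ → ℝ) :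
    I.lpCost z = ∑ i, (momentCost (fun j => ENNReal.ofReal (I.dens i j))
        (fun j t => ENNReal.ofReal (z i j t))
      + ∑ j, ENNReal.ofReal (I.w j) * ∫⁻ t in Set.Ici (0 : ℝ), ENNReal.ofReal (z i j t)) := by
  rw [Finset.sum_add_distrib, lpCost]
  congr 1
  refine Finset.sum_congr rfl fun i _ => Finset.sum_congr rfl fun j _ => ?_
  rw [setLIntegral_congr_fun measurableSet_Ici fun t ht => ENNReal.ofReal_mul ht]
  rfl

lemma LPFeasible.sum_ofReal_le_one {I : Instance M J} {x : J → ℝ} {z : M → J → ℝ → ℝ}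
    (hz : I.LPFeasible x z) (i : M) (t : ℝ) (ht : 0 ≤ t) :
    ∑ j, ENNReal.ofReal (z i j t) ≤ 1 := by
  rw [← ENNReal.ofReal_sum_of_nonneg fun j _ => hz.nonneg i j t ht]
  exact ENNReal.ofReal_le_one.2 (hz.machine_le_one i t ht)

/-- Positive weights turn finite cost into finite total times, even on machines of speed zero, which
the volume constraints do not see. -/
lemma LPFeasible.exists_splits {I : Instance M J} {x : J → ℝ} {z : M → J → ℝ → ℝ}
    (hz : I.LPFeasible x z) (hx : 0 ≤ x) (hfin : I.lpCost z ≠ ∞) :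
    ∃ y, I.Splits x y ∧
      ∀ i j, ∫⁻ t in Set.Ici (0 : ℝ), ENNReal.ofReal (z i j t) = ENNReal.ofReal (y i j) := by
  have hv : ∀ i j, ∫⁻ t in Set.Ici (0 : ℝ), ENNReal.ofReal (z i j t) ≠ ∞ := by
    intro i j htop
    apply hfin
    rw [lpCost_eq, ENNReal.sum_eq_top]
    refine ⟨i, Finset.mem_univ i, ?_⟩
    rw [ENNReal.add_eq_top, ENNReal.sum_eq_top]
    refine Or.inr ⟨j, Finset.mem_univ j, ?_⟩
    rw [htop, ENNReal.mul_top]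
    simpa using I.w_pos j
  refine ⟨fun i j => (∫⁻ t in Set.Ici (0 : ℝ), ENNReal.ofReal (z i j t)).toReal,
    ⟨fun i j => ENNReal.toReal_nonneg, fun j => ?_⟩, fun i j => (ENNReal.ofReal_toReal (hv i j)).symm⟩
  have h := hz.volume_eq j
  have h2 : ∀ i, ∫⁻ t in Set.Ici (0 : ℝ), ENNReal.ofReal (I.lam i j * z i j t)
      = ENNReal.ofReal (I.lam i j) * ∫⁻ t in Set.Ici (0 : ℝ), ENNReal.ofReal (z i j t) := by
    intro i
    simp only [ENNReal.ofReal_mul (I.lam_nonneg i j)]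
    exact lintegral_const_mul _ (hz.measurable i j).ennreal_ofReal
  simp only [h2] at h
  have h3 := congrArg ENNReal.toReal h
  rw [ENNReal.toReal_sum fun i _ => ENNReal.mul_ne_top ENNReal.ofReal_ne_top (hv i j),
    ENNReal.toReal_ofReal (hx j)] at h3
  rw [← h3]
  exact Finset.sum_congr rfl fun i _ => by
    rw [ENNReal.toReal_mul, ENNReal.toReal_ofReal (I.lam_nonneg i j)]

lemma LPFeasible.two_momentCost_ge {I : Instance M J} {x : J → ℝ} {z : M → J → ℝ → ℝ}
    (hz : I.LPFeasible x z) {y : M → J → ℝ} (hy : 0 ≤ y)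
    (hv : ∀ i j, ∫⁻ t in Set.Ici (0 : ℝ), ENNReal.ofReal (z i j t) = ENNReal.ofReal (y i j))
    (i : M) :
    ENNReal.ofReal (1 / 2 * minForm (I.dens i) (y i) (y i))
      ≤ momentCost (fun j => ENNReal.ofReal (I.dens i j)) (fun j t => ENNReal.ofReal (z i j t)) := by
  have key := pairing_le (fun j => ENNReal.ofReal (I.dens i j))
    (ζ := fun j t => ENNReal.ofReal (z i j t)) (ζ' := fun j t => ENNReal.ofReal (z i j t))
    (fun j => (hz.measurable i j).ennreal_ofReal) (hz.sum_ofReal_le_one i)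
    (fun j => (hz.measurable i j).ennreal_ofReal) (hz.sum_ofReal_le_one i)
  simp only [hv] at key
  rw [← ofReal_minForm (I.dens_nonneg i) (hy i) (hy i), ← two_mul] at key
  rw [ENNReal.ofReal_mul (by norm_num)]
  calc _ ≤ ENNReal.ofReal (1 / 2) * (2 * _) := by gcongr
    _ = _ := by
      rw [← mul_assoc, show (2 : ℝ≥0∞) = ENNReal.ofReal 2 by simp,
        ← ENNReal.ofReal_mul (by norm_num)]
      norm_num

lemma ofReal_quad (I : Instance M J) {y : M → J → ℝ} (hy : 0 ≤ y) :
    ENNReal.ofReal (I.quad y) = ∑ i, (ENNReal.ofReal (1 / 2 * minForm (I.dens i) (y i) (y i))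
      + ∑ j, ENNReal.ofReal (I.w j) * ENNReal.ofReal (y i j)) := by
  have h1 : ∀ i, 0 ≤ 1 / 2 * minForm (I.dens i) (y i) (y i) := fun i =>
    mul_nonneg (by norm_num) (minForm_nonneg (I.dens_nonneg i) (hy i) (hy i))
  have h2 : ∀ i j, 0 ≤ I.w j * y i j := fun i j => mul_nonneg (I.w_pos j).le (hy i j)
  rw [quad, ENNReal.ofReal_sum_of_nonneg fun i _ =>
    add_nonneg (h1 i) (Finset.sum_nonneg fun j _ => h2 i j)]
  refine Finset.sum_congr rfl fun i _ => ?_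
  rw [ENNReal.ofReal_add (h1 i) (Finset.sum_nonneg fun j _ => h2 i j),
    ENNReal.ofReal_sum_of_nonneg fun j _ => h2 i j]
  simp only [ENNReal.ofReal_mul (I.w_pos _).le]

lemma LPFeasible.quad_le {I : Instance M J} {x : J → ℝ} {z : M → J → ℝ → ℝ}
    (hz : I.LPFeasible x z) {y : M → J → ℝ} (hy : 0 ≤ y)
    (hv : ∀ i j, ∫⁻ t in Set.Ici (0 : ℝ), ENNReal.ofReal (z i j t) = ENNReal.ofReal (y i j)) :
    ENNReal.ofReal (I.quad y) ≤ I.lpCost z := by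
  rw [lpCost_eq, ofReal_quad I hy]
  simp only [hv]
  gcongr with i
  exact hz.two_momentCost_ge hy hv i

/-- Using the density order on every machine attains the lower bound of `LPFeasible.quad_le`. -/
lemma Splits.exists_lpFeasible {I : Instance M J} {x : J → ℝ} {y : M → J → ℝ}
    (hy : I.Splits x y) : ∃ z, I.LPFeasible x z ∧
      (∀ i j, ∫⁻ t in Set.Ici (0 : ℝ), ENNReal.ofReal (z i j t) = ENNReal.ofReal (y i j)) ∧
      (∀ i, momentCost (fun j => ENNReal.ofReal (I.dens i j)) (fun j t => ENNReal.ofReal (z i j t))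
        = ENNReal.ofReal (1 / 2 * minForm (I.dens i) (y i) (y i))) ∧
      I.lpCost z = ENNReal.ofReal (I.quad y) := by
  choose z hm h0 h1 hv hc using fun i =>
    exists_density_order (I.dens i) (y i) (I.dens_nonneg i) (hy.nonneg i)
  refine ⟨z, ⟨hm, fun i j t _ => h0 i j t, fun i t _ => h1 i t, fun j => ?_⟩, hv, hc, ?_⟩
  · rw [← hy.volume j, ENNReal.ofReal_sum_of_nonneg fun i _ =>
      mul_nonneg (I.lam_nonneg i j) (hy.nonneg i j)]
    refine Finset.sum_congr rfl fun i _ => ?_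
    simp only [ENNReal.ofReal_mul (I.lam_nonneg i j)]
    rw [lintegral_const_mul _ (hm i j).ennreal_ofReal, hv]
  · rw [lpCost_eq, ofReal_quad I hy.nonneg]
    simp only [hc, hv]
    rfl

lemma exists_splits {M J : Type} [Fintype M] (I : Instance M J) {x : J → ℝ} (hx : 0 ≤ x) : ∃ y, I.Splits x y := by
  classical
  choose m hm using I.exists_lam_pos
  refine ⟨fun i j => if i = m j then x j / I.lam i j else 0, fun i j => ?_, fun j => ?_⟩
  · show 0 ≤ if i = m j then x j / I.lam i j else 0
    split
    · exact div_nonneg (hx j) (I.lam_nonneg i j)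
    · exact le_rfl
  · simp only [mul_ite, mul_zero, Finset.sum_ite_eq', Finset.mem_univ, if_true]
    exact mul_div_cancel₀ _ (hm j).ne'

/-- Since w_j y_ij ≤ `quad`, sublevel sets are bounded, and a minimum over the closed set of
splittings exists by compactness. -/
lemma exists_isMin_quad (I : Instance M J) {x : J → ℝ} (hx : 0 ≤ x) :
    ∃ y, I.Splits x y ∧ ∀ y', I.Splits x y' → I.quad y ≤ I.quad y' := by
  obtain ⟨y₀, hy₀⟩ := I.exists_splits hx
  have hclosed : IsClosed {y : M → J → ℝ | I.Splits x y} := by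
    have : {y : M → J → ℝ | I.Splits x y}
        = {y | 0 ≤ y} ∩ ⋂ j, {y | ∑ i, I.lam i j * y i j = x j} := by
      ext y
      simp only [Set.mem_ofPred_eq, Set.mem_inter_iff, Set.mem_iInter]
      exact ⟨fun h => ⟨h.1, h.2⟩, fun h => ⟨h.1, h.2⟩⟩
    rw [this]
    exact (isClosed_le continuous_const continuous_id).inter
      (isClosed_iInter fun j => isClosed_eq (by fun_prop) continuous_const)
  have hcomp : IsCompact ({y : M → J → ℝ | I.Splits x y}
      ∩ Set.Icc 0 fun _ j => I.quad y₀ / I.w j) := isCompact_Icc.inter_left hclosed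
  have hmem : ∀ y, I.Splits x y → I.quad y ≤ I.quad y₀ →
      y ∈ ({y : M → J → ℝ | I.Splits x y} ∩ Set.Icc 0 fun _ j => I.quad y₀ / I.w j) := by
    intro y hy hle
    refine ⟨hy, hy.nonneg, fun i j => ?_⟩
    rw [le_div_iff₀ (I.w_pos j), mul_comm]
    exact (I.mul_le_quad hy.nonneg i j).trans hle
  obtain ⟨y, hy, hmin⟩ := hcomp.exists_isMinOn ⟨y₀, hmem y₀ hy₀ le_rfl⟩ I.continuous_quad.continuousOn
  refine ⟨y, hy.1, fun y' hy' => ?_⟩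
  by_cases h : I.quad y' ≤ I.quad y₀
  · exact hmin (hmem y' hy' h)
  · exact (hmin (hmem y₀ hy₀ le_rfl) : I.quad y ≤ I.quad y₀).trans (not_le.1 h).le

/-- A plan of finite cost pays at least `quad` of its total times, and a density order pays exactly
that, so only the total times remain to be optimized. -/
lemma lpValue_eq_of_isMin (I : Instance M J) {x : J → ℝ} (hx : 0 ≤ x) {y : M → J → ℝ}
    (hy : I.Splits x y) (hmin : ∀ y', I.Splits x y' → I.quad y ≤ I.quad y') :
    I.lpValue x = ENNReal.ofReal (I.quad y) := by
  apply le_antisymm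
  · obtain ⟨z, hz, -, -, hc⟩ := hy.exists_lpFeasible
    rw [← hc]
    exact iInf₂_le z hz
  · refine le_iInf₂ fun z hz => ?_
    by_cases hfin : I.lpCost z = ∞
    · rw [hfin]; exact le_top
    · obtain ⟨y', hy', hv⟩ := hz.exists_splits hx hfin
      exact (ENNReal.ofReal_le_ofReal (hmin y' hy')).trans (hz.quad_le hy'.nonneg hv)

/-- The residual optimum as a real number. -/
def value (I : Instance M J) (x : J → ℝ) : ℝ := (I.lpValue x).toReal

lemma lpValue_ne_top (I : Instance M J) {x : J → ℝ} (hx : 0 ≤ x) : I.lpValue x ≠ ∞ := by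
  obtain ⟨y, hy, hmin⟩ := I.exists_isMin_quad hx
  rw [I.lpValue_eq_of_isMin hx hy hmin]
  exact ENNReal.ofReal_ne_top

lemma ofReal_value (I : Instance M J) {x : J → ℝ} (hx : 0 ≤ x) :
    ENNReal.ofReal (I.value x) = I.lpValue x := ENNReal.ofReal_toReal (I.lpValue_ne_top hx)

lemma exists_lpOptimal (I : Instance M J) {x : J → ℝ} (hx : 0 ≤ x) : ∃ z, I.LPOptimal x z := by
  obtain ⟨y, hy, hmin⟩ := I.exists_isMin_quad hx
  obtain ⟨z, hz, -, -, hc⟩ := hy.exists_lpFeasible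
  exact ⟨z, hz, hc.trans (I.lpValue_eq_of_isMin hx hy hmin).symm⟩

lemma value_nonneg (I : Instance M J) (x : J → ℝ) : 0 ≤ I.value x := ENNReal.toReal_nonneg

lemma exists_value_eq (I : Instance M J) {x : J → ℝ} (hx : 0 ≤ x) :
    ∃ y, I.Splits x y ∧ I.value x = I.quad y := by
  obtain ⟨y, hy, hmin⟩ := I.exists_isMin_quad hx
  refine ⟨y, hy, ?_⟩
  rw [value, I.lpValue_eq_of_isMin hx hy hmin, ENNReal.toReal_ofReal (I.quad_nonneg hy.nonneg)]

lemma Splits.nonneg_volume {M J : Type} [Fintype M] {I : Instance M J} {x : J → ℝ} {y : M → J → ℝ} (hy : I.Splits x y) :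
    0 ≤ x := fun j => by
  rw [← hy.volume j]
  exact Finset.sum_nonneg fun i _ => mul_nonneg (I.lam_nonneg i j) (hy.nonneg i j)

lemma Splits.value_le {I : Instance M J} {x : J → ℝ} {y : M → J → ℝ} (hy : I.Splits x y) :
    I.value x ≤ I.quad y := by
  obtain ⟨y', hy', hmin⟩ := I.exists_isMin_quad hy.nonneg_volume
  rw [value, I.lpValue_eq_of_isMin hy.nonneg_volume hy' hmin,
    ENNReal.toReal_ofReal (I.quad_nonneg hy'.nonneg)]
  exact hmin y hy

/-! ### Duality and supermodularity -/

/-- First-order optimality: the multipliers `α` of the volume constraints. -/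
lemma exists_multipliers (I : Instance M J) {x : J → ℝ} {y : M → J → ℝ} (hy : I.Splits x y)
    (hmin : I.value x = I.quad y) : ∃ α : J → ℝ, 0 ≤ α ∧
      (∀ i j, I.lam i j * α j ≤ I.marginal y i j) ∧
      ∑ j, α j * x j = ∑ i, ∑ j, I.marginal y i j * y i j := by
  classical
  have hx := hy.nonneg_volume
  have hmarg : ∀ i j, 0 ≤ I.marginal y i j := fun i j => add_nonneg (I.w_pos j).le
    (Finset.sum_nonneg fun k _ => mul_nonneg (le_min (I.dens_nonneg i j) (I.dens_nonneg i k))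
      (hy.nonneg i k))
  have hex : ∀ j, ∃ i, 0 < I.lam i j ∧ ∀ i', 0 < I.lam i' j →
      I.marginal y i j / I.lam i j ≤ I.marginal y i' j / I.lam i' j := by
    intro j
    obtain ⟨i, hi, hle⟩ := Finset.exists_min_image (Finset.univ.filter fun i => 0 < I.lam i j)
      (fun i => I.marginal y i j / I.lam i j)
      (by obtain ⟨i, hi⟩ := I.exists_lam_pos j; exact ⟨i, by simpa using hi⟩)
    exact ⟨i, by simpa using hi, fun i' hi' => hle i' (by simpa using hi')⟩
  choose m hm hle using hex
  -- The multiplier of a job is its least marginal cost per unit of volume.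
  set α : J → ℝ := fun j => I.marginal y (m j) j / I.lam (m j) j with hα
  have hdual : ∀ i j, I.lam i j * α j ≤ I.marginal y i j := by
    intro i j
    rcases (I.lam_nonneg i j).eq_or_lt with h | h
    · rw [← h, zero_mul]; exact hmarg i j
    · have := hle j i h
      rwa [le_div_iff₀ h, mul_comm] at this
  refine ⟨α, fun j => div_nonneg (hmarg _ _) (I.lam_nonneg _ _), hdual, le_antisymm ?_ ?_⟩
  · rw [Finset.sum_comm]
    refine Finset.sum_le_sum fun j _ => ?_
    rw [← hy.volume j, Finset.mul_sum]
    refine Finset.sum_le_sum fun i _ => ?_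
    calc α j * (I.lam i j * y i j) = (I.lam i j * α j) * y i j := by ring
      _ ≤ _ := mul_le_mul_of_nonneg_right (hdual i j) (hy.nonneg i j)
  -- The comparison solution moves each job to its cheapest machine `m j`; linearized at `y`, it
  -- costs exactly ∑ α_j x_j.
  · set y' : M → J → ℝ := fun i j => if i = m j then x j / I.lam i j else 0 with hy'def
    have hy'0 : 0 ≤ y' := by
      intro i j
      show 0 ≤ if i = m j then x j / I.lam i j else 0
      split
      · exact div_nonneg (hx j) (I.lam_nonneg i j)
      · exact le_rfl
    have hy'v : ∀ j, ∑ i, I.lam i j * y' i j = x j := by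
      intro j
      simp only [hy'def, mul_ite, mul_zero, Finset.sum_ite_eq', Finset.mem_univ, if_true]
      exact mul_div_cancel₀ _ (hm j).ne'
    have hcost : ∑ i, ∑ j, I.marginal y i j * y' i j = ∑ j, α j * x j := by
      rw [Finset.sum_comm]
      refine Finset.sum_congr rfl fun j _ => ?_
      simp only [hy'def, mul_ite, mul_zero, Finset.sum_ite_eq', Finset.mem_univ, if_true, hα]
      ring
    rw [← hcost]
    set D := ∑ i, ∑ j, I.marginal y i j * (y' i j - y i j) with hD
    have hDeq : D = ∑ i, ∑ j, I.marginal y i j * y' i j - ∑ i, ∑ j, I.marginal y i j * y i j := by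
      simp only [hD, mul_sub, Finset.sum_sub_distrib]
    set E := ∑ i, minForm (I.dens i) (y' i - y i) (y' i - y i) with hE
    -- Quadratic expansion along the segment from `y` to `y'`, on which `y` is minimal.
    have hvar : ∀ c : ℝ, 0 ≤ c → c ≤ 1 → 0 ≤ c * D + c ^ 2 * (1 / 2 * E) := by
      intro c hc0 hc1
      have hs : I.Splits x (y + c • (y' - y)) := by
        constructor
        · intro i j
          have h1 := mul_nonneg (sub_nonneg.2 hc1) (hy.nonneg i j)
          have h2 := mul_nonneg hc0 (hy'0 i j)
          show 0 ≤ y i j + c * (y' i j - y i j)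
          linarith
        · intro j
          have : ∀ i, I.lam i j * (y + c • (y' - y)) i j
              = (1 - c) * (I.lam i j * y i j) + c * (I.lam i j * y' i j) := fun i => by
            simp only [Pi.add_apply, Pi.smul_apply, Pi.sub_apply, smul_eq_mul]; ring
          simp only [this, Finset.sum_add_distrib, ← Finset.mul_sum, hy'v, hy.volume]
          ring
      have h := hs.value_le
      rw [hmin, quad_add] at h
      have e1 : ∑ i, ∑ j, I.marginal y i j * (c • (y' - y)) i j = c * D := by
        simp only [hD, Finset.mul_sum, Pi.smul_apply, Pi.sub_apply, smul_eq_mul]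
        exact Finset.sum_congr rfl fun i _ => Finset.sum_congr rfl fun j _ => by ring
      have e2 : ∑ i, minForm (I.dens i) ((c • (y' - y)) i) ((c • (y' - y)) i) = c ^ 2 * E := by
        rw [hE, Finset.mul_sum]
        refine Finset.sum_congr rfl fun i _ => ?_
        show minForm (I.dens i) (c • (y' i - y i)) (c • (y' i - y i)) = _
        rw [minForm_smul_left, minForm_comm, minForm_smul_left]
        ring
      rw [e1, e2] at h
      linarith
    by_contra hcon
    have hDneg : D < 0 := by rw [hDeq]; linarith [not_le.1 hcon]
    have h1 := hvar 1 zero_le_one le_rfl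
    -- The case c = 1 gives E ≥ -2D > 0. Hence c = -D/E lies in [0, 1], where the expansion equals
    -- -D²/(2E) < 0.
    have hEpos : 0 < E := by nlinarith
    have h2 := hvar (-D / E) (div_nonneg (by linarith) hEpos.le)
      (by rw [div_le_one hEpos]; linarith)
    have : -D / E * D + (-D / E) ^ 2 * (1 / 2 * E) = -(D ^ 2 / (2 * E)) := by
      field_simp
      ring
    rw [this] at h2
    have : 0 < D ^ 2 / (2 * E) := by
      have h := mul_pos_of_neg_of_neg hDneg hDneg
      rw [← sq] at h
      positivity
    linarith

/-- The multipliers form a subgradient of the residual optimum. -/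
lemma exists_subgradient (I : Instance M J) {x : J → ℝ} (hx : 0 ≤ x) : ∃ α : J → ℝ,
    ∀ x', 0 ≤ x' → I.value x + ∑ j, α j * (x' j - x j) ≤ I.value x' := by
  obtain ⟨y, hy, hval⟩ := I.exists_value_eq hx
  obtain ⟨α, -, hdual, hsum⟩ := I.exists_multipliers hy hval
  refine ⟨α, fun x' hx' => ?_⟩
  obtain ⟨y', hy', hval'⟩ := I.exists_value_eq hx'
  have h1 : ∑ j, α j * x' j ≤ ∑ i, ∑ j, I.marginal y i j * y' i j := by
    rw [Finset.sum_comm]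
    refine Finset.sum_le_sum fun j _ => ?_
    rw [← hy'.volume j, Finset.mul_sum]
    refine Finset.sum_le_sum fun i _ => ?_
    calc α j * (I.lam i j * y' i j) = (I.lam i j * α j) * y' i j := by ring
      _ ≤ _ := mul_le_mul_of_nonneg_right (hdual i j) (hy'.nonneg i j)
  rw [sum_marginal_mul] at h1 hsum
  -- Semidefiniteness of the kernel bounds the cross term; this is the convexity of the program.
  have h2 : ∑ i, minForm (I.dens i) (y i) (y' i)
      ≤ 1 / 2 * (∑ i, minForm (I.dens i) (y i) (y i))
        + 1 / 2 * ∑ i, minForm (I.dens i) (y' i) (y' i) := by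
    rw [Finset.mul_sum, Finset.mul_sum, ← Finset.sum_add_distrib]
    exact Finset.sum_le_sum fun i _ =>
      minForm_le_half_add_half (I.dens_nonneg i) (hy.nonneg i) (hy'.nonneg i)
  rw [hval, hval', quad, quad]
  simp only [mul_sub, Finset.sum_sub_distrib, Finset.sum_add_distrib, ← Finset.mul_sum] at *
  linarith

/-- Strong duality: `α` and the tail loads `β` of an optimal solution certify the optimum. -/
lemma exists_certificate (I : Instance M J) {x : J → ℝ} (hx : 0 ≤ x) :
    ∃ (α : J → ℝ) (β : M → ℝ → ℝ≥0∞) (b : ℝ), 0 ≤ α ∧ (∀ i, Measurable (β i)) ∧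
      (∀ i j t, 0 ≤ t → ENNReal.ofReal (I.lam i j * α j) ≤ ENNReal.ofReal (I.w j)
        + ENNReal.ofReal (I.dens i j) * ENNReal.ofReal t + β i t) ∧ 0 ≤ b ∧
      ∑ i, ∫⁻ t in Set.Ici (0 : ℝ), β i t = ENNReal.ofReal b ∧
      I.value x + b = ∑ j, α j * x j := by
  obtain ⟨y, hy, hval⟩ := I.exists_value_eq hx
  obtain ⟨α, hα, hdual, hsum⟩ := I.exists_multipliers hy hval
  obtain ⟨z, hz, hv, hc, -⟩ := hy.exists_lpFeasible
  have hpos : ∀ i, 0 ≤ 1 / 2 * minForm (I.dens i) (y i) (y i) := fun i =>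
    mul_nonneg (by norm_num) (minForm_nonneg (I.dens_nonneg i) (hy.nonneg i) (hy.nonneg i))
  -- The number `b` is the moment part of the optimal cost and, by `lintegral_tailLoad`, the total
  -- price of capacity. The value is b plus the weight part, while ∑ α_j x_j is 2b plus the weight
  -- part.
  refine ⟨α, fun i => tailLoad (fun j => ENNReal.ofReal (I.dens i j))
      (fun j t => ENNReal.ofReal (z i j t)),
    ∑ i, 1 / 2 * minForm (I.dens i) (y i) (y i), hα, fun i => measurable_tailLoad _ _, ?_,
    Finset.sum_nonneg fun i _ => hpos i, ?_, ?_⟩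
  · intro i j t ht
    calc ENNReal.ofReal (I.lam i j * α j) ≤ ENNReal.ofReal (I.marginal y i j) :=
          ENNReal.ofReal_le_ofReal (hdual i j)
      _ = ENNReal.ofReal (I.w j) + ∑ k, min (ENNReal.ofReal (I.dens i j))
            (ENNReal.ofReal (I.dens i k)) * ∫⁻ t in Set.Ici (0 : ℝ), ENNReal.ofReal (z i k t) := by
          have h0 : ∀ k, 0 ≤ min (I.dens i j) (I.dens i k) * y i k := fun k =>
            mul_nonneg (le_min (I.dens_nonneg i j) (I.dens_nonneg i k)) (hy.nonneg i k)
          rw [marginal, ENNReal.ofReal_add (I.w_pos j).le (Finset.sum_nonneg fun k _ => h0 k),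
            ENNReal.ofReal_sum_of_nonneg fun k _ => h0 k]
          congr 1
          refine Finset.sum_congr rfl fun k _ => ?_
          rw [ENNReal.ofReal_mul' (hy.nonneg i k), ENNReal.ofReal_mono.map_min, hv]
      _ ≤ _ := by
          rw [add_assoc]
          gcongr
          exact sum_min_le_tailLoad (fun j => ENNReal.ofReal (I.dens i j))
            (ζ := fun j t => ENNReal.ofReal (z i j t))
            (fun j => (hz.measurable i j).ennreal_ofReal) (hz.sum_ofReal_le_one i) _ ht
  · rw [ENNReal.ofReal_sum_of_nonneg fun i _ => hpos i]
    refine Finset.sum_congr rfl fun i _ => ?_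
    rw [lintegral_tailLoad _ fun j => (hz.measurable i j).ennreal_ofReal, hc]
  · rw [hsum, sum_marginal_mul, hval, quad]
    simp only [Finset.sum_add_distrib, ← Finset.mul_sum]
    ring

/-- Weak duality. -/
lemma weak_duality (I : Instance M J) {x : J → ℝ} (hx : 0 ≤ x) {α : J → ℝ} (hα : 0 ≤ α)
    {β : M → ℝ → ℝ≥0∞} (hβ : ∀ i, Measurable (β i))
    (hdual : ∀ i j t, 0 ≤ t → ENNReal.ofReal (I.lam i j * α j) ≤ ENNReal.ofReal (I.w j)
        + ENNReal.ofReal (I.dens i j) * ENNReal.ofReal t + β i t) :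
    ENNReal.ofReal (∑ j, α j * x j) ≤ I.lpValue x + ∑ i, ∫⁻ t in Set.Ici (0 : ℝ), β i t := by
  obtain ⟨z, hz, hopt⟩ := I.exists_lpOptimal hx
  rw [← hopt, lpCost_eq, ← Finset.sum_add_distrib,
    ENNReal.ofReal_sum_of_nonneg fun j _ => mul_nonneg (hα j) (hx j)]
  have hzm : ∀ i j, Measurable fun t => ENNReal.ofReal (z i j t) := fun i j =>
    (hz.measurable i j).ennreal_ofReal
  have hof : Measurable fun t : ℝ => ENNReal.ofReal t := ENNReal.measurable_ofReal
  calc ∑ j, ENNReal.ofReal (α j * x j)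
      = ∑ i, ∑ j, ∫⁻ t in Set.Ici (0 : ℝ),
          ENNReal.ofReal (I.lam i j * α j) * ENNReal.ofReal (z i j t) := by
        rw [Finset.sum_comm]
        refine Finset.sum_congr rfl fun j _ => ?_
        rw [ENNReal.ofReal_mul (hα j), ← hz.volume_eq j, Finset.mul_sum]
        refine Finset.sum_congr rfl fun i _ => ?_
        rw [lintegral_const_mul _ (hzm i j), mul_comm (I.lam i j), ENNReal.ofReal_mul (hα j),
          mul_assoc]
        simp only [ENNReal.ofReal_mul (I.lam_nonneg i j)]
        rw [lintegral_const_mul _ (hzm i j)]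
    _ ≤ _ := by
        refine Finset.sum_le_sum fun i _ => ?_
        rw [← lintegral_finsetSum _ fun j _ => (hzm i j).const_mul _]
        have hm1 : ∀ j, Measurable fun t => ENNReal.ofReal (I.dens i j)
            * (ENNReal.ofReal t * ENNReal.ofReal (z i j t)) := fun j =>
          (hof.mul (hzm i j)).const_mul _
        have hm2 : ∀ j, Measurable fun t => ENNReal.ofReal (I.w j) * ENNReal.ofReal (z i j t) :=
          fun j => (hzm i j).const_mul _
        calc ∫⁻ t in Set.Ici (0 : ℝ), ∑ j, ENNReal.ofReal (I.lam i j * α j)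
              * ENNReal.ofReal (z i j t)
            ≤ ∫⁻ t in Set.Ici (0 : ℝ), (((∑ j, ENNReal.ofReal (I.dens i j)
                * (ENNReal.ofReal t * ENNReal.ofReal (z i j t)))
                + ∑ j, ENNReal.ofReal (I.w j) * ENNReal.ofReal (z i j t)) + β i t) := by
              refine setLIntegral_mono (((Finset.measurable_fun_sum _ fun j _ => hm1 j).add
                (Finset.measurable_fun_sum _ fun j _ => hm2 j)).add (hβ i)) fun t ht => ?_
              calc ∑ j, ENNReal.ofReal (I.lam i j * α j) * ENNReal.ofReal (z i j t)
                  ≤ ∑ j, (ENNReal.ofReal (I.w j) + ENNReal.ofReal (I.dens i j)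
                      * ENNReal.ofReal t + β i t) * ENNReal.ofReal (z i j t) := by
                    gcongr with j
                    exact hdual i j t ht
                _ = ((∑ j, ENNReal.ofReal (I.dens i j)
                      * (ENNReal.ofReal t * ENNReal.ofReal (z i j t)))
                      + ∑ j, ENNReal.ofReal (I.w j) * ENNReal.ofReal (z i j t))
                      + β i t * ∑ j, ENNReal.ofReal (z i j t) := by
                    rw [Finset.mul_sum, ← Finset.sum_add_distrib, ← Finset.sum_add_distrib]
                    exact Finset.sum_congr rfl fun j _ => by ring
                _ ≤ _ := by
                    gcongr
                    exact mul_le_of_le_one_right' (hz.sum_ofReal_le_one i t ht)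
          _ = _ := by
              rw [lintegral_add_right _ (hβ i), lintegral_add_right _
                (Finset.measurable_fun_sum _ fun j _ => hm2 j),
                lintegral_finsetSum _ fun j _ => hm1 j, lintegral_finsetSum _ fun j _ => hm2 j]
              unfold momentCost
              congr 2
              · exact Finset.sum_congr rfl fun j _ => lintegral_const_mul _ (hof.mul (hzm i j))
              · exact Finset.sum_congr rfl fun j _ => lintegral_const_mul _ (hzm i j)

/-- The residual optimum is supermodular. -/
theorem value_supermodular (I : Instance M J) {x x' : J → ℝ} (hx : 0 ≤ x) (hx' : 0 ≤ x') :
    I.value x + I.value x' ≤ I.value (x ⊔ x') + I.value (x ⊓ x') := by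
  obtain ⟨α, β, b, hα, hβ, hd, hb, hbs, hv⟩ := I.exists_certificate hx
  obtain ⟨α', β', b', hα', hβ', hd', hb', hbs', hv'⟩ := I.exists_certificate hx'
  have hsup0 : 0 ≤ x ⊔ x' := le_sup_of_le_left hx
  have hinf0 : 0 ≤ x ⊓ x' := le_inf hx hx'
  have h1 := I.weak_duality hsup0 (α := α ⊔ α') (le_sup_of_le_left hα)
    (β := fun i t => max (β i t) (β' i t)) (fun i => (hβ i).max (hβ' i)) (by
      intro i j t ht
      rw [Pi.sup_apply]
      rcases max_cases (α j) (α' j) with ⟨h, -⟩ | ⟨h, -⟩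
      · rw [h]
        refine (hd i j t ht).trans ?_
        gcongr
        exact le_max_left _ _
      · rw [h]
        refine (hd' i j t ht).trans ?_
        gcongr
        exact le_max_right _ _)
  have h2 := I.weak_duality hinf0 (α := α ⊓ α') (le_inf hα hα')
    (β := fun i t => min (β i t) (β' i t)) (fun i => (hβ i).min (hβ' i)) (by
      intro i j t ht
      rw [Pi.inf_apply]
      have hl := I.lam_nonneg i j
      rcases min_cases (β i t) (β' i t) with ⟨h, -⟩ | ⟨h, -⟩
      · rw [h]
        refine le_trans (ENNReal.ofReal_le_ofReal ?_) (hd i j t ht)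
        gcongr
        exact min_le_left _ _
      · rw [h]
        refine le_trans (ENNReal.ofReal_le_ofReal ?_) (hd' i j t ht)
        gcongr
        exact min_le_right _ _)
  -- Since max + min is the sum, the total price of capacity is unchanged.
  have h3 : (∑ i, ∫⁻ t in Set.Ici (0 : ℝ), max (β i t) (β' i t))
      + ∑ i, ∫⁻ t in Set.Ici (0 : ℝ), min (β i t) (β' i t)
      = ENNReal.ofReal (b + b') := by
    rw [ENNReal.ofReal_add hb hb', ← hbs, ← hbs', ← Finset.sum_add_distrib,
      ← Finset.sum_add_distrib]
    refine Finset.sum_congr rfl fun i _ => ?_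
    rw [← lintegral_add_left ((hβ i).max (hβ' i)), ← lintegral_add_left (hβ i)]
    simp only [max_add_min]
  have h4 := add_le_add h1 h2
  rw [add_add_add_comm, h3, ← I.ofReal_value hsup0, ← I.ofReal_value hinf0,
    ← ENNReal.ofReal_add (I.value_nonneg _) (I.value_nonneg _),
    ← ENNReal.ofReal_add (add_nonneg (I.value_nonneg _) (I.value_nonneg _)) (add_nonneg hb hb'),
    ← ENNReal.ofReal_add
      (Finset.sum_nonneg fun j _ => mul_nonneg (le_sup_of_le_left hα j) (hsup0 j))
      (Finset.sum_nonneg fun j _ => mul_nonneg (le_inf hα hα' j) (hinf0 j)),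
    ENNReal.ofReal_le_ofReal_iff (add_nonneg (add_nonneg (I.value_nonneg _) (I.value_nonneg _))
      (add_nonneg hb hb'))] at h4
  -- Rearrangement: matching larger multipliers with larger volumes does not decrease the sum.
  have h5 : ∑ j, α j * x j + ∑ j, α' j * x' j
      ≤ ∑ j, (α ⊔ α') j * (x ⊔ x') j + ∑ j, (α ⊓ α') j * (x ⊓ x') j := by
    rw [← Finset.sum_add_distrib, ← Finset.sum_add_distrib]
    refine Finset.sum_le_sum fun j _ => ?_
    simp only [Pi.sup_apply, Pi.inf_apply]
    rcases le_total (α j) (α' j) with h | h <;> rcases le_total (x j) (x' j) with h' | h' <;>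
      simp only [h, h', sup_of_le_left, sup_of_le_right, inf_of_le_left, inf_of_le_right] <;>
      nlinarith
  linarith

end Instance

/-! ### Linear substitutes of the generalized flow valuation -/

section Profit

variable {J : Type} [Fintype J]

/-- The number `m` is the positive part of the best profit, that is, the price of the unit capacity
of one machine. -/
lemma exists_max_profit (a : J → ℝ) : ∃ (m : ℝ) (z : J → ℝ), 0 ≤ m ∧ a ≤ (fun _ => m) ∧ 0 ≤ z ∧
    ∑ j, z j ≤ 1 ∧ ∑ j, a j * z j = m := by
  classical
  by_cases h : ∃ j, 0 < a j
  · obtain ⟨j₀, h₀⟩ := h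
    obtain ⟨j, -, hj⟩ := Finset.exists_max_image Finset.univ a ⟨j₀, Finset.mem_univ j₀⟩
    refine ⟨a j, Pi.single j 1, h₀.le.trans (hj j₀ (Finset.mem_univ _)),
      fun k => hj k (Finset.mem_univ k), Pi.single_nonneg.2 zero_le_one, ?_, ?_⟩
    · simp
    · simp [Pi.single_apply]
  · push Not at h
    exact ⟨0, 0, le_rfl, h, le_rfl, by simp, by simp⟩

/-- When the profits of some jobs are lowered, there is a best response of the machine that does
not decrease the shares of the other jobs. -/
lemma exists_best_response {a a' z : J → ℝ} {m : ℝ} (haa : a' ≤ a) (hz : 0 ≤ z)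
    (hz1 : ∑ j, z j ≤ 1) (hm : 0 ≤ m) (ham : a ≤ fun _ => m) (hval : ∑ j, a j * z j = m) :
    ∃ (m' : ℝ) (z' : J → ℝ), 0 ≤ m' ∧ a' ≤ (fun _ => m') ∧ 0 ≤ z' ∧ ∑ j, z' j ≤ 1 ∧
      ∑ j, a' j * z' j = m' ∧ ∀ j, a j = a' j → z j ≤ z' j := by
  classical
  -- A job with positive share earns the maximal profit `m`. If its profit is unchanged, `m` stays
  -- maximal: unchanged shares are kept and all freed capacity goes to `j₀`. Otherwise the unchanged
  -- jobs have share zero and any best response works.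
  by_cases h : ∃ j, a j = a' j ∧ 0 < z j
  · obtain ⟨j₀, hj₀, hz₀⟩ := h
    have hterm : ∀ j, a j * z j = m * z j := by
      have hle : ∀ j ∈ Finset.univ, a j * z j ≤ m * z j := fun j _ =>
        mul_le_mul_of_nonneg_right (ham j) (hz j)
      have heq : ∑ j, a j * z j = ∑ j, m * z j := by
        refine le_antisymm (Finset.sum_le_sum hle) ?_
        rw [hval, ← Finset.mul_sum]
        exact mul_le_of_le_one_right hm hz1
      exact fun j => (Finset.sum_eq_sum_iff_of_le hle).1 heq j (Finset.mem_univ j)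
    have hj₀m : a' j₀ = m := by
      rw [← hj₀]; exact mul_right_cancel₀ hz₀.ne' (hterm j₀)
    set u : J → ℝ := fun j => if a j = a' j then z j else 0 with hu
    have hu0 : 0 ≤ u := fun j => by
      show 0 ≤ if a j = a' j then z j else 0
      split
      · exact hz j
      · exact le_rfl
    have huz : u ≤ z := fun j => by
      show (if a j = a' j then z j else 0) ≤ z j
      split
      · exact le_rfl
      · exact hz j
    have hu1 : ∑ j, u j ≤ 1 := (Finset.sum_le_sum fun j _ => huz j).trans hz1
    have hua : ∀ j, a' j * u j = m * u j := fun j => by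
      by_cases hj : a j = a' j
      · simp only [hu, if_pos hj]; rw [← hj]; exact hterm j
      · simp [hu, hj]
    have hs0 : (0 : J → ℝ) ≤ Pi.single j₀ (1 - ∑ j, u j) :=
      Pi.single_nonneg.2 (sub_nonneg.2 hu1)
    refine ⟨m, u + Pi.single j₀ (1 - ∑ j, u j), hm, fun j => (haa j).trans (ham j),
      add_nonneg hu0 hs0, ?_, ?_, fun j hj => ?_⟩
    · simp [Finset.sum_add_distrib]
    · simp only [Pi.add_apply, mul_add, Finset.sum_add_distrib, hua, ← Finset.mul_sum]
      have : ∑ j, a' j * (Pi.single j₀ (1 - ∑ j, u j) : J → ℝ) j = m * (1 - ∑ j, u j) := by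
        simp [Pi.single_apply, hj₀m]
      rw [this]; ring
    · have : u j = z j := by simp [hu, hj]
      rw [← this]
      exact le_add_of_nonneg_right (hs0 j)
  · push Not at h
    obtain ⟨m', z', h1, h2, h3, h4, h5⟩ := exists_max_profit a'
    exact ⟨m', z', h1, h2, h3, h4, h5, fun j hj => (h j hj).trans (h3 j)⟩

end Profit

namespace Instance

variable {M J : Type} [Fintype M] [Fintype J]

/-- The coefficients of the generalized flow valuation. -/
def flowCoeff {M J : Type} (I : Instance M J) (B t : ℝ) (i : M) (j : J) : ℝ :=
  B * I.lam i j - I.w j * I.lam i j / I.p j * t - I.w j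

lemma flowValuation_isGreatest (I : Instance M J) (B t : ℝ) {x : J → ℝ} (hx : 0 ≤ x) :
    IsGreatest {v : ℝ | ∃ z : M → J → ℝ, (∀ i j, 0 ≤ z i j) ∧ (∀ j, ∑ i, I.lam i j * z i j ≤ x j) ∧
      (∀ i, ∑ j, z i j ≤ 1) ∧
      v = ∑ i, ∑ j, (B * I.lam i j - I.w j * I.lam i j / I.p j * t - I.w j) * z i j}
      (I.flowValuation B t x) := by
  set Z : Set (M → J → ℝ) := {z | (∀ i j, 0 ≤ z i j) ∧ (∀ j, ∑ i, I.lam i j * z i j ≤ x j) ∧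
      (∀ i, ∑ j, z i j ≤ 1)} with hZ
  have hclosed : IsClosed Z := by
    have : Z = (⋂ i, ⋂ j, {z | 0 ≤ z i j}) ∩ ((⋂ j, {z | ∑ i, I.lam i j * z i j ≤ x j}) ∩
        ⋂ i, {z | ∑ j, z i j ≤ 1}) := by
      ext z; simp [hZ]
    rw [this]
    refine IsClosed.inter ?_ (IsClosed.inter ?_ ?_)
    · exact isClosed_iInter fun i => isClosed_iInter fun j =>
        isClosed_le continuous_const (by fun_prop)
    · exact isClosed_iInter fun j => isClosed_le (by fun_prop) continuous_const
    · exact isClosed_iInter fun i => isClosed_le (by fun_prop) continuous_const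
  have hcomp : IsCompact Z := by
    refine (isCompact_Icc (a := (0 : M → J → ℝ)) (b := 1)).of_isClosed_subset hclosed ?_
    intro z hz
    exact ⟨hz.1, fun i j => (Finset.single_le_sum (f := fun j => z i j) (fun j _ => hz.1 i j)
      (Finset.mem_univ j)).trans (hz.2.2 i)⟩
  obtain ⟨z, hz, hmax⟩ := hcomp.exists_isMaxOn (f := fun z : M → J → ℝ =>
      ∑ i, ∑ j, (B * I.lam i j - I.w j * I.lam i j / I.p j * t - I.w j) * z i j)
    ⟨0, by simp [hZ]; exact hx⟩ (by fun_prop)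
  have hg : IsGreatest {v : ℝ | ∃ z : M → J → ℝ, (∀ i j, 0 ≤ z i j) ∧
      (∀ j, ∑ i, I.lam i j * z i j ≤ x j) ∧ (∀ i, ∑ j, z i j ≤ 1) ∧
      v = ∑ i, ∑ j, (B * I.lam i j - I.w j * I.lam i j / I.p j * t - I.w j) * z i j}
      (∑ i, ∑ j, (B * I.lam i j - I.w j * I.lam i j / I.p j * t - I.w j) * z i j) := by
    refine ⟨⟨z, hz.1, hz.2.1, hz.2.2, rfl⟩, ?_⟩
    rintro v ⟨z', h1, h2, h3, rfl⟩
    exact hmax (show z' ∈ Z from ⟨h1, h2, h3⟩)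
  rw [flowValuation, hg.csSup_eq]
  exact hg

lemma sum_profit_eq (I : Instance M J) (B t : ℝ) (q : J → ℝ) (z : M → J → ℝ) :
    ∑ i, ∑ j, (I.flowCoeff B t i j - I.lam i j * q j) * z i j
      = ∑ i, ∑ j, I.flowCoeff B t i j * z i j - ∑ j, q j * ∑ i, I.lam i j * z i j := by
  simp only [sub_mul, Finset.sum_sub_distrib, Finset.mul_sum]
  congr 1
  rw [Finset.sum_comm]
  exact Finset.sum_congr rfl fun j _ => Finset.sum_congr rfl fun i _ => by ring

/-- At fixed prices the machines decouple and machine i earns at most m_i; goods bought but not used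
only lower the utility, as prices are nonnegative. -/
lemma flowValuation_sub_le (I : Instance M J) (B t : ℝ) {q : J → ℝ} (hq : 0 ≤ q) {m : M → ℝ}
    (hm : 0 ≤ m) (ham : ∀ i j, I.flowCoeff B t i j - I.lam i j * q j ≤ m i) {x : J → ℝ}
    (hx : 0 ≤ x) : I.flowValuation B t x - ∑ j, q j * x j ≤ ∑ i, m i := by
  obtain ⟨⟨z, h0, hv, h1, heq⟩, -⟩ := I.flowValuation_isGreatest B t hx
  have e := I.sum_profit_eq B t q z
  have h2 : ∑ j, q j * ∑ i, I.lam i j * z i j ≤ ∑ j, q j * x j :=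
    Finset.sum_le_sum fun j _ => mul_le_mul_of_nonneg_left (hv j) (hq j)
  have h3 : ∑ i, ∑ j, (I.flowCoeff B t i j - I.lam i j * q j) * z i j ≤ ∑ i, m i := by
    refine Finset.sum_le_sum fun i _ => ?_
    calc ∑ j, (I.flowCoeff B t i j - I.lam i j * q j) * z i j ≤ ∑ j, m i * z i j :=
          Finset.sum_le_sum fun j _ => mul_le_mul_of_nonneg_right (ham i j) (h0 i j)
      _ = m i * ∑ j, z i j := by rw [Finset.mul_sum]
      _ ≤ m i := mul_le_of_le_one_right (hm i) (h1 i)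
  rw [heq]
  unfold flowCoeff at e h3
  linarith

/-- The converse bound, under complementary slackness: goods left unused must be free. -/
lemma le_flowValuation_sub (I : Instance M J) (B t : ℝ) {q x : J → ℝ} {z : M → J → ℝ}
    (h0 : ∀ i j, 0 ≤ z i j) (h1 : ∀ i, ∑ j, z i j ≤ 1) (hv : ∀ j, ∑ i, I.lam i j * z i j ≤ x j)
    (hq : ∀ j, q j * (x j - ∑ i, I.lam i j * z i j) = 0) :
    ∑ i, ∑ j, (I.flowCoeff B t i j - I.lam i j * q j) * z i j
      ≤ I.flowValuation B t x - ∑ j, q j * x j := by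
  have hx : 0 ≤ x := fun j => (Finset.sum_nonneg fun i _ =>
    mul_nonneg (I.lam_nonneg i j) (h0 i j)).trans (hv j)
  have h := (I.flowValuation_isGreatest B t hx).2 ⟨z, h0, hv, h1, rfl⟩
  have e : ∑ j, q j * ∑ i, I.lam i j * z i j = ∑ j, q j * x j :=
    Finset.sum_congr rfl fun j _ => by linarith [hq j, mul_sub (q j) (x j) (∑ i, I.lam i j * z i j)]
  rw [I.sum_profit_eq B t q z, e]
  unfold flowCoeff
  linarith

/-- The generalized flow valuation is linear-substitute. -/
theorem linearSubstitutes_flowValuation (I : Instance M J) (B t : ℝ) :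
    LinearSubstitutes (I.flowValuation B t) := by
  classical
  intro q q' hq hqq x hx
  choose m e hm ham he he1 hev using fun i =>
    exists_max_profit fun j => I.flowCoeff B t i j - I.lam i j * q j
  obtain ⟨hx0, hxmax⟩ := hx
  obtain ⟨⟨z, h0, hv, h1, heq⟩, -⟩ := I.flowValuation_isGreatest B t hx0
  -- The load of the separate machine optima is one of the bundles with which `x` competes.
  have hbest : ∑ i, m i ≤ I.flowValuation B t x - ∑ j, q j * x j := by
    have h2 := I.le_flowValuation_sub B t (q := q) (x := fun j => ∑ i, I.lam i j * e i j)
      (fun i j => he i j) he1 (fun j => le_rfl) (fun j => by ring)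
    simp only [hev] at h2
    exact h2.trans (hxmax _ fun j => Finset.sum_nonneg fun i _ =>
      mul_nonneg (I.lam_nonneg i j) (he i j))
  have hprof : ∀ i, ∑ j, (I.flowCoeff B t i j - I.lam i j * q j) * z i j ≤ m i := fun i =>
    calc ∑ j, (I.flowCoeff B t i j - I.lam i j * q j) * z i j ≤ ∑ j, m i * z i j :=
          Finset.sum_le_sum fun j _ => mul_le_mul_of_nonneg_right (ham i j) (h0 i j)
      _ = m i * ∑ j, z i j := by rw [Finset.mul_sum]
      _ ≤ m i := mul_le_of_le_one_right (hm i) (h1 i)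
  have hslack : ∀ j ∈ Finset.univ, q j * ∑ i, I.lam i j * z i j ≤ q j * x j := fun j _ =>
    mul_le_mul_of_nonneg_left (hv j) (hq j)
  have hsum := I.sum_profit_eq B t q z
  have htot : ∑ i, ∑ j, (I.flowCoeff B t i j - I.lam i j * q j) * z i j ≤ ∑ i, m i :=
    Finset.sum_le_sum fun i _ => hprof i
  have htot2 := Finset.sum_le_sum hslack
  unfold flowCoeff at hsum htot
  -- The two bounds squeeze the utility: every machine plays a best response, and every good with
  -- positive price is used up.
  have heq1 := (Finset.sum_eq_sum_iff_of_le fun i _ => hprof i).1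
    (by unfold flowCoeff; linarith : _ = ∑ i, m i)
  have heq2 := (Finset.sum_eq_sum_iff_of_le hslack).1 (by linarith)
  choose m' z' hm' ham' hz' hz1' hval' hmono using fun i => exists_best_response
    (a' := fun j => I.flowCoeff B t i j - I.lam i j * q' j)
    (fun j => sub_le_sub_left (mul_le_mul_of_nonneg_left (hqq j) (I.lam_nonneg i j)) _)
    (fun j => h0 i j) (h1 i) (hm i) (ham i) (heq1 i (Finset.mem_univ i))
  set load : J → ℝ := fun j => ∑ i, I.lam i j * z' i j with hload
  have hload0 : 0 ≤ load := fun j => Finset.sum_nonneg fun i _ =>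
    mul_nonneg (I.lam_nonneg i j) (hz' i j)
  have hle : ∀ j, load j ≤ if q j = q' j then max (x j) (load j) else load j := fun j => by
    split
    · exact le_max_right _ _
    · exact le_rfl
  -- Raising the load to `x j` costs something only at a positive price. There, if the price is
  -- unchanged, `x j` was used up and its shares do not decrease, so the load already reaches `x j`.
  refine ⟨fun j => if q j = q' j then max (x j) (load j) else load j,
    ⟨fun j => (hload0 j).trans (hle j), fun y hy => ?_⟩, fun j hj => ?_⟩
  · refine (I.flowValuation_sub_le B t (hq.trans hqq) hm' ham' hy).trans ?_
    have h2 := I.le_flowValuation_sub B t (q := q') hz' hz1' hle (fun j => by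
      by_cases hj : q j = q' j
      · rw [if_pos hj]
        rcases eq_or_ne (q j) 0 with h | h
        · rw [← hj, h, zero_mul]
        · have h3 : x j = ∑ i, I.lam i j * z i j :=
            (mul_left_cancel₀ h (heq2 j (Finset.mem_univ j))).symm
          rw [max_eq_right, sub_self, mul_zero]
          rw [h3]
          refine Finset.sum_le_sum fun i _ => mul_le_mul_of_nonneg_left ?_ (I.lam_nonneg i j)
          exact hmono i j (by simp only [hj])
      · rw [if_neg hj, sub_self, mul_zero])
    simpa only [hval'] using h2
  · simp only [if_pos hj]
    exact le_max_left _ _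

end Instance

/-! ### Merging copies, and the effect of releases on the residual optimum -/

section Merge

open Classical in
/-- The total of `y` over each fibre of `g`. -/
def fiberSum {J K : Type} [Fintype K] (g : K → J) (y : K → ℝ) (j : J) : ℝ := ∑ k with g k = j, y k

lemma fiberSum_eq {J K : Type} [Fintype K] [DecidableEq J] (g : K → J) (y : K → ℝ) (j : J) :
    fiberSum g y j = ∑ k, if g k = j then y k else 0 := by
  rw [fiberSum, Finset.sum_filter]
  exact Finset.sum_congr rfl fun k _ => by congr

lemma fiberSum_mul_comp {J K : Type} [Fintype K] (g : K → J) (F : J → ℝ) (y : K → ℝ) (j : J) :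
    fiberSum g (fun k => F (g k) * y k) j = F j * fiberSum g y j := by
  classical
  rw [fiberSum_eq, fiberSum_eq, Finset.mul_sum]
  refine Finset.sum_congr rfl fun k _ => ?_
  split
  · next h => rw [h]
  · rw [mul_zero]

lemma fiberSum_nonneg {J K : Type} [Fintype K] {g : K → J} {y : K → ℝ} (hy : 0 ≤ y) :
    0 ≤ fiberSum g y := fun _ =>
  Finset.sum_nonneg fun k _ => hy k

variable {J K : Type} [Fintype J] [Fintype K]

lemma sum_comp_mul_eq (g : K → J) (F : J → ℝ) (y : K → ℝ) :
    ∑ k, F (g k) * y k = ∑ j, F j * fiberSum g y j := by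
  classical
  rw [← Finset.sum_fiberwise Finset.univ g]
  refine Finset.sum_congr rfl fun j _ => ?_
  rw [fiberSum, Finset.mul_sum]
  refine Finset.sum_congr (by congr!) fun k hk => ?_
  rw [(Finset.mem_filter.1 hk).2]

lemma minForm_comp (g : K → J) (ρ : J → ℝ) (y y' : K → ℝ) :
    minForm (ρ ∘ g) y y' = minForm ρ (fiberSum g y) (fiberSum g y') := by
  have h1 : ∀ k, ∑ l, min (ρ (g k)) (ρ (g l)) * y k * y' l
      = (∑ j, min (ρ (g k)) (ρ j) * fiberSum g y' j) * y k := by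
    intro k
    rw [← sum_comp_mul_eq g (fun j => min (ρ (g k)) (ρ j)), Finset.sum_mul]
    exact Finset.sum_congr rfl fun l _ => by ring
  simp only [minForm, Function.comp_apply, h1]
  rw [sum_comp_mul_eq g (fun j => ∑ l, min (ρ j) (ρ l) * fiberSum g y' l)]
  simp only [Finset.sum_mul]
  exact Finset.sum_congr rfl fun j _ => Finset.sum_congr rfl fun l _ => by ring

end Merge

namespace Instance

variable {M J : Type} [Fintype M] [Fintype J]

lemma quad_comap {K : Type} [Fintype K] (I : Instance M J) (g : K → J) (y : M → K → ℝ) :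
    (I.comap g).quad y = I.quad fun i => fiberSum g (y i) := by
  refine Finset.sum_congr rfl fun i _ => ?_
  rw [← sum_comp_mul_eq g I.w, ← minForm_comp]
  rfl

/-- Copies of a job can be merged into one job. -/
lemma value_comap {K : Type} [Fintype K] (I : Instance M J) (g : K → J) {x : K → ℝ}
    (hx : 0 ≤ x) : (I.comap g).value x = I.value (fiberSum g x) := by
  apply le_antisymm
  · obtain ⟨y, hy, hval⟩ := I.exists_value_eq (fiberSum_nonneg (g := g) hx)
    -- The copies share the time of the merged job in proportion to their sizes. The factor `r` is
    -- 1, or 0 where the total size is 0 (division by zero); the time lost there is harmless by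
    -- `quad_mono`.
    set r : J → ℝ := fun j => fiberSum g x j / fiberSum g x j with hr
    have hr1 : ∀ j, r j ≤ 1 := fun j => div_self_le_one _
    have hr0 : ∀ j, 0 ≤ r j := fun j =>
      div_nonneg (fiberSum_nonneg hx j) (fiberSum_nonneg hx j)
    have hx0 : ∀ k, fiberSum g x (g k) = 0 → x k = 0 := by
      classical
      intro k h
      rw [fiberSum, Finset.sum_eq_zero_iff_of_nonneg fun k _ => hx k] at h
      exact h k (by simp)
    have hs : (I.comap g).Splits x fun i k => y i (g k) / fiberSum g x (g k) * x k := by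
      refine ⟨fun i k => mul_nonneg (div_nonneg (hy.nonneg i (g k)) (fiberSum_nonneg hx _))
        (hx k), fun k => ?_⟩
      show ∑ i, I.lam i (g k) * (y i (g k) / fiberSum g x (g k) * x k) = x k
      have : ∀ i, I.lam i (g k) * (y i (g k) / fiberSum g x (g k) * x k)
          = I.lam i (g k) * y i (g k) * (x k / fiberSum g x (g k)) := fun i => by ring
      simp only [this]
      rw [← Finset.sum_mul, hy.volume]
      rcases eq_or_ne (fiberSum g x (g k)) 0 with h | h
      · rw [h, zero_mul, hx0 k h]
      · exact mul_div_cancel₀ _ h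
    refine hs.value_le.trans ?_
    rw [quad_comap, hval]
    have he : ∀ i, fiberSum g (fun k => y i (g k) / fiberSum g x (g k) * x k)
        = fun j => y i j * r j := fun i => by
      ext j
      rw [fiberSum_mul_comp g (fun j => y i j / fiberSum g x j)]
      simp only [hr]; ring
    simp only [he]
    exact I.quad_mono (fun i j => mul_nonneg (hy.nonneg i j) (hr0 j))
      fun i j => mul_le_of_le_one_right (hy.nonneg i j) (hr1 j)
  · obtain ⟨y, hy, hval⟩ := (I.comap g).exists_value_eq hx
    have hs : I.Splits (fiberSum g x) fun i => fiberSum g (y i) := by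
      refine ⟨fun i => fiberSum_nonneg (hy.nonneg i), fun j => ?_⟩
      classical
      have h1 : ∀ i, I.lam i j * fiberSum g (y i) j
          = fiberSum g (fun k => I.lam i (g k) * y i k) j := fun i =>
        (fiberSum_mul_comp g (I.lam i) (y i) j).symm
      rw [Finset.sum_congr rfl fun i _ => h1 i]
      simp only [fiberSum_eq]
      rw [Finset.sum_comm]
      refine Finset.sum_congr rfl fun k _ => ?_
      split
      · exact hy.volume k
      · simp
    rw [hval, quad_comap]
    exact hs.value_le

lemma fiberSum_copies (n : ℕ) (xA xO : J → ℝ) :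
    fiberSum (Sum.elim id Prod.snd : J ⊕ (Fin (n - 1) × J) → J) (Sum.elim xA fun c => xO c.2)
      = fun j => xA j + (n - 1 : ℕ) * xO j := by
  classical
  ext j
  have h : fiberSum (Sum.elim id Prod.snd : J ⊕ (Fin (n - 1) × J) → J)
      (Sum.elim xA fun c => xO c.2) j
      = (∑ k, if k = j then xA k else 0) + ∑ _c : Fin (n - 1), ∑ k, if k = j then xO k else 0 := by
    rw [fiberSum_eq, Fintype.sum_sum_type, Fintype.sum_prod_type]
    rfl
  rw [h]
  simp

/-- With the copies merged, the second term becomes f at x^A + (n-1) x^O, the form in which all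
later estimates are made. -/
lemma potential_eq (I : Instance M J) {n : ℕ} (hn : 1 ≤ n) {xA xO : J → ℝ} (hA : 0 ≤ xA)
    (hO : 0 ≤ xO) : potential I n xA xO
      = 2 * n * (I.value xA - 1 / n * I.value fun j => xA j + ((n : ℝ) - 1) * xO j) := by
  have h := I.value_comap (Sum.elim id Prod.snd : J ⊕ (Fin (n - 1) × J) → J)
    (x := Sum.elim xA fun c => xO c.2) (by rintro (j | c); exacts [hA j, hO c.2])
  rw [fiberSum_copies] at h
  rw [potential, show (n : ℝ) - 1 = ((n - 1 : ℕ) : ℝ) by push_cast [hn]; ring, ← h]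
  rfl

/-- Releasing new jobs `e` in both schedules does not increase the potential. -/
lemma value_release (I : Instance M J) {n : ℕ} (hn : 1 ≤ n) {a b e : J → ℝ} (ha : 0 ≤ a)
    (hb : 0 ≤ b) (he : 0 ≤ e) (hdisj : ∀ j, e j = 0 ∨ (a j = 0 ∧ b j = 0)) :
    (I.value (a + e) - I.value a) ≤ 1 / n *
      (I.value (a + e + ((n : ℝ) - 1) • (b + e)) - I.value (a + ((n : ℝ) - 1) • b)) := by
  have hn1 : (1 : ℝ) ≤ n := by exact_mod_cast hn
  have hn0 : 0 ≤ (n : ℝ) - 1 := by linarith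
  have hne : 0 ≤ a + (n : ℝ) • e := fun j => add_nonneg (ha j) (mul_nonneg (by positivity) (he j))
  have hb' : 0 ≤ a + ((n : ℝ) - 1) • b := fun j => add_nonneg (ha j) (mul_nonneg hn0 (hb j))
  -- Where `e` is nonzero, `a` and `b` vanish. Writing n e = e + (n-1) e, the join is the combined
  -- state after the release, and the meet is `a`.
  have hsup := I.value_supermodular hne hb'
  have e1 : (a + (n : ℝ) • e) ⊔ (a + ((n : ℝ) - 1) • b) = a + e + ((n : ℝ) - 1) • (b + e) := by
    ext j
    simp only [Pi.sup_apply, Pi.add_apply, Pi.smul_apply, smul_eq_mul]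
    have h2 := mul_nonneg hn0 (hb j)
    have h3 := mul_nonneg (zero_le_one.trans hn1) (he j)
    rcases hdisj j with h | ⟨h, h'⟩
    · rw [h, max_eq_right (by simpa using h2)]; ring
    · rw [h, h', max_eq_left (by simpa using h3)]; ring
  have e2 : (a + (n : ℝ) • e) ⊓ (a + ((n : ℝ) - 1) • b) = a := by
    ext j
    simp only [Pi.inf_apply, Pi.add_apply, Pi.smul_apply, smul_eq_mul]
    have h2 := mul_nonneg hn0 (hb j)
    have h3 := mul_nonneg (zero_le_one.trans hn1) (he j)
    rcases hdisj j with h | ⟨h, h'⟩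
    · rw [h, min_eq_left (by simpa using h2)]; ring
    · rw [h, h', min_eq_right (by simpa using h3)]; ring
  rw [e1, e2] at hsup
  -- A subgradient at a + e, tested at a + n e and at a, gives f(a + n e) - f(a) ≥ n (f(a + e) -
  -- f(a)).
  obtain ⟨α, hα⟩ := I.exists_subgradient (add_nonneg ha he)
  have h1 := hα _ hne
  have h2 := hα a ha
  have s1 : ∑ j, α j * ((a + (n : ℝ) • e) j - (a + e) j) = ((n : ℝ) - 1) * ∑ j, α j * e j := by
    rw [Finset.mul_sum]
    exact Finset.sum_congr rfl fun j _ => by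
      simp only [Pi.add_apply, Pi.smul_apply, smul_eq_mul]; ring
  have s2 : ∑ j, α j * (a j - (a + e) j) = -∑ j, α j * e j := by
    rw [← Finset.sum_neg_distrib]
    exact Finset.sum_congr rfl fun j _ => by simp only [Pi.add_apply]; ring
  rw [s1] at h1
  rw [s2] at h2
  rw [div_mul_eq_mul_div, one_mul, le_div_iff₀ (by linarith)]
  nlinarith

end Instance

/-! ### The approximate gradient: cut times, descent and insertion -/

namespace Instance

variable {M J : Type} [Fintype M] [Fintype J]

lemma LPFeasible.integrableOn {I : Instance M J} {x : J → ℝ} {z : M → J → ℝ → ℝ}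
    (hz : I.LPFeasible x z) (i : M) (j : J) :
    IntegrableOn (fun u => I.lam i j * z i j u / I.p j) (Set.Ici 0) := by
  apply Integrable.div_const
  refine ⟨((hz.measurable i j).const_mul _).aestronglyMeasurable, ?_⟩
  rw [hasFiniteIntegral_iff_ofReal (by
    filter_upwards [ae_restrict_mem measurableSet_Ici] with t ht
    exact mul_nonneg (I.lam_nonneg i j) (hz.nonneg i j t ht))]
  refine lt_of_le_of_lt (Finset.single_le_sum (f := fun i => ∫⁻ t in Set.Ici (0 : ℝ),
    ENNReal.ofReal (I.lam i j * z i j t)) (fun _ _ => zero_le) (Finset.mem_univ i)) ?_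
  rw [hz.volume_eq j]
  exact ENNReal.ofReal_lt_top

/-- The part of the plan that `gdRate` integrates: an initial time interval, which holds a unit
fraction of jobs unless it is everything. -/
lemma LPFeasible.exists_cut {I : Instance M J} {x : J → ℝ} {z : M → J → ℝ → ℝ}
    (hz : I.LPFeasible x z) (i : M) : ∃ A : Set ℝ,
      (∀ j, I.gdRate z i j = ∫ u in A, I.lam i j * z i j u / I.p j) ∧
      ((A = Set.Ici 0 ∧ ∑ j, I.gdRate z i j ≤ 1) ∨
        ∃ τ, 0 ≤ τ ∧ A = Set.Ico 0 τ ∧ ∑ j, I.gdRate z i j = 1) := by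
  set g : J → ℝ → ℝ := fun j => (Set.Ici (0 : ℝ)).indicator fun u => I.lam i j * z i j u / I.p j
    with hg
  have hgi : ∀ j, Integrable (g j) := fun j =>
    (integrable_indicator_iff measurableSet_Ici).2 (hz.integrableOn i j)
  set G : ℝ → ℝ := fun t => ∑ j, ∫ u in (0 : ℝ)..t, g j u with hG
  have hcont : Continuous G := continuous_finsetSum _ fun j _ =>
    intervalIntegral.continuous_primitive (fun _ _ => (hgi j).intervalIntegrable) 0
  have hint : ∀ j t, 0 ≤ t → ∫ u in (0 : ℝ)..t, g j u
      = ∫ u in (0 : ℝ)..t, I.lam i j * z i j u / I.p j := by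
    intro j t ht
    refine intervalIntegral.integral_congr fun u hu => ?_
    rw [Set.uIcc_of_le ht] at hu
    exact Set.indicator_of_mem (show u ∈ Set.Ici (0 : ℝ) from hu.1) _
  have hGf : ∀ t, 0 ≤ t → G t = I.fractionUpTo z i t := fun t ht =>
    Finset.sum_congr rfl fun j _ => hint j t ht
  set S : Set ℝ := {t : ℝ | 0 ≤ t ∧ 1 ≤ I.fractionUpTo z i t} with hS
  have hSG : S = {t | 0 ≤ t ∧ 1 ≤ G t} := by
    ext t
    exact and_congr_right fun ht => by rw [hGf t ht]
  refine ⟨{u : ℝ | 0 ≤ u ∧ (u : EReal) < I.cutTime z i}, fun j => rfl, ?_⟩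
  rcases S.eq_empty_or_nonempty with hemp | hne
  · left
    have hcut : I.cutTime z i = ⊤ := by
      rw [cutTime, ← hS, hemp]; simp
    have hA : {u : ℝ | 0 ≤ u ∧ (u : EReal) < I.cutTime z i} = Set.Ici 0 := by
      ext u; simp [hcut, EReal.coe_lt_top]
    refine ⟨hA, ?_⟩
    have hlim : Tendsto G atTop (𝓝 (∑ j, I.gdRate z i j)) := by
      refine tendsto_finsetSum _ fun j _ => ?_
      have h := intervalIntegral_tendsto_integral_Ioi 0 (hgi j).integrableOn tendsto_id
      have e : ∫ u in Set.Ioi (0 : ℝ), g j u = I.gdRate z i j := by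
        rw [← integral_Ici_eq_integral_Ioi, gdRate, hA]
        exact setIntegral_congr_fun measurableSet_Ici fun u hu => Set.indicator_of_mem hu _
      rwa [e] at h
    refine le_of_tendsto hlim ?_
    filter_upwards [eventually_ge_atTop 0] with t ht
    by_contra hcon
    have : t ∈ S := by rw [hSG]; exact ⟨ht, (not_le.1 hcon).le⟩
    rw [hemp] at this
    exact this
  · right
    have hclosed : IsClosed S := by
      rw [hSG]
      exact (isClosed_le continuous_const continuous_id).inter (isClosed_le continuous_const hcont)
    have hbdd : BddBelow S := ⟨0, fun t ht => ht.1⟩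
    have hleast : IsLeast S (sInf S) := hclosed.isLeast_csInf hne hbdd
    set τ := sInf S with hτ
    have hcut : I.cutTime z i = (τ : EReal) := by
      rw [cutTime, ← hS]
      exact ((EReal.coe_strictMono.monotone.map_isLeast hleast).isGLB).sInf_eq
    have hA : {u : ℝ | 0 ≤ u ∧ (u : EReal) < I.cutTime z i} = Set.Ico 0 τ := by
      ext u; simp [hcut]
    have hτ0 : 0 ≤ τ := hleast.1.1
    refine ⟨τ, hτ0, hA, ?_⟩
    have e : ∑ j, I.gdRate z i j = G τ := by
      refine Finset.sum_congr rfl fun j _ => ?_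
      rw [gdRate, hA, hint j τ hτ0, intervalIntegral.integral_of_le hτ0,
        integral_Ico_eq_integral_Ioc]
    rw [e]
    have hmem := hleast.1
    rw [hSG] at hmem
    refine le_antisymm ?_ hmem.2
    by_contra hcon
    -- The accumulated fraction is continuous and starts at 0, so at the first time it reaches 1 it
    -- cannot exceed 1.
    have hG0 : G 0 = 0 := by simp [hG]
    obtain ⟨t, ht, htG⟩ := intermediate_value_Icc hτ0 hcont.continuousOn
      (show (1 : ℝ) ∈ Set.Icc (G 0) (G τ) from ⟨by rw [hG0]; exact zero_le_one, hmem.2⟩)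
    have h1 : τ ≤ t := hleast.2 (by rw [hSG]; exact ⟨ht.1, htG.ge⟩)
    have h2 : t = τ := le_antisymm ht.2 h1
    rw [h2] at htG
    exact hcon htG.le

lemma LPFeasible.gdRate_nonneg {I : Instance M J} {x : J → ℝ} {z : M → J → ℝ → ℝ}
    (hz : I.LPFeasible x z) (i : M) (j : J) : 0 ≤ I.gdRate z i j := by
  unfold gdRate
  refine integral_nonneg_of_ae ?_
  refine (ae_restrict_iff' ?_).2 (Eventually.of_forall fun u hu =>
    div_nonneg (mul_nonneg (I.lam_nonneg i j) (hz.nonneg i j u hu.1)) (I.p_pos j).le)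
  exact (measurableSet_le measurable_const measurable_id).inter
    (measurableSet_lt measurable_coe_real_ereal measurable_const)

/-- In an optimal solution of the residual program, the jobs started before a time have at least
the density of the jobs processed after it. -/
lemma LPOptimal.dens_le {I : Instance M J} {x : J → ℝ} {z : M → J → ℝ → ℝ} {y : M → J → ℝ}
    (hz : I.LPFeasible x z) (hy : 0 ≤ y)
    (hv : ∀ i j, ∫⁻ t in Set.Ici (0 : ℝ), ENNReal.ofReal (z i j t) = ENNReal.ofReal (y i j))
    (i : M) (hc : momentCost (fun j => ENNReal.ofReal (I.dens i j))
      (fun j t => ENNReal.ofReal (z i j t))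
        = ENNReal.ofReal (1 / 2 * minForm (I.dens i) (y i) (y i))) {τ : ℝ} (hτ : 0 ≤ τ) {j k : J}
    (hj : ∫⁻ t in Set.Ico 0 τ, ENNReal.ofReal (z i j t) ≠ 0)
    (hk : ∫⁻ t in Set.Ici τ, ENNReal.ofReal (z i k t) ≠ 0) : I.dens i k ≤ I.dens i j := by
  have htight := ae_tight (fun j => ENNReal.ofReal (I.dens i j))
    (ζ := fun j t => ENNReal.ofReal (z i j t)) (fun j => (hz.measurable i j).ennreal_ofReal)
    (hz.sum_ofReal_le_one i) (by rw [hc]; exact ENNReal.ofReal_ne_top) (by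
      simp only [hv]
      rw [hc, ← ofReal_minForm (I.dens_nonneg i) (hy i) (hy i),
        show (2 : ℝ≥0∞) = ENNReal.ofReal 2 by simp, ← ENNReal.ofReal_mul (by norm_num)]
      apply ENNReal.ofReal_le_ofReal
      linarith)
  have hex : ∀ (A : Set ℝ) (l : J), A ⊆ Set.Ici 0 →
      ∫⁻ t in A, ENNReal.ofReal (z i l t) ≠ 0 → MeasurableSet A → ∃ t ∈ A,
        ∑ m, min (ENNReal.ofReal (I.dens i l)) (ENNReal.ofReal (I.dens i m))
          * ENNReal.ofReal (y i m) = ENNReal.ofReal (I.dens i l) * ENNReal.ofReal t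
            + tailLoad (fun j => ENNReal.ofReal (I.dens i j))
              (fun j t => ENNReal.ofReal (z i j t)) t := by
    intro A l hA hne hAm
    by_contra hcon
    push Not at hcon
    apply hne
    rw [lintegral_eq_zero_iff (hz.measurable i l).ennreal_ofReal]
    filter_upwards [ae_restrict_of_ae_restrict_of_subset hA htight, ae_restrict_mem hAm]
      with t ht htA
    by_contra h0
    have := ht l h0
    simp only [hv] at this
    exact hcon t htA this
  -- Choose t before τ where the constraint of `j` is tight, and v after τ where that of `k` is
  -- tight.
  obtain ⟨t, htA, ht⟩ := hex _ j Set.Ico_subset_Ici_self hj measurableSet_Ico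
  obtain ⟨v, hvA, htv⟩ := hex _ k (Set.Ici_subset_Ici.2 hτ) hk measurableSet_Ici
  have hdual : ∀ (l : J) (u : ℝ), 0 ≤ u →
      ∑ m, min (ENNReal.ofReal (I.dens i l)) (ENNReal.ofReal (I.dens i m))
          * ENNReal.ofReal (y i m) ≤ ENNReal.ofReal (I.dens i l) * ENNReal.ofReal u
            + tailLoad (fun j => ENNReal.ofReal (I.dens i j))
              (fun j t => ENNReal.ofReal (z i j t)) u := by
    intro l u hu
    have := sum_min_le_tailLoad (fun j => ENNReal.ofReal (I.dens i j))
      (ζ := fun j t => ENNReal.ofReal (z i j t)) (fun j => (hz.measurable i j).ennreal_ofReal)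
      (hz.sum_ofReal_le_one i) (ENNReal.ofReal (I.dens i l)) hu
    simpa only [hv] using this
  have h1 := hdual j v (hτ.trans hvA)
  have h2 := hdual k t htA.1
  rw [ht] at h1
  rw [htv] at h2
  have hfin : ∀ (l : J) (u : ℝ), ∑ m, min (ENNReal.ofReal (I.dens i l)) (ENNReal.ofReal (I.dens i m))
          * ENNReal.ofReal (y i m) = ENNReal.ofReal (I.dens i l) * ENNReal.ofReal u
            + tailLoad (fun j => ENNReal.ofReal (I.dens i j))
              (fun j t => ENNReal.ofReal (z i j t)) u →
      tailLoad (fun j => ENNReal.ofReal (I.dens i j)) (fun j t => ENNReal.ofReal (z i j t)) u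
        ≠ ∞ := by
    intro l u h
    refine ne_top_of_le_ne_top ?_ (le_add_self.trans h.ge)
    exact ENNReal.sum_ne_top.2 fun m _ => ENNReal.mul_ne_top
      (ne_top_of_le_ne_top ENNReal.ofReal_ne_top (min_le_left _ _)) ENNReal.ofReal_ne_top
  -- Testing `j` at v and `k` at t as well, the tail loads cancel and (ρ_k - ρ_j)(v - t) ≤ 0
  -- remains.
  have h3 := add_le_add h1 h2
  obtain ⟨b, hb⟩ := WithTop.ne_top_iff_exists.1 (hfin j t ht)
  obtain ⟨c, hc'⟩ := WithTop.ne_top_iff_exists.1 (hfin k v htv)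
  change (b : ℝ≥0∞) = _ at hb
  change (c : ℝ≥0∞) = _ at hc'
  have htv' : t < v := htA.2.trans_le hvA
  have ht0 := htA.1
  have hv0 := hτ.trans hvA
  have dj := I.dens_nonneg i j
  have dk := I.dens_nonneg i k
  simp only [Pi.zero_apply] at dj dk
  simp only [← hb, ← hc', ← ENNReal.ofReal_coe_nnreal, ← ENNReal.ofReal_mul dj,
    ← ENNReal.ofReal_mul dk] at h3
  have p1 := mul_nonneg dj ht0
  have p2 := mul_nonneg dk ht0
  have p3 := mul_nonneg dj hv0
  have p4 := mul_nonneg dk hv0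
  have q1 := b.coe_nonneg
  have q2 := c.coe_nonneg
  rw [← ENNReal.ofReal_add p1 q1, ← ENNReal.ofReal_add p4 q2, ← ENNReal.ofReal_add p3 q2,
    ← ENNReal.ofReal_add p2 q1, ← ENNReal.ofReal_add (by linarith) (by linarith),
    ← ENNReal.ofReal_add (by linarith) (by linarith),
    ENNReal.ofReal_le_ofReal_iff (by linarith)] at h3
  by_contra hlt
  nlinarith [mul_pos (sub_pos.2 (not_le.1 hlt)) (sub_pos.2 htv')]

/-- The total times `y` of an optimal solution and the parts `a` of them before the cut times. -/
lemma LPOptimal.exists_cut {I : Instance M J} {x : J → ℝ} {z : M → J → ℝ → ℝ}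
    (hz : I.LPOptimal x z) (hx : 0 ≤ x) : ∃ y a : M → J → ℝ, I.Splits x y ∧
      I.quad y ≤ I.value x ∧ 0 ≤ a ∧ a ≤ y ∧
      (∀ i j, I.gdRate z i j = I.lam i j * a i j / I.p j) ∧ (∀ i, ∑ j, I.gdRate z i j ≤ 1) ∧
      ∀ i, a i = y i ∨ (∑ j, I.gdRate z i j = 1 ∧
        ∀ j k, 0 < a i j → a i k < y i k → I.dens i k ≤ I.dens i j) := by
  obtain ⟨hf, hopt⟩ := hz
  have hfin : I.lpCost z ≠ ∞ := by rw [hopt]; exact I.lpValue_ne_top hx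
  obtain ⟨y, hy, hv⟩ := hf.exists_splits hx hfin
  have hq : I.quad y ≤ I.value x := by
    have := hf.quad_le hy.nonneg hv
    rwa [hopt, ← I.ofReal_value hx, ENNReal.ofReal_le_ofReal_iff (I.value_nonneg x)] at this
  have hquad : I.lpCost z = ENNReal.ofReal (I.quad y) := by
    rw [hopt, ← I.ofReal_value hx, le_antisymm hy.value_le hq]
  -- Each machine satisfies the lower bound and the totals agree, so the bound is tight on every
  -- machine.
  have hmoment : ∀ i, momentCost (fun j => ENNReal.ofReal (I.dens i j))
      (fun j t => ENNReal.ofReal (z i j t))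
        = ENNReal.ofReal (1 / 2 * minForm (I.dens i) (y i) (y i)) := by
    classical
    rw [lpCost_eq, ofReal_quad I hy.nonneg, Finset.sum_add_distrib, Finset.sum_add_distrib] at hquad
    simp only [hv] at hquad
    have hw : ∑ i, ∑ j, ENNReal.ofReal (I.w j) * ENNReal.ofReal (y i j) ≠ ∞ :=
      ENNReal.sum_ne_top.2 fun i _ => ENNReal.sum_ne_top.2 fun j _ =>
        ENNReal.mul_ne_top ENNReal.ofReal_ne_top ENNReal.ofReal_ne_top
    have hsum := (ENNReal.add_left_inj hw).1 hquad
    intro i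
    refine le_antisymm ?_ (hf.two_momentCost_ge hy.nonneg hv i)
    rw [← Finset.add_sum_erase _ _ (Finset.mem_univ i),
      ← Finset.add_sum_erase Finset.univ (fun i => ENNReal.ofReal
        (1 / 2 * minForm (I.dens i) (y i) (y i))) (Finset.mem_univ i)] at hsum
    have hrest : ∑ l ∈ Finset.univ.erase i, ENNReal.ofReal
        (1 / 2 * minForm (I.dens l) (y l) (y l)) ≠ ∞ :=
      ENNReal.sum_ne_top.2 fun l _ => ENNReal.ofReal_ne_top
    refine (ENNReal.add_le_add_iff_right hrest).1 ?_
    rw [← hsum]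
    gcongr with l
    exact hf.two_momentCost_ge hy.nonneg hv l
  choose A hrate hcase using hf.exists_cut
  have hA : ∀ i, MeasurableSet (A i) ∧ A i ⊆ Set.Ici 0 := by
    intro i
    rcases hcase i with ⟨h, -⟩ | ⟨τ, -, h, -⟩
    · rw [h]; exact ⟨measurableSet_Ici, le_rfl⟩
    · rw [h]; exact ⟨measurableSet_Ico, Set.Ico_subset_Ici_self⟩
  have hale : ∀ i j, ∫⁻ t in A i, ENNReal.ofReal (z i j t) ≤ ENNReal.ofReal (y i j) := by
    intro i j
    rw [← hv]
    exact lintegral_mono_set (hA i).2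
  refine ⟨y, fun i j => (∫⁻ t in A i, ENNReal.ofReal (z i j t)).toReal, hy, hq,
    fun i j => ENNReal.toReal_nonneg, fun i j => ENNReal.toReal_le_of_le_ofReal (hy.nonneg i j)
      (hale i j), fun i j => ?_, fun i => ?_, fun i => ?_⟩
  · rw [hrate, integral_div, integral_const_mul, integral_eq_lintegral_of_nonneg_ae _
      (hf.measurable i j).aestronglyMeasurable]
    filter_upwards [ae_restrict_mem (hA i).1] with t ht
    exact hf.nonneg i j t ((hA i).2 ht)
  · rcases hcase i with ⟨-, h⟩ | ⟨τ, -, -, h⟩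
    · exact h
    · exact h.le
  · rcases hcase i with ⟨h, -⟩ | ⟨τ, hτ, h, h1⟩
    · left
      ext j
      show (∫⁻ t in A i, ENNReal.ofReal (z i j t)).toReal = y i j
      rw [h, hv, ENNReal.toReal_ofReal (hy.nonneg i j)]
    · right
      refine ⟨h1, fun j k hj hk => LPOptimal.dens_le hf hy.nonneg hv i (hmoment i) hτ ?_ ?_⟩
      · rw [← h]
        intro h0
        change 0 < (∫⁻ t in A i, ENNReal.ofReal (z i j t)).toReal at hj
        rw [h0, ENNReal.toReal_zero] at hj
        exact lt_irrefl _ hj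
      · intro h0
        have hs := lintegral_Ici_split (fun t => ENNReal.ofReal (z i k t)) hτ
        rw [h0, add_zero, ← h, hv] at hs
        change (∫⁻ t in A i, ENNReal.ofReal (z i k t)).toReal < y i k at hk
        rw [← hs, ENNReal.toReal_ofReal (hy.nonneg i k)] at hk
        exact lt_irrefl _ hk

/-- The approximate gradient is a fractional matching. -/
lemma LPOptimal.sum_gdRate_le {I : Instance M J} {x : J → ℝ} {z : M → J → ℝ → ℝ}
    (hz : I.LPOptimal x z) (hx : 0 ≤ x) (j : J) : ∑ i, I.gdRate z i j ≤ x j / I.p j := by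
  obtain ⟨y, a, hy, -, -, hay, hrate, -⟩ := hz.exists_cut hx
  rw [← hy.volume j, Finset.sum_div]
  refine Finset.sum_le_sum fun i _ => ?_
  rw [hrate]
  exact div_le_div_of_nonneg_right (mul_le_mul_of_nonneg_left (hay i j) (I.lam_nonneg i j))
    (I.p_pos j).le

lemma sum_dens_mul {I : Instance M J} {x : J → ℝ} {y : M → J → ℝ} (hy : I.Splits x y) :
    ∑ i, ∑ j, I.dens i j * y i j = ∑ j, I.w j / I.p j * x j := by
  rw [Finset.sum_comm]
  refine Finset.sum_congr rfl fun j _ => ?_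
  rw [← hy.volume j, Finset.mul_sum]
  exact Finset.sum_congr rfl fun i _ => by unfold dens; ring

/-- Following the approximate gradient decreases the residual optimum at least at the rate of the
fractional weight, as long as no planned fraction is used up. -/
lemma LPOptimal.value_sub_le {I : Instance M J} {x : J → ℝ} {z : M → J → ℝ → ℝ}
    (hz : I.LPOptimal x z) (hx : 0 ≤ x) {c : ℝ} (hc : 0 ≤ c)
    (hlim : ∀ i j, 0 < I.gdRate z i j → c * I.lam i j ≤ I.p j) :
    (∀ j, c * ∑ i, I.lam i j * I.gdRate z i j ≤ x j) ∧
    I.value (fun j => x j - c * ∑ i, I.lam i j * I.gdRate z i j)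
      ≤ I.value x - c * ∑ j, I.w j / I.p j * x j := by
  obtain ⟨y, a, hy, hval, ha, hay, hrate, -, hcut⟩ := hz.exists_cut hx
  set e : M → J → ℝ := fun i j => I.gdRate z i j with he
  have he0 : ∀ i j, 0 ≤ e i j := hz.1.gdRate_nonneg
  -- The step removes only work planned before the cut: e_ij = λ_ij a_ij / p_j and c λ_ij ≤ p_j.
  have hea : ∀ i j, c * e i j ≤ a i j := by
    intro i j
    rcases (he0 i j).eq_or_lt with h | h
    · rw [← h, mul_zero]; exact ha i j
    · have h1 : e i j = I.lam i j * a i j / I.p j := hrate i j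
      rw [h1, mul_div_assoc', div_le_iff₀ (I.p_pos j), ← mul_assoc, mul_comm (a i j)]
      exact mul_le_mul_of_nonneg_right (hlim i j h) (ha i j)
  have hvol : ∀ j, ∑ i, I.lam i j * (c * e i j) = c * ∑ i, I.lam i j * e i j := fun j => by
    rw [Finset.mul_sum]
    exact Finset.sum_congr rfl fun i _ => by ring
  refine ⟨fun j => ?_, ?_⟩
  · rw [← hvol, ← hy.volume j]
    exact Finset.sum_le_sum fun i _ => mul_le_mul_of_nonneg_left ((hea i j).trans (hay i j))
      (I.lam_nonneg i j)
  have hs : I.Splits (fun j => x j - c * ∑ i, I.lam i j * e i j) (y + (-c) • e) := by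
    refine ⟨fun i j => ?_, fun j => ?_⟩
    · show 0 ≤ y i j + -c * e i j
      linarith [hea i j, hay i j]
    · rw [← hvol, ← hy.volume j, ← Finset.sum_sub_distrib]
      exact Finset.sum_congr rfl fun i _ => by
        simp only [Pi.add_apply, Pi.smul_apply, smul_eq_mul]; ring
  refine hs.value_le.trans ?_
  rw [quad_add, ← sum_dens_mul hy]
  have e1 : ∑ i, ∑ j, I.marginal y i j * ((-c) • e) i j
      = -c * ∑ i, (minForm (I.dens i) (y i) (e i) + ∑ j, I.w j * e i j) := by
    rw [← sum_marginal_mul, Finset.mul_sum]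
    refine Finset.sum_congr rfl fun i _ => ?_
    rw [Finset.mul_sum]
    exact Finset.sum_congr rfl fun j _ => by simp only [Pi.smul_apply, smul_eq_mul]; ring
  have e2 : ∀ i, minForm (I.dens i) (((-c) • e) i) (((-c) • e) i)
      = c * (c * minForm (I.dens i) (e i) (e i)) := fun i => by
    show minForm (I.dens i) ((-c) • e i) ((-c) • e i) = _
    rw [minForm_smul_left, minForm_comm, minForm_smul_left]
    ring
  simp only [e2]
  -- The heart of the descent. The weight term w_j e_ij equals ρ_ij a_ij and accounts for the work
  -- before the cut; the pairing of y - a with e accounts for the work after it; the pairing of a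
  -- with e absorbs the second-order term, because c e ≤ a.
  have key : ∀ i, (∑ j, I.dens i j * y i j) + c * minForm (I.dens i) (e i) (e i)
      ≤ minForm (I.dens i) (y i) (e i) + ∑ j, I.w j * e i j := by
    intro i
    have k1 : c * minForm (I.dens i) (e i) (e i) ≤ minForm (I.dens i) (a i) (e i) := by
      rw [← minForm_smul_left]
      exact minForm_mono (I.dens_nonneg i) (fun j => mul_nonneg hc (he0 i j)) (hea i) (he0 i) le_rfl
    have k2 : ∀ j, I.w j * e i j = I.dens i j * a i j := fun j => by
      simp only [he, hrate, dens]; ring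
    have k3 : minForm (I.dens i) (y i) (e i)
        = minForm (I.dens i) (y i - a i) (e i) + minForm (I.dens i) (a i) (e i) := by
      rw [← minForm_add_left, sub_add_cancel]
    -- If anything lies after the cut, the shares `e i` sum to 1 and belong to jobs at least as
    -- dense, so each minimum is the density of the later job.
    have k4 : ∑ j, I.dens i j * (y i j - a i j) ≤ minForm (I.dens i) (y i - a i) (e i) := by
      rcases hcut i with h | ⟨h1, h2⟩
      · rw [h, sub_self]
        simp [minForm]
      · refine Finset.sum_le_sum fun k _ => ?_
        rcases (sub_nonneg.2 (hay i k)).eq_or_lt with h | h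
        · simp only [Pi.sub_apply, ← h, mul_zero, zero_mul, Finset.sum_const_zero, le_refl]
        · have : ∀ j, min (I.dens i k) (I.dens i j) * (y i - a i) k * e i j
              = I.dens i k * (y i k - a i k) * e i j := fun j => by
            rcases (he0 i j).eq_or_lt with h' | h'
            · rw [← h', mul_zero, mul_zero]
            · have haj : 0 < a i j := by
                rcases (ha i j).eq_or_lt with h3 | h3
                · exfalso
                  have h4 : e i j = I.lam i j * a i j / I.p j := hrate i j
                  rw [h4, ← h3] at h'
                  simp at h'
                · exact h3
              rw [min_eq_left (h2 j k haj (sub_pos.1 h))]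
              rfl
          rw [Finset.sum_congr rfl fun j _ => this j, ← Finset.mul_sum]
          have h1' : ∑ j, e i j = 1 := h1
          rw [h1', mul_one]
    have k5 : ∑ j, I.dens i j * y i j
        = ∑ j, I.dens i j * (y i j - a i j) + ∑ j, I.w j * e i j := by
      rw [← Finset.sum_add_distrib]
      exact Finset.sum_congr rfl fun j _ => by rw [k2]; ring
    linarith
  have hsum := Finset.sum_le_sum fun i (_ : i ∈ Finset.univ) => key i
  rw [Finset.sum_add_distrib, ← Finset.mul_sum] at hsum
  have hE : 0 ≤ ∑ i, minForm (I.dens i) (e i) (e i) := Finset.sum_nonneg fun i _ =>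
    minForm_nonneg (I.dens_nonneg i) (he0 i) (he0 i)
  rw [e1]
  simp only [← Finset.mul_sum]
  nlinarith [mul_le_mul_of_nonneg_left hsum hc, mul_nonneg hc (mul_nonneg hc hE)]

/-- Inserting work `d`, at most `L` time units on each machine, in front of an optimal solution. -/
lemma value_insert_le (I : Instance M J) {x x' : J → ℝ} (hx' : 0 ≤ x') {d : M → J → ℝ}
    (hd : 0 ≤ d) (hx : ∀ j, x j = x' j + ∑ i, I.lam i j * d i j) {L R : ℝ}
    (hL : ∀ i, ∑ j, d i j ≤ L) (hR0 : 0 ≤ R) (hR : ∀ i j, I.dens i j ≤ R) :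
    I.value x ≤ I.value x' + ∑ i, ∑ j, I.w j * d i j + L * ∑ j, I.w j / I.p j * x' j
      + Fintype.card M * R * L ^ 2 := by
  obtain ⟨y, hy, hval⟩ := I.exists_value_eq hx'
  have hs : I.Splits x (y + d) := by
    refine ⟨add_nonneg hy.nonneg hd, fun j => ?_⟩
    rw [hx, ← hy.volume j, ← Finset.sum_add_distrib]
    exact Finset.sum_congr rfl fun i _ => by simp only [Pi.add_apply]; ring
  refine hs.value_le.trans ?_
  rw [quad_add, ← hval, sum_marginal_mul, ← sum_dens_mul hy, Finset.sum_add_distrib]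
  -- Planned work of density ρ is delayed by at most L, and min(ρ_j, ρ_k) ≤ ρ_j charges the delay to
  -- it.
  have h1 : ∑ i, minForm (I.dens i) (y i) (d i) ≤ L * ∑ i, ∑ j, I.dens i j * y i j := by
    rw [Finset.mul_sum]
    refine Finset.sum_le_sum fun i _ => ?_
    rw [Finset.mul_sum]
    refine Finset.sum_le_sum fun j _ => ?_
    calc ∑ k, min (I.dens i j) (I.dens i k) * y i j * d i k
        ≤ ∑ k, I.dens i j * y i j * d i k := Finset.sum_le_sum fun k _ =>
          mul_le_mul_of_nonneg_right (mul_le_mul_of_nonneg_right (min_le_left _ _)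
            (hy.nonneg i j)) (hd i k)
      _ = (∑ k, d i k) * (I.dens i j * y i j) := by rw [← Finset.mul_sum]; ring
      _ ≤ _ := mul_le_mul_of_nonneg_right (hL i) (mul_nonneg (I.dens_nonneg i j) (hy.nonneg i j))
  have h2 : ∀ i, 1 / 2 * minForm (I.dens i) (d i) (d i) ≤ R * L ^ 2 := by
    intro i
    have hD : 0 ≤ ∑ j, d i j := Finset.sum_nonneg fun j _ => hd i j
    have h3 : minForm (I.dens i) (d i) (d i) ≤ R * (∑ j, d i j) ^ 2 := by
      rw [sq, Finset.sum_mul_sum, Finset.mul_sum]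
      refine Finset.sum_le_sum fun j _ => ?_
      rw [Finset.mul_sum]
      refine Finset.sum_le_sum fun k _ => ?_
      rw [mul_assoc]
      exact mul_le_mul_of_nonneg_right ((min_le_left _ _).trans (hR i j))
        (mul_nonneg (hd i j) (hd i k))
    have h4 : (∑ j, d i j) ^ 2 ≤ L ^ 2 := pow_le_pow_left₀ hD (hL i) 2
    have h5 := mul_le_mul_of_nonneg_left h4 hR0
    have h6 := minForm_nonneg (I.dens_nonneg i) (hd i) (hd i)
    linarith
  rw [Finset.mul_sum]
  have h3 := Finset.sum_le_sum fun i (_ : i ∈ Finset.univ) => h2 i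
  rw [Finset.sum_const, Finset.card_univ, nsmul_eq_mul, ← mul_assoc] at h3
  linarith

end Instance

/-! ### Fractional and alive weights; the work actually done in an interval -/

namespace Instance

variable {M J : Type} [Fintype J]

/-- Total fractional weight of the remaining sizes `x`. -/
def fracSum (I : Instance M J) (x : J → ℝ) : ℝ := ∑ j, I.w j / I.p j * x j

open Classical in
/-- Total weight of the jobs with positive remaining size. -/
def aliveSum (I : Instance M J) (x : J → ℝ) : ℝ := ∑ j, if 0 < x j then I.w j else 0

lemma fracSum_mono (I : Instance M J) {x y : J → ℝ} (h : x ≤ y) : I.fracSum x ≤ I.fracSum y :=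
  Finset.sum_le_sum fun j _ =>
    mul_le_mul_of_nonneg_left (h j) (div_nonneg (I.w_pos j).le (I.p_pos j).le)

lemma fracSum_nonneg (I : Instance M J) {x : J → ℝ} (h : 0 ≤ x) : 0 ≤ I.fracSum x :=
  Finset.sum_nonneg fun j _ => mul_nonneg (div_nonneg (I.w_pos j).le (I.p_pos j).le) (h j)

lemma aliveSum_mono (I : Instance M J) {x y : J → ℝ} (h : x ≤ y) :
    I.aliveSum x ≤ I.aliveSum y := by
  refine Finset.sum_le_sum fun j _ => ?_
  by_cases hx : 0 < x j
  · rw [if_pos hx, if_pos (hx.trans_le (h j))]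
  · rw [if_neg hx]
    split
    · exact (I.w_pos j).le
    · exact le_rfl

lemma aliveSum_nonneg (I : Instance M J) (x : J → ℝ) : 0 ≤ I.aliveSum x :=
  Finset.sum_nonneg fun j _ => by
    split
    · exact (I.w_pos j).le
    · exact le_rfl

lemma fracSum_le_aliveSum (I : Instance M J) {x : J → ℝ} (hx : x ≤ I.p) :
    I.fracSum x ≤ I.aliveSum x := by
  refine Finset.sum_le_sum fun j _ => ?_
  have h := div_pos (I.w_pos j) (I.p_pos j)
  split
  · calc I.w j / I.p j * x j ≤ I.w j / I.p j * I.p j := mul_le_mul_of_nonneg_left (hx j) h.le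
      _ = I.w j := div_mul_cancel₀ _ (I.p_pos j).ne'
  · next hn => exact mul_nonpos_of_nonneg_of_nonpos h.le (not_lt.1 hn)

end Instance

lemma intervalIntegrable_finsetSum {ι : Type} [Fintype ι] {f : ι → ℝ → ℝ} {u v : ℝ}
    (h : ∀ k, IntervalIntegrable (f k) volume u v) :
    IntervalIntegrable (fun t => ∑ k, f k t) volume u v := by
  have := IntervalIntegrable.sum Finset.univ fun k _ => h k
  rwa [Finset.sum_fn] at this

namespace Schedule

variable {M J : Type} [Fintype M] [Fintype J] {I : Instance M J}

lemma rate_le_one (σ : Schedule I) (t : ℝ) (i : M) (j : J) : σ.rate t i j ≤ 1 :=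
  (Finset.single_le_sum (f := fun j => σ.rate t i j) (fun j _ => σ.rate_nonneg t i j)
    (Finset.mem_univ j)).trans (σ.machine_le_one t i)

lemma intervalIntegrable_rate (σ : Schedule I) (i : M) (j : J) (u v : ℝ) :
    IntervalIntegrable (fun t => σ.rate t i j) volume u v := by
  refine (intervalIntegrable_const (c := (1 : ℝ))).mono_fun
    (σ.measurable_rate i j).aestronglyMeasurable (Eventually.of_forall fun t => ?_)
  show ‖σ.rate t i j‖ ≤ ‖(1 : ℝ)‖
  rw [Real.norm_of_nonneg (σ.rate_nonneg t i j), norm_one]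
  exact σ.rate_le_one t i j

lemma intervalIntegrable_work (σ : Schedule I) (j : J) (u v : ℝ) :
    IntervalIntegrable (fun t => ∑ i, I.lam i j * σ.rate t i j) volume u v :=
  intervalIntegrable_finsetSum fun i => (σ.intervalIntegrable_rate i j u v).const_mul _

lemma work_nonneg (σ : Schedule I) (t : ℝ) (j : J) : 0 ≤ ∑ i, I.lam i j * σ.rate t i j :=
  Finset.sum_nonneg fun i _ => mul_nonneg (I.lam_nonneg i j) (σ.rate_nonneg t i j)

lemma processed_sub (σ : Schedule I) (s : ℝ) (j : J) (u v : ℝ) :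
    σ.processed s j v - σ.processed s j u = s * ∫ t in u..v, ∑ i, I.lam i j * σ.rate t i j := by
  rw [processed, processed, ← mul_sub, intervalIntegral.integral_interval_sub_left
    (σ.intervalIntegrable_work j _ _) (σ.intervalIntegrable_work j _ _)]

lemma processed_mono (σ : Schedule I) {s : ℝ} (hs : 0 ≤ s) (j : J) :
    Monotone (σ.processed s j) := fun u v huv => by
  rw [← sub_nonneg, processed_sub]
  exact mul_nonneg hs (intervalIntegral.integral_nonneg huv fun t _ => σ.work_nonneg t j)

lemma continuous_processed (σ : Schedule I) (s : ℝ) (j : J) : Continuous (σ.processed s j) :=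
  (intervalIntegral.continuous_primitive (fun u v => σ.intervalIntegrable_work j u v) 0).const_mul s

lemma processed_of_le_release (σ : Schedule I) (s : ℝ) {j : J} {t : ℝ} (ht : t ≤ I.r j) :
    σ.processed s j t = 0 := by
  have h : ∫ u in (0 : ℝ)..t, ∑ i, I.lam i j * σ.rate u i j = ∫ u in (0 : ℝ)..t, (0 : ℝ) := by
    refine intervalIntegral.integral_congr_ae ?_
    have hne : ∀ᵐ u : ℝ, u ≠ I.r j := by simp [ae_iff]
    filter_upwards [hne] with u hu hut
    refine Finset.sum_eq_zero fun i _ => ?_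
    have h1 : u < I.r j := by
      rcases Set.mem_uIoc.1 hut with h | h
      · exact lt_of_le_of_ne (h.2.trans ht) hu
      · exact lt_of_le_of_ne (h.2.trans (I.r_nonneg j)) hu
    rw [σ.rate_before_release u i j h1, mul_zero]
  rw [processed, h]
  simp

lemma processed_nonneg (σ : Schedule I) {s : ℝ} (hs : 0 ≤ s) (j : J) (t : ℝ) :
    0 ≤ σ.processed s j t := by
  rcases le_total t (I.r j) with h | h
  · rw [σ.processed_of_le_release s h]
  · rw [← σ.processed_of_le_release s (le_refl (I.r j))]
    exact σ.processed_mono hs j h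

open Classical in
/-- The remaining sizes at time `t` of the jobs that are released by time `T`. -/
def frozen (σ : Schedule I) (s T t : ℝ) (j : J) : ℝ :=
  if I.r j ≤ T then max 0 (I.p j - σ.processed s j t) else 0

lemma frozen_self (σ : Schedule I) (s t : ℝ) : σ.frozen s t t = σ.residual s t := rfl

lemma frozen_of_released (σ : Schedule I) (s t : ℝ) {T : ℝ} {j : J} (h : I.r j ≤ T) :
    σ.frozen s T t j = max 0 (I.p j - σ.processed s j t) := if_pos h

lemma frozen_of_not_released (σ : Schedule I) (s t : ℝ) {T : ℝ} {j : J} (h : ¬I.r j ≤ T) :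
    σ.frozen s T t j = 0 := if_neg h

/-- Ignoring releases after `T` makes the remaining sizes monotone in time. At the next release
time, `frozen` still gives the state just before the jump. -/
lemma frozen_eq_residual (σ : Schedule I) (s : ℝ) {T t : ℝ} (hT : T ≤ t)
    (hr : ∀ j, T < I.r j → t < I.r j) : σ.frozen s T t = σ.residual s t := by
  ext j
  rw [← frozen_self]
  by_cases h : I.r j ≤ T
  · rw [σ.frozen_of_released s t h, σ.frozen_of_released s t (h.trans hT)]
  · rw [σ.frozen_of_not_released s t h,
      σ.frozen_of_not_released s t (not_le.2 (hr j (not_le.1 h)))]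

lemma frozen_nonneg (σ : Schedule I) (s T t : ℝ) : 0 ≤ σ.frozen s T t := fun j => by
  unfold frozen
  split
  · exact le_max_left _ _
  · exact le_rfl

lemma frozen_le (σ : Schedule I) {s : ℝ} (hs : 0 ≤ s) (T t : ℝ) : σ.frozen s T t ≤ I.p :=
  fun j => by
    unfold frozen
    split
    · exact max_le (I.p_pos j).le (sub_le_self _ (σ.processed_nonneg hs j t))
    · exact (I.p_pos j).le

lemma frozen_antitone (σ : Schedule I) {s : ℝ} (hs : 0 ≤ s) (T : ℝ) :
    Antitone (σ.frozen s T) := fun u v huv j => by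
  unfold frozen
  split
  · exact max_le_max_left _ (sub_le_sub_left (σ.processed_mono hs j huv) _)
  · exact le_rfl

lemma residual_nonneg (σ : Schedule I) (s t : ℝ) : 0 ≤ σ.residual s t := σ.frozen_nonneg s t t

lemma antitone_aliveSum_frozen (σ : Schedule I) {s : ℝ} (hs : 0 ≤ s) (T : ℝ) :
    Antitone fun t => I.aliveSum (σ.frozen s T t) := fun _ _ huv =>
  I.aliveSum_mono (σ.frozen_antitone hs T huv)

/-- The effective processing in the interval `[u, v]` stops at the completion time. -/
lemma exists_effective_end (σ : Schedule I) {s : ℝ} (hs : 0 ≤ s) (T : ℝ) {u v : ℝ} (huv : u ≤ v)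
    (j : J) : ∃ c, u ≤ c ∧ c ≤ v ∧
      σ.frozen s T u j - σ.frozen s T v j = s * (∫ t in u..c, ∑ i, I.lam i j * σ.rate t i j) ∧
      ∀ t, u ≤ t → t < c → 0 < σ.frozen s T t j := by
  by_cases hr : I.r j ≤ T
  · simp only [σ.frozen_of_released s _ hr]
    set g : ℝ → ℝ := fun t => I.p j - σ.processed s j t with hg
    have hgc : Continuous g := continuous_const.sub (σ.continuous_processed s j)
    have hga : Antitone g := fun a b hab => sub_le_sub_left (σ.processed_mono hs j hab) _
    have hint : ∀ c, s * (∫ t in u..c, ∑ i, I.lam i j * σ.rate t i j) = g u - g c := fun c => by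
      rw [← processed_sub]; simp only [hg]; ring
    simp only [hint]
    rcases le_or_gt (g u) 0 with h1 | h1
    · refine ⟨u, le_rfl, huv, ?_, fun t h h' => absurd h (not_le.2 h')⟩
      rw [max_eq_left h1, max_eq_left ((hga huv).trans h1)]
      ring
    rcases le_or_gt (g v) 0 with h2 | h2
    · have hclosed : IsClosed {t | t ∈ Set.Icc u v ∧ g t ≤ 0} :=
        isClosed_Icc.inter (isClosed_le hgc continuous_const)
      have hleast := hclosed.isLeast_csInf ⟨v, ⟨huv, le_rfl⟩, h2⟩ ⟨u, fun t ht => ht.1.1⟩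
      set c := sInf {t | t ∈ Set.Icc u v ∧ g t ≤ 0}
      obtain ⟨b, hb, hb0⟩ := intermediate_value_Icc' huv hgc.continuousOn
        (show (0 : ℝ) ∈ Set.Icc (g v) (g u) from ⟨h2, h1.le⟩)
      have hcb : c ≤ b := hleast.2 ⟨hb, hb0.le⟩
      have hgc0 : g c = 0 := le_antisymm hleast.1.2 (hb0 ▸ hga hcb)
      refine ⟨c, hleast.1.1.1, hleast.1.1.2, ?_, fun t hut htc => lt_max_of_lt_right ?_⟩
      · rw [hgc0, max_eq_right h1.le, max_eq_left h2]
      · by_contra hcon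
        exact not_le.2 htc (hleast.2 ⟨⟨hut, htc.le.trans hleast.1.1.2⟩, not_lt.1 hcon⟩)
    · refine ⟨v, huv, le_rfl, ?_, fun t _ htv => lt_max_of_lt_right (h2.trans_le (hga htv.le))⟩
      rw [max_eq_right h1.le, max_eq_right h2.le]
  · refine ⟨u, le_rfl, huv, ?_, fun t h h' => absurd h (not_le.2 h')⟩
    rw [σ.frozen_of_not_released s u hr, σ.frozen_of_not_released s v hr]
    simp

/-- The effective processing of the unit-speed machines in the interval `[u, v]`. -/
lemma exists_effective_work (τ : Schedule I) (T : ℝ) {u v : ℝ} (huv : u ≤ v) :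
    ∃ d : M → J → ℝ, 0 ≤ d ∧
      (∀ j, ∑ i, I.lam i j * d i j = τ.frozen 1 T u j - τ.frozen 1 T v j) ∧
      (∀ i, ∑ j, d i j ≤ v - u) ∧
      ∑ i, ∑ j, I.w j * d i j ≤ ∫ t in u..v, I.aliveSum (τ.frozen 1 T t) := by
  choose c huc hcv hc hpos using τ.exists_effective_end zero_le_one T huv
  have hII := τ.intervalIntegrable_rate
  -- Processing is counted only up to the completion time `c j`, so that it is charged while the job
  -- is alive. By `job_le_one` a job receives at most one unit of machine time per unit of time,
  -- hence its weight is charged at most once.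
  refine ⟨fun i j => ∫ t in u..c j, τ.rate t i j, fun i j =>
    intervalIntegral.integral_nonneg (huc j) fun t _ => τ.rate_nonneg t i j, fun j => ?_,
    fun i => ?_, ?_⟩
  · rw [hc j, one_mul, intervalIntegral.integral_finsetSum fun i _ => (hII i j _ _).const_mul _]
    exact Finset.sum_congr rfl fun i _ => (intervalIntegral.integral_const_mul _ _).symm
  · calc ∑ j, ∫ t in u..c j, τ.rate t i j ≤ ∑ j, ∫ t in u..v, τ.rate t i j := by
          refine Finset.sum_le_sum fun j _ => ?_
          exact intervalIntegral.integral_mono_interval le_rfl (huc j) (hcv j)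
            (Eventually.of_forall fun t => τ.rate_nonneg t i j) (hII i j _ _)
      _ = ∫ t in u..v, ∑ j, τ.rate t i j :=
          (intervalIntegral.integral_finsetSum fun j _ => hII i j _ _).symm
      _ ≤ ∫ t in u..v, (1 : ℝ) := intervalIntegral.integral_mono_on huv
          (intervalIntegrable_finsetSum fun j => hII i j _ _) intervalIntegrable_const
          fun t _ => τ.machine_le_one t i
      _ = v - u := by simp
  · classical
    have hal : ∀ j, IntervalIntegrable (fun t => if 0 < τ.frozen 1 T t j then I.w j else 0)
        volume u v := fun j => by
      refine Antitone.intervalIntegrable fun a b hab => ?_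
      by_cases hb : 0 < τ.frozen 1 T b j
      · show ite _ _ _ ≤ ite _ _ _
        rw [if_pos hb, if_pos (hb.trans_le (τ.frozen_antitone zero_le_one T hab j))]
      · show ite _ _ _ ≤ ite _ _ _
        rw [if_neg hb]
        split
        · exact (I.w_pos j).le
        · exact le_rfl
    have hsum : ∫ t in u..v, I.aliveSum (τ.frozen 1 T t)
        = ∑ j, ∫ t in u..v, if 0 < τ.frozen 1 T t j then I.w j else 0 := by
      rw [← intervalIntegral.integral_finsetSum fun j _ => hal j]
      refine intervalIntegral.integral_congr fun t _ => ?_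
      simp only [Instance.aliveSum]
    rw [hsum, Finset.sum_comm]
    refine Finset.sum_le_sum fun j _ => ?_
    calc ∑ i, I.w j * ∫ t in u..c j, τ.rate t i j
        = I.w j * ∫ t in u..c j, ∑ i, τ.rate t i j := by
          rw [← Finset.mul_sum, intervalIntegral.integral_finsetSum fun i _ => hII i j _ _]
      _ ≤ I.w j * ∫ t in u..c j, (1 : ℝ) := by
          refine mul_le_mul_of_nonneg_left ?_ (I.w_pos j).le
          exact intervalIntegral.integral_mono_on (huc j)
            (intervalIntegrable_finsetSum fun i => hII i j _ _) intervalIntegrable_const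
            fun t _ => τ.job_le_one t j
      _ = ∫ t in u..c j, I.w j := by
          rw [intervalIntegral.integral_const, intervalIntegral.integral_const]
          simp; ring
      _ = ∫ t in u..c j, if 0 < τ.frozen 1 T t j then I.w j else 0 := by
          refine intervalIntegral.integral_congr_ae ?_
          have hne : ∀ᵐ t : ℝ, t ≠ c j := by simp [ae_iff]
          filter_upwards [hne] with t ht htm
          rw [Set.uIoc_of_le (huc j)] at htm
          rw [if_pos (hpos j t htm.1.le (lt_of_le_of_ne htm.2 ht))]
      _ ≤ _ := by
          refine intervalIntegral.integral_mono_interval le_rfl (huc j) (hcv j)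
            (Eventually.of_forall fun t => ?_) (hal j)
          show 0 ≤ ite _ _ _
          split
          · exact (I.w_pos j).le
          · exact le_rfl

end Schedule

/-! ### Drift of the potential between releases -/

/-- A function that increases up to quadratic gaps is increasing. -/
lemma le_of_quadratic_gap {φ : ℝ → ℝ} {a b K : ℝ} (hab : a ≤ b)
    (h : ∀ u v, a ≤ u → u ≤ v → v ≤ b → φ u ≤ φ v + K * (v - u) ^ 2) : φ a ≤ φ b := by
  -- With N equal steps the errors add up to N K ((b - a)/N)², which tends to 0.
  have hN : ∀ N : ℕ, 0 < N → φ a ≤ φ b + K * (b - a) ^ 2 / N := by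
    intro N hN
    have hN' : (0 : ℝ) < N := by exact_mod_cast hN
    set e := (b - a) / N with he
    have he0 : 0 ≤ e := div_nonneg (sub_nonneg.2 hab) hN'.le
    have hNe : N * e = b - a := by rw [he]; field_simp
    have hk : ∀ k : ℕ, k ≤ N → φ a ≤ φ (a + k * e) + k * (K * e ^ 2) := by
      intro k
      induction k with
      | zero => intro _; simp
      | succ k ih =>
        intro hk
        have h1 := ih (by omega)
        have hk' : ((k : ℝ) + 1) ≤ N := by exact_mod_cast hk
        have h2 := h (a + k * e) (a + (k + 1) * e) (by nlinarith [mul_nonneg (Nat.cast_nonneg (α := ℝ) k) he0])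
          (by nlinarith) (by nlinarith)
        have h3 : a + (k + 1) * e - (a + k * e) = e := by ring
        rw [h3] at h2
        push_cast
        linarith
    have h1 := hk N le_rfl
    rw [hNe, add_sub_cancel] at h1
    have h2 : (N : ℝ) * (K * e ^ 2) = K * (b - a) ^ 2 / N := by
      rw [he]; field_simp
    rwa [h2] at h1
  have hlim : Tendsto (fun N : ℕ => φ b + K * (b - a) ^ 2 / N) atTop (𝓝 (φ b + 0)) :=
    tendsto_const_nhds.add (tendsto_const_div_atTop_nhds_zero_nat _)
  rw [add_zero] at hlim
  exact ge_of_tendsto hlim (eventually_atTop.2 ⟨1, fun N hN1 => hN N hN1⟩)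

namespace Schedule

variable {M J : Type} [Fintype M] [Fintype J] {I : Instance M J}

/-- No planned fraction is used up within `h`, so the removed work never exceeds what remains and
the truncation at 0 is inactive. For completed or unreleased jobs the same bound forces the work to
be 0. -/
lemma frozen_of_gdRate (σ : Schedule I) {s T h : ℝ} (hs : 0 ≤ s) {z : M → J → ℝ → ℝ}
    (hz : I.LPOptimal (σ.residual s T) z)
    (hrate : ∀ u, T ≤ u → u < T + h → ∀ i j, σ.rate u i j = I.gdRate z i j)
    (hlim : ∀ i j, 0 < I.gdRate z i j → s * h * I.lam i j ≤ I.p j) {u : ℝ} (hTu : T ≤ u)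
    (huh : u ≤ T + h) (j : J) :
    σ.frozen s T u j
      = σ.residual s T j - s * (u - T) * ∑ i, I.lam i j * I.gdRate z i j := by
  have hc : 0 ≤ s * (u - T) := mul_nonneg hs (sub_nonneg.2 hTu)
  have hle := (hz.value_sub_le (σ.residual_nonneg s T) hc fun i j hij =>
    (mul_le_mul_of_nonneg_right (mul_le_mul_of_nonneg_left (by linarith) hs)
      (I.lam_nonneg i j)).trans (hlim i j hij)).1 j
  have hw0 : 0 ≤ s * (u - T) * ∑ i, I.lam i j * I.gdRate z i j := mul_nonneg hc
    (Finset.sum_nonneg fun i _ => mul_nonneg (I.lam_nonneg i j) (hz.1.gdRate_nonneg i j))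
  have hproc : σ.processed s j u - σ.processed s j T
      = s * (u - T) * ∑ i, I.lam i j * I.gdRate z i j := by
    have : ∫ t in T..u, ∑ i, I.lam i j * σ.rate t i j
        = ∫ t in T..u, ∑ i, I.lam i j * I.gdRate z i j := by
      refine intervalIntegral.integral_congr_ae ?_
      have hne : ∀ᵐ t : ℝ, t ≠ u := by simp [ae_iff]
      filter_upwards [hne] with t ht htm
      rw [Set.uIoc_of_le hTu] at htm
      refine Finset.sum_congr rfl fun i _ => ?_
      rw [hrate t htm.1.le ((lt_of_le_of_ne htm.2 ht).trans_le huh)]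
    rw [processed_sub, this, intervalIntegral.integral_const, smul_eq_mul]
    ring
  rw [← frozen_self] at hle ⊢
  by_cases hr : I.r j ≤ T
  · rw [σ.frozen_of_released s u hr]
    rw [σ.frozen_of_released s T hr] at hle ⊢
    rcases le_total 0 (I.p j - σ.processed s j T) with h0 | h0
    · rw [max_eq_right h0] at hle ⊢
      rw [max_eq_right (by linarith)]
      linarith
    · rw [max_eq_left h0] at hle ⊢
      rw [max_eq_left (by linarith)]
      linarith
  · rw [σ.frozen_of_not_released s u hr]
    rw [σ.frozen_of_not_released s T hr] at hle ⊢
    linarith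

/-- The drift of the residual optimum of the combined remaining sizes. -/
lemma value_combined_le (σ τ : Schedule I) {s T h : ℝ} (hs : 0 ≤ s) (hh : 0 ≤ h)
    {n : ℕ} (hn : 1 ≤ n) {z : M → J → ℝ → ℝ} (hz : I.LPOptimal (σ.residual s T) z)
    (hrate : ∀ u, T ≤ u → u < T + h → ∀ i j, σ.rate u i j = I.gdRate z i j)
    (hlim : ∀ i j, 0 < I.gdRate z i j → s * h * I.lam i j ≤ I.p j) :
    I.value (σ.frozen s T T + ((n : ℝ) - 1) • τ.frozen 1 T T)
      ≤ I.value (σ.frozen s T (T + h) + ((n : ℝ) - 1) • τ.frozen 1 T (T + h))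
        + (2 * s + n - 1) * h * I.fracSum (σ.residual s T)
        + ((n : ℝ) - 1) * (s + n) * ∫ t in T..T + h, I.aliveSum (τ.frozen 1 T t) := by
  have hn1 : (0 : ℝ) ≤ n - 1 := by
    have : (1 : ℝ) ≤ n := by exact_mod_cast hn
    linarith
  have hal := fun u v : ℝ => (τ.antitone_aliveSum_frozen zero_le_one T).intervalIntegrable
    (μ := volume) (a := u) (b := v)
  obtain ⟨R, hR0, hR⟩ : ∃ R : ℝ, 0 ≤ R ∧ ∀ i j, I.dens i j ≤ R := by
    refine ⟨∑ i, ∑ j, I.dens i j, Finset.sum_nonneg fun i _ => Finset.sum_nonneg fun j _ =>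
      I.dens_nonneg i j, fun i j => ?_⟩
    exact (Finset.single_le_sum (f := fun j => I.dens i j) (fun j _ => I.dens_nonneg i j)
      (Finset.mem_univ j)).trans (Finset.single_le_sum (f := fun i => ∑ j, I.dens i j)
      (fun i _ => Finset.sum_nonneg fun j _ => I.dens_nonneg i j) (Finset.mem_univ i))
  set F := I.fracSum (σ.residual s T) with hF
  set X : ℝ → J → ℝ := fun u => σ.frozen s T u + ((n : ℝ) - 1) • τ.frozen 1 T u with hX
  have hX0 : ∀ u, 0 ≤ X u := fun u => add_nonneg (σ.frozen_nonneg s T u)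
    (smul_nonneg hn1 (τ.frozen_nonneg 1 T u))
  -- Insertion costs an error of order (v - u)² from the interaction of the inserted work with
  -- itself. Monotonicity of φ up to such gaps, and thus exactly, is the claim.
  set φ : ℝ → ℝ := fun u => I.value (X u) + (2 * s + n - 1) * F * (u - T)
    + ((n : ℝ) - 1) * (s + n) * ∫ t in T..u, I.aliveSum (τ.frozen 1 T t) with hφ
  have hmono : φ T ≤ φ (T + h) := by
    refine le_of_quadratic_gap (K := Fintype.card M * R * (s + n - 1) ^ 2) (by linarith)
      fun u v hTu huv hvh => ?_
    obtain ⟨d, hd0, hdv, hdm, hdw⟩ := τ.exists_effective_work T huv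
    have hg0 := hz.1.gdRate_nonneg
    have hvu : 0 ≤ v - u := sub_nonneg.2 huv
    have hsvu : 0 ≤ s * (v - u) := mul_nonneg hs hvu
    have hg1 : ∀ i, ∑ j, I.gdRate z i j ≤ 1 := by
      obtain ⟨y, a, -, -, -, -, -, h1, -⟩ := hz.exists_cut (σ.residual_nonneg s T)
      exact h1
    -- Reinsert the work of the algorithm and n - 1 times that of the adversary, at most (s + n -
    -- 1)(v - u) per machine. Its weight contributes s and the delay s + n - 1 to the coefficient of
    -- `F`; for the adversary the contributions are (n - 1) and (n - 1)(s + n - 1).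
    have hstep := I.value_insert_le (hX0 v) (x := X u)
      (d := fun i j => s * (v - u) * I.gdRate z i j + ((n : ℝ) - 1) * d i j)
      (fun i j => add_nonneg (mul_nonneg hsvu (hg0 i j)) (mul_nonneg hn1 (hd0 i j)))
      (fun j => by
        have h1 := σ.frozen_of_gdRate hs hz hrate hlim hTu (huv.trans hvh) j
        have h2 := σ.frozen_of_gdRate hs hz hrate hlim (hTu.trans huv) hvh j
        have h3 := hdv j
        have h4 : ∑ i, I.lam i j * (s * (v - u) * I.gdRate z i j + ((n : ℝ) - 1) * d i j)
            = s * (v - u) * ∑ i, I.lam i j * I.gdRate z i j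
              + ((n : ℝ) - 1) * ∑ i, I.lam i j * d i j := by
          rw [Finset.mul_sum, Finset.mul_sum, ← Finset.sum_add_distrib]
          exact Finset.sum_congr rfl fun i _ => by ring
        simp only [hX, Pi.add_apply, Pi.smul_apply, smul_eq_mul]
        rw [h4, h3, h1, h2]
        ring)
      (L := (s + n - 1) * (v - u))
      (fun i => by
        rw [Finset.sum_add_distrib, ← Finset.mul_sum, ← Finset.mul_sum]
        have h1 := mul_le_mul_of_nonneg_left (hg1 i) hsvu
        have h2 := mul_le_mul_of_nonneg_left (hdm i) hn1
        linarith) hR0 hR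
    have hwd : ∑ i, ∑ j, I.w j * (s * (v - u) * I.gdRate z i j + ((n : ℝ) - 1) * d i j)
        ≤ s * (v - u) * F + ((n : ℝ) - 1) * ∫ t in u..v, I.aliveSum (τ.frozen 1 T t) := by
      have h1 : ∑ i, ∑ j, I.w j * I.gdRate z i j ≤ F := by
        rw [Finset.sum_comm]
        refine Finset.sum_le_sum fun j _ => ?_
        rw [← Finset.mul_sum]
        calc I.w j * ∑ i, I.gdRate z i j ≤ I.w j * (σ.residual s T j / I.p j) :=
              mul_le_mul_of_nonneg_left (hz.sum_gdRate_le (σ.residual_nonneg s T) j) (I.w_pos j).le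
          _ = _ := by ring
      have h2 : ∑ i, ∑ j, I.w j * (s * (v - u) * I.gdRate z i j + ((n : ℝ) - 1) * d i j)
          = s * (v - u) * (∑ i, ∑ j, I.w j * I.gdRate z i j)
            + ((n : ℝ) - 1) * ∑ i, ∑ j, I.w j * d i j := by
        simp only [Finset.mul_sum, ← Finset.sum_add_distrib]
        exact Finset.sum_congr rfl fun i _ => Finset.sum_congr rfl fun j _ => by ring
      rw [h2]
      exact add_le_add (mul_le_mul_of_nonneg_left h1 hsvu) (mul_le_mul_of_nonneg_left hdw hn1)
    have hfrac : (v - u) * I.fracSum (X v)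
        ≤ (v - u) * F + ((n : ℝ) - 1) * ∫ t in u..v, I.aliveSum (τ.frozen 1 T t) := by
      have h1 : I.fracSum (X v)
          = I.fracSum (σ.frozen s T v) + ((n : ℝ) - 1) * I.fracSum (τ.frozen 1 T v) := by
        simp only [Instance.fracSum, hX, Pi.add_apply, Pi.smul_apply, smul_eq_mul,
          Finset.mul_sum, ← Finset.sum_add_distrib]
        exact Finset.sum_congr rfl fun j _ => by ring
      have h2 : I.fracSum (σ.frozen s T v) ≤ F :=
        I.fracSum_mono (σ.frozen_antitone hs T (hTu.trans huv))
      have h3 : (v - u) * I.fracSum (τ.frozen 1 T v)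
          ≤ ∫ t in u..v, I.aliveSum (τ.frozen 1 T t) := by
        calc (v - u) * I.fracSum (τ.frozen 1 T v)
            = ∫ _t in u..v, I.fracSum (τ.frozen 1 T v) := by
              rw [intervalIntegral.integral_const, smul_eq_mul]
          _ ≤ _ := intervalIntegral.integral_mono_on huv intervalIntegrable_const (hal u v)
              fun t ht => (I.fracSum_le_aliveSum (τ.frozen_le zero_le_one T v)).trans
                (τ.antitone_aliveSum_frozen zero_le_one T ht.2)
      rw [h1, mul_add]
      have h4 := mul_le_mul_of_nonneg_left h2 hvu
      have h5 := mul_le_mul_of_nonneg_left h3 hn1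
      linarith
    have hadd := intervalIntegral.integral_add_adjacent_intervals (hal T u) (hal u v)
    have hfrac' := mul_le_mul_of_nonneg_left hfrac (add_nonneg hs hn1)
    simp only [hφ]
    rw [← hadd]
    set P := ∫ t in u..v, I.aliveSum (τ.frozen 1 T t)
    change _ ≤ _ + _ + (s + n - 1) * (v - u) * I.fracSum (X v) + _ at hstep
    linarith
  simp only [hφ, sub_self, mul_zero, add_zero, intervalIntegral.integral_same] at hmono
  rw [add_sub_cancel_left] at hmono
  linarith

/-- The drift of the potential in an interval without releases in which the algorithm follows an
approximate gradient. -/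
lemma potential_drift (σ τ : Schedule I) {ε s T h : ℝ} (hε : 0 < ε) (hε8 : ε < 1 / 8)
    (hs : s = 1 + 2 * ε) (hh : 0 ≤ h) {n : ℕ} (hn : 1 ≤ n * ε) (hn' : ((n : ℝ) - 1) * ε ≤ 1)
    {z : M → J → ℝ → ℝ} (hz : I.LPOptimal (σ.residual s T) z)
    (hrate : ∀ u, T ≤ u → u < T + h → ∀ i j, σ.rate u i j = I.gdRate z i j)
    (hlim : ∀ i j, 0 < I.gdRate z i j → s * h * I.lam i j ≤ I.p j) :
    potential I n (σ.frozen s T (T + h)) (τ.frozen 1 T (T + h))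
        - potential I n (σ.residual s T) (τ.residual 1 T)
      ≤ -(h * I.fracSum (σ.residual s T))
        + 4 / ε ^ 2 * ∫ t in T..T + h, I.aliveSum (τ.frozen 1 T t) := by
  have hs0 : 0 ≤ s := by rw [hs]; linarith
  have hn1 : 1 ≤ n := by
    rcases Nat.eq_zero_or_pos n with h0 | h0
    · rw [h0] at hn; norm_num at hn
    · exact h0
  have hn1' : (1 : ℝ) ≤ n := by exact_mod_cast hn1
  have hA := (hz.value_sub_le (σ.residual_nonneg s T) (mul_nonneg hs0 hh) hlim).2
  have hfun : (fun j => σ.residual s T j - s * h * ∑ i, I.lam i j * I.gdRate z i j)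
      = σ.frozen s T (T + h) := by
    ext j
    rw [σ.frozen_of_gdRate hs0 hz hrate hlim (by linarith) le_rfl j, add_sub_cancel_left]
  rw [hfun] at hA
  have hB := σ.value_combined_le τ hs0 hh hn1 hz hrate hlim
  rw [I.potential_eq hn1 (σ.frozen_nonneg _ _ _) (τ.frozen_nonneg _ _ _),
    I.potential_eq hn1 (σ.residual_nonneg _ _) (τ.residual_nonneg _ _)]
  change I.value (fun j => σ.residual s T j + ((n : ℝ) - 1) * τ.residual 1 T j)
    ≤ I.value (fun j => σ.frozen s T (T + h) j + ((n : ℝ) - 1) * τ.frozen 1 T (T + h) j) + _ + _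
    at hB
  change I.value (σ.frozen s T (T + h))
    ≤ I.value (σ.residual s T) - s * h * I.fracSum (σ.residual s T) at hA
  set P := ∫ t in T..T + h, I.aliveSum (τ.frozen 1 T t) with hP
  set F := I.fracSum (σ.residual s T) with hF
  set G := I.value fun j => σ.residual s T j + ((n : ℝ) - 1) * τ.residual 1 T j
  set G' := I.value fun j => σ.frozen s T (T + h) j + ((n : ℝ) - 1) * τ.frozen 1 T (T + h) j
  have hP0 : 0 ≤ P := intervalIntegral.integral_nonneg (by linarith)
    fun t _ => I.aliveSum_nonneg _
  have hF0 : 0 ≤ h * F := mul_nonneg hh (I.fracSum_nonneg (σ.residual_nonneg s T))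
  have hn0 : (n : ℝ) ≠ 0 := by linarith
  have e : ∀ f g : ℝ, 2 * (n : ℝ) * (f - 1 / n * g) = 2 * n * f - 2 * g := fun f g => by
    field_simp
  rw [e, e]
  have c1 : ((n : ℝ) - 1) ≤ 1 / ε := by rwa [le_div_iff₀ hε]
  have c2 : 8 ≤ 1 / ε := by rw [le_div_iff₀ hε]; linarith
  have c3 : (n : ℝ) + s ≤ 2 * (1 / ε) := by rw [hs]; linarith
  have c4 : 2 * (((n : ℝ) - 1) * (s + n)) ≤ 4 / ε ^ 2 := by
    have h1 : ((n : ℝ) - 1) * (s + n) ≤ 1 / ε * (2 * (1 / ε)) :=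
      mul_le_mul c1 (by linarith) (by linarith) (by positivity)
    have h2 : 1 / ε * (2 * (1 / ε)) = 2 / ε ^ 2 := by field_simp
    have h3 : 4 / ε ^ 2 = 2 * (2 / ε ^ 2) := by ring
    rw [h3]; linarith
  have c5 := mul_le_mul_of_nonneg_right c4 hP0
  -- For s = 1 + 2ε the coefficient is -4nε + 2 + 8ε, which is at most -1 because nε ≥ 1 and ε <
  -- 1/8.
  have c6 : (-2 * n * s + 2 * (2 * s + n - 1)) * (h * F) ≤ -1 * (h * F) := by
    refine mul_le_mul_of_nonneg_right ?_ hF0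
    rw [hs]
    nlinarith
  nlinarith [mul_le_mul_of_nonneg_left hA (show (0 : ℝ) ≤ 2 * n by linarith)]

lemma fracWeight_eq (σ : Schedule I) (s t : ℝ) :
    σ.fracWeight s t = I.fracSum (σ.residual s t) := rfl

lemma aliveWeight_eq (σ : Schedule I) (s t : ℝ) :
    σ.aliveWeight s t = I.aliveSum (σ.residual s t) := rfl

end Schedule

section Runs

variable {M J : Type} [Fintype M] [Fintype J] {I : Instance M J}

lemma Instance.gdRate_eq_zero_of_lam {M J : Type} [Fintype J] {I : Instance M J} {i : M} {j : J} (h : I.lam i j = 0) (z : M → J → ℝ → ℝ) :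
    I.gdRate z i j = 0 := by
  simp [Instance.gdRate, h]

lemma Instance.lam_pos_of_gdRate_pos {M J : Type} [Fintype J] {I : Instance M J} {i : M} {j : J} {z : M → J → ℝ → ℝ}
    (h : 0 < I.gdRate z i j) : 0 < I.lam i j := by
  refine lt_of_le_of_ne (I.lam_nonneg i j) fun h0 => ?_
  rw [Instance.gdRate_eq_zero_of_lam h0.symm] at h
  exact lt_irrefl _ h

namespace Schedule

/-- For small `h` there is no release in (t, t + h] and no planned fraction is used up. The alive
weight of the adversary does not increase meanwhile, so its integral is at most h times its value at
`t`. -/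
lemma potential_drift_eventually (σ τ : Schedule I) {ε s C : ℝ} (hε : 0 < ε) (hε8 : ε < 1 / 8)
    (hs : s = 1 + 2 * ε) (hC : 4 ≤ C) {n : ℕ} (hn : ε = 1 / n) {t δ : ℝ} (hδ : 0 < δ)
    {z : M → J → ℝ → ℝ} (hz : I.LPOptimal (σ.residual s t) z)
    (hrate : ∀ u, t ≤ u → u < t + δ → ∀ i j, σ.rate u i j = I.gdRate z i j) :
    ∀ᶠ h in 𝓝[>] (0 : ℝ),
      (potential I n (σ.residual s (t + h)) (τ.residual 1 (t + h))
        - potential I n (σ.residual s t) (τ.residual 1 t)) / h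
        ≤ -σ.fracWeight s t + C / ε ^ 2 * τ.aliveWeight 1 t := by
  have hn0 : (n : ℝ) ≠ 0 := by
    rintro h0
    rw [h0, div_zero] at hn
    exact hε.ne' hn
  have hnε : n * ε = 1 := by rw [hn]; field_simp
  have e1 : ∀ᶠ h in 𝓝[>] (0 : ℝ), ∀ i j, s * h * I.lam i j ≤ I.p j := by
    rw [eventually_all]; intro i
    rw [eventually_all]; intro j
    refine (((continuous_const.mul continuous_id).mul continuous_const).tendsto'
      (0 : ℝ) 0 (by simp) |>.eventually (eventually_le_nhds (I.p_pos j))).filter_mono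
      nhdsWithin_le_nhds
  have e2 : ∀ᶠ h in 𝓝[>] (0 : ℝ), ∀ j, t < I.r j → t + h < I.r j := by
    rw [eventually_all]; intro j
    by_cases hj : t < I.r j
    · refine Eventually.mono (Ioo_mem_nhdsGT (sub_pos.2 hj)) fun h hh _ => ?_
      linarith [hh.2]
    · exact Eventually.of_forall fun h h' => absurd h' hj
  filter_upwards [e1, e2, Ioo_mem_nhdsGT hδ] with h h1 h2 h3
  have hd := σ.potential_drift τ hε hε8 hs h3.1.le (n := n) hnε.ge (by linarith) hz
    (fun u hu hu' => hrate u hu (by linarith [h3.2])) fun i j _ => h1 i j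
  rw [σ.frozen_eq_residual s (by linarith [h3.1]) h2, τ.frozen_eq_residual 1 (by linarith [h3.1]) h2]
    at hd
  rw [div_le_iff₀ h3.1, fracWeight_eq, aliveWeight_eq]
  refine hd.trans ?_
  have hint : ∫ u in t..t + h, I.aliveSum (τ.frozen 1 t u)
      ≤ ∫ _u in t..t + h, I.aliveSum (τ.residual 1 t) :=
    intervalIntegral.integral_mono_on (by linarith [h3.1])
      (τ.antitone_aliveSum_frozen zero_le_one t).intervalIntegrable intervalIntegrable_const
      fun u hu => τ.antitone_aliveSum_frozen zero_le_one t hu.1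
  rw [intervalIntegral.integral_const, smul_eq_mul, add_sub_cancel_left] at hint
  have hε2 : 0 < ε ^ 2 := by positivity
  have hP0 : 0 ≤ h * I.aliveSum (τ.residual 1 t) := mul_nonneg h3.1.le (I.aliveSum_nonneg _)
  have h4 : 4 / ε ^ 2 ≤ C / ε ^ 2 := div_le_div_of_nonneg_right hC hε2.le
  have h5 : 0 ≤ 4 / ε ^ 2 := by positivity
  nlinarith [mul_le_mul_of_nonneg_left hint h5, mul_le_mul_of_nonneg_right h4 hP0]

end Schedule

namespace IsApproxGD

variable {s : ℝ} {σ : Schedule I} {T : ℕ → ℝ} {z : ℕ → M → J → ℝ → ℝ}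

lemma le_release (hrun : IsApproxGD s σ T z) (k : ℕ) (j : J) (hj : T k < I.r j) :
    T (k + 1) ≤ I.r j := by
  have hmem : I.r j ∈ I.revisionTimes s (T k) (z k) := Or.inr ⟨hj, j, rfl⟩
  exact (hrun.next k ⟨_, hmem⟩).2 hmem

/-- The next decision comes no later than the first completion of a planned fraction, which is the
limit required for the descent estimate. -/
lemma step_le (hrun : IsApproxGD s σ T z) (hs : 0 < s) (k : ℕ) {h : ℝ}
    (hh : T k + h ≤ T (k + 1)) (i : M) (j : J) (hij : 0 < I.gdRate (z k) i j) :
    s * h * I.lam i j ≤ I.p j := by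
  have hmem : T k + I.p j / I.lam i j / s ∈ I.revisionTimes s (T k) (z k) :=
    Or.inl ⟨i, j, hij, rfl⟩
  have h1 := (hrun.next k ⟨_, hmem⟩).2 hmem
  have hl := Instance.lam_pos_of_gdRate_pos hij
  have h2 : h ≤ I.p j / I.lam i j / s := by linarith
  rw [le_div_iff₀ hs, le_div_iff₀ hl] at h2
  linarith

lemma drift (hrun : IsApproxGD s σ T z) (τ : Schedule I) {ε : ℝ} (hε : 0 < ε)
    (hε8 : ε < 1 / 8) (hs : s = 1 + 2 * ε) {n : ℕ} (hn : 1 ≤ n * ε)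
    (hn' : ((n : ℝ) - 1) * ε ≤ 1) (k : ℕ) {t : ℝ} (ht : T k ≤ t) (ht' : t ≤ T (k + 1)) :
    potential I n (σ.frozen s (T k) t) (τ.frozen 1 (T k) t)
        - potential I n (σ.residual s (T k)) (τ.residual 1 (T k))
      ≤ -((t - T k) * I.fracSum (σ.residual s (T k)))
        + 4 / ε ^ 2 * ∫ u in (T k)..t, I.aliveSum (τ.frozen 1 (T k) u) := by
  have h := σ.potential_drift τ hε hε8 hs (sub_nonneg.2 ht) hn hn' (hrun.optimal k)
    (fun u hu hu' => hrun.rate_eq k u hu (by linarith))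
    (fun i j hij => hrun.step_le (by linarith) k (by linarith) i j hij)
  rwa [add_sub_cancel] at h

/-- The fractional weight of the algorithm does not increase between decisions, so its integral is
at most the interval length times its initial value. -/
lemma drift_integral (hrun : IsApproxGD s σ T z) (τ : Schedule I) {ε C : ℝ} (hε : 0 < ε)
    (hε8 : ε < 1 / 8) (hs : s = 1 + 2 * ε) (hC : 4 ≤ C) {n : ℕ} (hn : ε = 1 / n) (k : ℕ) {t : ℝ}
    (ht : T k ≤ t) (ht' : t < T (k + 1)) :
    potential I n (σ.residual s t) (τ.residual 1 t)
        - potential I n (σ.residual s (T k)) (τ.residual 1 (T k))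
      ≤ ∫ u in (T k)..t, (-σ.fracWeight s u + C / ε ^ 2 * τ.aliveWeight 1 u) := by
  have hs0 : 0 ≤ s := by linarith
  have hn0 : (n : ℝ) ≠ 0 := by
    rintro h0
    rw [h0, div_zero] at hn
    exact hε.ne' hn
  have hnε : n * ε = 1 := by rw [hn]; field_simp
  have hrel : ∀ u, u ≤ t → ∀ j, T k < I.r j → u < I.r j := fun u hu j hj =>
    (hu.trans_lt ht').trans_le (hrun.le_release k j hj)
  have hd := hrun.drift τ hε hε8 hs (n := n) hnε.ge (by linarith) k ht ht'.le
  rw [σ.frozen_eq_residual s ht (hrel t le_rfl), τ.frozen_eq_residual 1 ht (hrel t le_rfl)] at hd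
  refine hd.trans ?_
  have hcongr : ∫ u in (T k)..t, (-σ.fracWeight s u + C / ε ^ 2 * τ.aliveWeight 1 u)
      = ∫ u in (T k)..t, (-I.fracSum (σ.frozen s (T k) u)
        + C / ε ^ 2 * I.aliveSum (τ.frozen 1 (T k) u)) := by
    refine intervalIntegral.integral_congr fun u hu => ?_
    rw [Set.uIcc_of_le ht] at hu
    simp only [Schedule.fracWeight_eq, Schedule.aliveWeight_eq]
    rw [σ.frozen_eq_residual s hu.1 (hrel u hu.2), τ.frozen_eq_residual 1 hu.1 (hrel u hu.2)]
  have hfa : Antitone fun u => I.fracSum (σ.frozen s (T k) u) := fun _ _ huv =>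
    I.fracSum_mono (σ.frozen_antitone hs0 (T k) huv)
  have hfi : IntervalIntegrable (fun u => I.fracSum (σ.frozen s (T k) u)) volume (T k) t :=
    hfa.intervalIntegrable
  have hfn : IntervalIntegrable (fun u => -I.fracSum (σ.frozen s (T k) u)) volume (T k) t := hfi.neg
  have hai : IntervalIntegrable (fun u => I.aliveSum (τ.frozen 1 (T k) u)) volume (T k) t :=
    (τ.antitone_aliveSum_frozen zero_le_one (T k)).intervalIntegrable
  rw [hcongr, intervalIntegral.integral_add hfn (hai.const_mul _),
    intervalIntegral.integral_neg, intervalIntegral.integral_const_mul]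
  refine add_le_add (neg_le_neg ?_) ?_
  · calc ∫ u in (T k)..t, I.fracSum (σ.frozen s (T k) u)
        ≤ ∫ _u in (T k)..t, I.fracSum (σ.residual s (T k)) :=
          intervalIntegral.integral_mono_on ht hfi intervalIntegrable_const fun u hu => hfa hu.1
      _ = _ := by rw [intervalIntegral.integral_const, smul_eq_mul]
  · refine mul_le_mul_of_nonneg_right (div_le_div_of_nonneg_right hC (by positivity)) ?_
    exact intervalIntegral.integral_nonneg ht fun u _ => I.aliveSum_nonneg _

end IsApproxGD

/-! ### Releases, weighted flow time and the alive weight -/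

namespace Schedule

/-- At a release time the remaining sizes jump by the sizes of the released jobs. -/
lemma residual_eq_frozen_add (σ : Schedule I) (s : ℝ) {T t : ℝ} (hT : T ≤ t)
    (hr : ∀ j, T < I.r j → t ≤ I.r j) :
    σ.residual s t = σ.frozen s T t + fun j => if T < I.r j ∧ I.r j ≤ t then I.p j else 0 := by
  ext j
  rw [← frozen_self, Pi.add_apply]
  by_cases h1 : I.r j ≤ T
  · rw [σ.frozen_of_released s t h1, σ.frozen_of_released s t (h1.trans hT),
      if_neg fun h => not_lt.2 h1 h.1, add_zero]
  · rw [σ.frozen_of_not_released s t h1, zero_add]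
    by_cases h2 : I.r j ≤ t
    · rw [if_pos ⟨not_le.1 h1, h2⟩, σ.frozen_of_released s t h2,
        σ.processed_of_le_release s (hr j (not_le.1 h1)), sub_zero, max_eq_right (I.p_pos j).le]
    · rw [if_neg fun h => h2 h.2, σ.frozen_of_not_released s t h2]

lemma potential_release_le (σ τ : Schedule I) (s : ℝ) {n : ℕ} (hn : 1 ≤ n) {T t : ℝ} (hT : T ≤ t)
    (hr : ∀ j, T < I.r j → t ≤ I.r j) :
    potential I n (σ.residual s t) (τ.residual 1 t)
      ≤ potential I n (σ.frozen s T t) (τ.frozen 1 T t) := by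
  have hn0 : (0 : ℝ) < n := by exact_mod_cast hn
  rw [I.potential_eq hn (σ.residual_nonneg _ _) (τ.residual_nonneg _ _),
    I.potential_eq hn (σ.frozen_nonneg _ _ _) (τ.frozen_nonneg _ _ _),
    σ.residual_eq_frozen_add s hT hr, τ.residual_eq_frozen_add 1 hT hr]
  have key := I.value_release hn (σ.frozen_nonneg s T t) (τ.frozen_nonneg 1 T t)
    (e := fun j => if T < I.r j ∧ I.r j ≤ t then I.p j else 0)
    (fun j => by
      show 0 ≤ ite _ _ _
      split
      · exact (I.p_pos j).le
      · exact le_rfl)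
    (fun j => by
      by_cases h : I.r j ≤ T
      · left; exact if_neg fun h' => not_lt.2 h h'.1
      · right
        exact ⟨σ.frozen_of_not_released s t h, τ.frozen_of_not_released 1 t h⟩)
  refine mul_le_mul_of_nonneg_left ?_ (by positivity)
  rw [mul_sub] at key
  change _ ≤ 1 / (n : ℝ) * I.value (fun j => _) - 1 / (n : ℝ) * I.value (fun j => _) at key
  simp only [Pi.add_apply, Pi.smul_apply, smul_eq_mul] at key ⊢
  linarith

lemma measurable_residual (σ : Schedule I) (s : ℝ) (j : J) :
    Measurable fun t => σ.residual s t j := by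
  unfold residual
  exact Measurable.ite (measurableSet_le measurable_const measurable_id)
    (measurable_const.max (measurable_const.sub (σ.continuous_processed s j).measurable))
    measurable_const

lemma ofReal_aliveWeight (σ : Schedule I) (s t : ℝ) :
    ENNReal.ofReal (σ.aliveWeight s t)
      = ∑ j, ENNReal.ofReal (I.w j) * {t | 0 < σ.residual s t j}.indicator 1 t := by
  rw [aliveWeight, ENNReal.ofReal_sum_of_nonneg]
  · refine Finset.sum_congr rfl fun j _ => ?_
    by_cases h : 0 < σ.residual s t j <;> simp [h]
  · intro j _
    split
    · exact (I.w_pos j).le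
    · exact le_rfl

lemma lintegral_aliveWeight_eq (σ : Schedule I) (s : ℝ) :
    ∫⁻ t in Set.Ici (0 : ℝ), ENNReal.ofReal (σ.aliveWeight s t)
      = ∑ j, ENNReal.ofReal (I.w j) * volume ({t | 0 < σ.residual s t j} ∩ Set.Ici 0) := by
  have hm : ∀ j, MeasurableSet {t | 0 < σ.residual s t j} := fun j =>
    measurableSet_lt measurable_const (σ.measurable_residual s j)
  simp only [ofReal_aliveWeight]
  rw [lintegral_finsetSum _ fun j _ => (measurable_one.indicator (hm j)).const_mul _]
  refine Finset.sum_congr rfl fun j _ => ?_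
  rw [lintegral_const_mul _ (measurable_one.indicator (hm j)), lintegral_indicator_one (hm j),
    Measure.restrict_apply (hm j)]

lemma residual_pos_iff (σ : Schedule I) (s t : ℝ) (j : J) :
    0 < σ.residual s t j ↔ I.r j ≤ t ∧ σ.processed s j t < I.p j := by
  unfold residual
  by_cases h : I.r j ≤ t
  · simp [h]
  · simp [h]

/-- The weight of the alive jobs integrates to at most the weighted flow time. -/
lemma lintegral_aliveWeight_le (σ : Schedule I) {s : ℝ} (hs : 0 ≤ s) :
    ∫⁻ t in Set.Ici (0 : ℝ), ENNReal.ofReal (σ.aliveWeight s t) ≤ σ.weightedFlow s := by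
  rw [lintegral_aliveWeight_eq, weightedFlow]
  gcongr with j
  have hle : ∀ t, 0 < σ.residual s t j → ENNReal.ofReal t ≤ σ.completionTime s j := by
    intro t ht
    rw [residual_pos_iff] at ht
    refine le_iInf₂ fun t' ht' => ENNReal.ofReal_le_ofReal ?_
    by_contra hlt
    exact not_lt.2 (ht'.2.trans (σ.processed_mono hs j (not_le.1 hlt).le)) ht.2
  by_cases hC : σ.completionTime s j = ∞
  · rw [hC]; simp
  · calc volume ({t | 0 < σ.residual s t j} ∩ Set.Ici 0)
        ≤ volume (Set.Icc (I.r j) (σ.completionTime s j).toReal) := by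
          refine measure_mono fun t ht => ⟨((residual_pos_iff σ s t j).1 ht.1).1, ?_⟩
          exact (ENNReal.ofReal_le_iff_le_toReal hC).1 (hle t ht.1)
      _ = _ := by
          rw [Real.volume_Icc, ENNReal.ofReal_sub _ (I.r_nonneg j), ENNReal.ofReal_toReal hC]

/-- The weighted flow time is at most the integral of the weight of the alive jobs. -/
lemma weightedFlow_le (σ : Schedule I) (s : ℝ) :
    σ.weightedFlow s ≤ ∫⁻ t in Set.Ici (0 : ℝ), ENNReal.ofReal (σ.aliveWeight s t) := by
  rw [lintegral_aliveWeight_eq, weightedFlow]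
  gcongr with j
  have halive : ∀ t, I.r j ≤ t → ENNReal.ofReal t < σ.completionTime s j →
      0 < σ.residual s t j := by
    intro t hrt ht
    rw [residual_pos_iff]
    refine ⟨hrt, ?_⟩
    by_contra hcon
    exact not_lt.2 (iInf₂_le t ⟨hrt, not_lt.1 hcon⟩) ht
  by_cases hC : σ.completionTime s j = ∞
  · refine le_top.trans ((Real.volume_Ici (a := I.r j)).symm.le.trans (measure_mono fun t ht =>
      ⟨halive t ht (by rw [hC]; exact ENNReal.ofReal_lt_top), (I.r_nonneg j).trans ht⟩))
  · have hvol : σ.completionTime s j - ENNReal.ofReal (I.r j)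
        = volume (Set.Ico (I.r j) (σ.completionTime s j).toReal) := by
      rw [Real.volume_Ico, ENNReal.ofReal_sub _ (I.r_nonneg j), ENNReal.ofReal_toReal hC]
    rw [hvol]
    refine measure_mono fun t ht => ⟨halive t ht.1 ?_, (I.r_nonneg j).trans ht.1⟩
    exact (ENNReal.ofReal_lt_iff_lt_toReal ((I.r_nonneg j).trans ht.1) hC).2 ht.2

/-- An unfinished job would have infinite completion time and positive weight. After the adversary
has finished, the potential is nonnegative. -/
lemma exists_residual_eq_zero (τ : Schedule I) {s : ℝ} (hs : 0 ≤ s)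
    (hfin : τ.weightedFlow s ≠ ∞) : ∃ t₁, ∀ t, t₁ ≤ t → τ.residual s t = 0 := by
  have hex : ∀ j, ∃ t, I.p j ≤ τ.processed s j t := by
    intro j
    by_contra hcon
    push Not at hcon
    apply hfin
    rw [weightedFlow, ENNReal.sum_eq_top]
    refine ⟨j, Finset.mem_univ j, ?_⟩
    have : τ.completionTime s j = ∞ := by
      refine iInf₂_eq_top.2 fun t ht => absurd ht.2 (not_le.2 (hcon t))
    rw [this, ENNReal.top_sub ENNReal.ofReal_ne_top, ENNReal.mul_top]
    simpa using I.w_pos j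
  choose t ht using hex
  refine ⟨∑ j, |t j|, fun u hu => ?_⟩
  ext j
  have h1 : t j ≤ u := (le_abs_self _).trans ((Finset.single_le_sum (f := fun j => |t j|)
    (fun j _ => abs_nonneg _) (Finset.mem_univ j)).trans hu)
  refine le_antisymm (not_lt.1 fun h => ?_) (τ.residual_nonneg s u j)
  change 0 < τ.residual s u j at h
  rw [residual_pos_iff] at h
  exact not_lt.2 ((ht j).trans (τ.processed_mono hs j h1)) h.2

end Schedule

lemma Instance.value_zero (I : Instance M J) : I.value 0 = 0 := by
  have hs : I.Splits 0 0 := ⟨le_rfl, by simp⟩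
  have := hs.value_le
  have h0 : I.quad 0 = 0 := by simp [Instance.quad, minForm]
  rw [h0] at this
  exact le_antisymm this (I.value_nonneg 0)

/-! ### Telescoping: the fractional objective -/

namespace IsApproxGD

variable {s : ℝ} {σ : Schedule I} {T : ℕ → ℝ} {z : ℕ → M → J → ℝ → ℝ}

lemma potential_le (hrun : IsApproxGD s σ T z) (τ : Schedule I) {ε : ℝ} (hε : 0 < ε)
    (hε8 : ε < 1 / 8) (hs : s = 1 + 2 * ε) {n : ℕ} (hn : 1 ≤ n * ε)
    (hn' : ((n : ℝ) - 1) * ε ≤ 1) (hn1 : 1 ≤ n) (k : ℕ) :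
    potential I n (σ.residual s (T k)) (τ.residual 1 (T k))
        + ∑ l ∈ Finset.range k, (T (l + 1) - T l) * I.fracSum (σ.residual s (T l))
      ≤ 4 / ε ^ 2 * ∑ l ∈ Finset.range k,
          ∫ u in (T l)..(T (l + 1)), I.aliveSum (τ.frozen 1 (T l) u) := by
  induction k with
  | zero =>
    -- With T = -1 no job counts as released, so jobs released at time 0 are covered by the release
    -- estimate, starting from the zero state.
    have h := σ.potential_release_le τ s hn1 (T := -1) (t := 0) (by norm_num)
      fun j _ => I.r_nonneg j
    have h0 : ∀ (ρ : Schedule I) (s : ℝ), ρ.frozen s (-1) 0 = 0 := fun ρ s => by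
      ext j
      exact ρ.frozen_of_not_released s 0 (not_le.2 (by linarith [I.r_nonneg j]))
    rw [h0, h0, I.potential_eq hn1 le_rfl le_rfl] at h
    have h1 : (fun j : J => (0 : J → ℝ) j + ((n : ℝ) - 1) * (0 : J → ℝ) j) = 0 := by
      ext j; simp
    rw [h1, I.value_zero] at h
    simpa [hrun.start] using h
  | succ k ih =>
    -- The drift estimate ends just before the releases at T (k + 1); the releases themselves do not
    -- raise the potential.
    have h1 := σ.potential_release_le τ s hn1 (hrun.mono (Nat.lt_succ_self k)).le
      fun j hj => hrun.le_release k j hj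
    have h2 := hrun.drift τ hε hε8 hs hn hn' k (hrun.mono (Nat.lt_succ_self k)).le le_rfl
    rw [Finset.sum_range_succ, Finset.sum_range_succ, mul_add]
    simp only [Nat.succ_eq_add_one] at h1
    linarith

lemma lintegral_fracWeight_le (hrun : IsApproxGD s σ T z) (hs : 0 ≤ s) (k : ℕ) :
    ∫⁻ t in Set.Ico 0 (T k), ENNReal.ofReal (σ.fracWeight s t)
      ≤ ENNReal.ofReal (∑ l ∈ Finset.range k,
          (T (l + 1) - T l) * I.fracSum (σ.residual s (T l))) := by
  have h0 : ∀ l, 0 ≤ (T (l + 1) - T l) * I.fracSum (σ.residual s (T l)) := fun l =>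
    mul_nonneg (sub_nonneg.2 (hrun.mono (Nat.lt_succ_self l)).le)
      (I.fracSum_nonneg (σ.residual_nonneg s _))
  induction k with
  | zero => simp [hrun.start]
  | succ k ih =>
    have hT := (hrun.mono (Nat.lt_succ_self k)).le
    have hT0 : 0 ≤ T k := by
      rw [← hrun.start]; exact hrun.mono.monotone (Nat.zero_le k)
    rw [Finset.sum_range_succ, ENNReal.ofReal_add (Finset.sum_nonneg fun l _ => h0 l) (h0 k),
      ← Set.Ico_union_Ico_eq_Ico hT0 hT]
    refine (lintegral_union_le _ _ _).trans (add_le_add ih ?_)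
    calc ∫⁻ t in Set.Ico (T k) (T (k + 1)), ENNReal.ofReal (σ.fracWeight s t)
        ≤ ∫⁻ _t in Set.Ico (T k) (T (k + 1)), ENNReal.ofReal (I.fracSum (σ.residual s (T k))) := by
          refine setLIntegral_mono measurable_const fun t ht => ENNReal.ofReal_le_ofReal ?_
          rw [Schedule.fracWeight_eq, ← σ.frozen_eq_residual s ht.1
            fun j hj => ht.2.trans_le (hrun.le_release k j hj)]
          exact I.fracSum_mono (σ.frozen_antitone hs (T k) ht.1)
      _ = _ := by
          rw [lintegral_const, Measure.restrict_apply MeasurableSet.univ, Set.univ_inter,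
            Real.volume_Ico, mul_comm, ENNReal.ofReal_mul (sub_nonneg.2 hT)]

lemma sum_alive_le (hrun : IsApproxGD s σ T z) (τ : Schedule I) (k : ℕ) :
    ENNReal.ofReal (∑ l ∈ Finset.range k,
        ∫ u in (T l)..(T (l + 1)), I.aliveSum (τ.frozen 1 (T l) u))
      ≤ ∫⁻ t in Set.Ico 0 (T k), ENNReal.ofReal (τ.aliveWeight 1 t) := by
  have h0 : ∀ l, 0 ≤ ∫ u in (T l)..(T (l + 1)), I.aliveSum (τ.frozen 1 (T l) u) := fun l =>
    intervalIntegral.integral_nonneg (hrun.mono (Nat.lt_succ_self l)).le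
      fun _ _ => I.aliveSum_nonneg _
  induction k with
  | zero => simp
  | succ k ih =>
    have hT := (hrun.mono (Nat.lt_succ_self k)).le
    have hT0 : 0 ≤ T k := by
      rw [← hrun.start]; exact hrun.mono.monotone (Nat.zero_le k)
    rw [Finset.sum_range_succ, ENNReal.ofReal_add (Finset.sum_nonneg fun l _ => h0 l) (h0 k),
      ← Set.Ico_union_Ico_eq_Ico hT0 hT, lintegral_union measurableSet_Ico
        (Set.disjoint_left.2 fun t h1 h2 => not_le.2 h1.2 h2.1)]
    refine add_le_add ih (le_of_eq ?_)
    have hint : IntervalIntegrable (fun u => I.aliveSum (τ.frozen 1 (T k) u)) volume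
        (T k) (T (k + 1)) := (τ.antitone_aliveSum_frozen zero_le_one (T k)).intervalIntegrable
    rw [intervalIntegral.integral_of_le hT, ← integral_Ico_eq_integral_Ioc,
      ofReal_integral_eq_lintegral_ofReal
        ((intervalIntegrable_iff_integrableOn_Ico_of_le hT).1 hint)
        (Eventually.of_forall fun _ => I.aliveSum_nonneg _)]
    refine setLIntegral_congr_fun measurableSet_Ico fun t ht => ?_
    rw [Schedule.aliveWeight_eq, ← τ.frozen_eq_residual 1 ht.1
      fun j hj => ht.2.trans_le (hrun.le_release k j hj)]

/-- Approximate gradient descent is competitive for the fractional objective. -/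
theorem fracFlow_le (hrun : IsApproxGD s σ T z) {ε : ℝ} (hε : 0 < ε) (hε8 : ε < 1 / 8)
    (hs : s = 1 + 2 * ε) : σ.fracFlow s ≤ ENNReal.ofReal (4 / ε ^ 2) * I.opt := by
  have hc : 0 < 4 / ε ^ 2 := by positivity
  have hs0 : 0 ≤ s := by linarith
  rw [Instance.opt, ENNReal.mul_iInf_of_ne (by simpa using hc) ENNReal.ofReal_ne_top]
  refine le_iInf fun τ => ?_
  by_cases hfin : τ.weightedFlow 1 = ∞
  · rw [hfin, ENNReal.mul_top (by simpa using hc)]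
    exact le_top
  obtain ⟨t₁, ht₁⟩ := τ.exists_residual_eq_zero zero_le_one hfin
  -- When 1/ε is not an integer, rounding up suffices: the drift uses only nε ≥ 1 and (n - 1)ε ≤ 1.
  set n := ⌈1 / ε⌉₊ with hn
  have hn1 : 1 ≤ n * ε := by
    rw [← div_le_iff₀ hε]; exact Nat.le_ceil _
  have hn2 : ((n : ℝ) - 1) * ε ≤ 1 := by
    rw [← le_div_iff₀ hε]
    have := (Nat.ceil_lt_add_one (show 0 ≤ 1 / ε by positivity)).le
    linarith
  have hnpos : 1 ≤ n := Nat.one_le_iff_ne_zero.2 fun h => by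
    rw [h] at hn1; norm_num at hn1
  have hn' : (1 : ℝ) ≤ n := by exact_mod_cast hnpos
  have hbound : ∀ k, t₁ ≤ T k → ∫⁻ t in Set.Ico 0 (T k), ENNReal.ofReal (σ.fracWeight s t)
      ≤ ENNReal.ofReal (4 / ε ^ 2) * τ.weightedFlow 1 := by
    intro k hk
    -- Without adversary work both terms of the potential evaluate f at the same sizes, and 1 - 1/n
    -- ≥ 0.
    have hpot : 0 ≤ potential I n (σ.residual s (T k)) (τ.residual 1 (T k)) := by
      rw [I.potential_eq hnpos (σ.residual_nonneg _ _) (τ.residual_nonneg _ _), ht₁ _ hk]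
      have h1 : (fun j => σ.residual s (T k) j + ((n : ℝ) - 1) * (0 : J → ℝ) j)
          = σ.residual s (T k) := by ext j; simp
      rw [h1]
      have h2 : 1 / (n : ℝ) ≤ 1 := by rw [div_le_one (by linarith)]; exact hn'
      have h3 := I.value_nonneg (σ.residual s (T k))
      refine mul_nonneg (by linarith) ?_
      nlinarith
    have hle := hrun.potential_le τ hε hε8 hs hn1 hn2 hnpos k
    calc _ ≤ _ := hrun.lintegral_fracWeight_le hs0 k
      _ ≤ ENNReal.ofReal (4 / ε ^ 2 * ∑ l ∈ Finset.range k,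
          ∫ u in (T l)..(T (l + 1)), I.aliveSum (τ.frozen 1 (T l) u)) :=
          ENNReal.ofReal_le_ofReal (by linarith)
      _ ≤ _ := by
          rw [ENNReal.ofReal_mul hc.le]
          gcongr
          exact (hrun.sum_alive_le τ k).trans ((lintegral_mono_set Set.Ico_subset_Ici_self).trans
            (τ.lintegral_aliveWeight_le zero_le_one))
  have hunion : Set.Ici (0 : ℝ) = ⋃ k, Set.Ico 0 (T k) := by
    ext t
    simp only [Set.mem_Ici, Set.mem_iUnion, Set.mem_Ico]
    refine ⟨fun ht => ?_, fun ⟨k, hk⟩ => hk.1⟩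
    obtain ⟨k, hk⟩ := (hrun.unbounded.eventually_gt_atTop t).exists
    exact ⟨k, ht, hk⟩
  have hdir : Directed (· ⊆ ·) fun k => Set.Ico 0 (T k) :=
    Monotone.directed_le fun k l hkl => Set.Ico_subset_Ico_right (hrun.mono.monotone hkl)
  rw [Schedule.fracFlow, hunion, setLIntegral_iUnion_of_directed _ hdir]
  refine iSup_le fun k => ?_
  obtain ⟨l, hl1, hl2⟩ := ((hrun.unbounded.eventually_ge_atTop t₁).and
    (eventually_ge_atTop k)).exists
  exact (lintegral_mono_set (Set.Ico_subset_Ico_right (hrun.mono.monotone hl2))).trans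
    (hbound l hl1)

end IsApproxGD

end Runs

/-! ### Solving the residual program for a subset of the jobs -/

section Extension

variable {M J K : Type} [Fintype M] [Fintype J] [Fintype K]

lemma Instance.lpValue_comap_injective (I : Instance M J) {g : K → J} (hg : Function.Injective g)
    {x : J → ℝ} (hx : 0 ≤ x) (hx0 : ∀ j, j ∉ Set.range g → x j = 0) :
    (I.comap g).lpValue (x ∘ g) = I.lpValue x := by
  classical
  have hxg : 0 ≤ x ∘ g := fun k => hx (g k)
  have h : fiberSum g (x ∘ g) = x := by
    ext j
    rw [fiberSum_eq]
    by_cases hj : j ∈ Set.range g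
    · obtain ⟨k, rfl⟩ := hj
      simp [hg.eq_iff]
    · rw [hx0 j hj]
      exact Finset.sum_eq_zero fun k _ => if_neg fun hk => hj ⟨k, hk⟩
  rw [← Instance.ofReal_value _ hxg, ← I.ofReal_value hx, I.value_comap g hxg, h]

/-- Extend a solution of the residual program for some of the jobs by zero. -/
def extendPlan {M J K : Type} (g : K → J) (z : M → K → ℝ → ℝ) (i : M) : J → ℝ → ℝ :=
  Function.extend g (z i) 0

lemma extendPlan_apply {M J K : Type} {g : K → J} (hg : Function.Injective g)
    (z : M → K → ℝ → ℝ) (i : M) (k : K) : extendPlan g z i (g k) = z i k :=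
  hg.extend_apply _ _ _

lemma extendPlan_of_notMem {M J K : Type} {g : K → J} (z : M → K → ℝ → ℝ) (i : M) {j : J}
    (hj : j ∉ Set.range g) : extendPlan g z i j = 0 :=
  Function.extend_apply' _ _ _ hj

/-- Jobs with remaining size 0 do not affect the optimum. Hence an optimal solution for the released
jobs, the only ones an online algorithm knows, is optimal for the whole instance. -/
lemma Instance.LPOptimal.extendPlan {I : Instance M J} {g : K → J} (hg : Function.Injective g)
    {x : J → ℝ} (hx : 0 ≤ x) (hx0 : ∀ j, j ∉ Set.range g → x j = 0) {z : M → K → ℝ → ℝ}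
    (hz : (I.comap g).LPOptimal (x ∘ g) z) : I.LPOptimal x (extendPlan g z) := by
  obtain ⟨hf, hopt⟩ := hz
  have hcases : ∀ j, (∃ k, g k = j) ∨ j ∉ Set.range g := fun j => em _
  refine ⟨⟨fun i j => ?_, fun i j t ht => ?_, fun i t ht => ?_, fun j => ?_⟩, ?_⟩
  · rcases hcases j with ⟨k, rfl⟩ | hj
    · rw [extendPlan_apply hg]; exact hf.measurable i k
    · rw [extendPlan_of_notMem z i hj]; exact measurable_const
  · rcases hcases j with ⟨k, rfl⟩ | hj
    · rw [extendPlan_apply hg]; exact hf.nonneg i k t ht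
    · rw [extendPlan_of_notMem z i hj]; exact le_rfl
  · rw [← Fintype.sum_of_injective g hg (fun k => z i k t) _
      (fun j hj => by rw [extendPlan_of_notMem z i hj]; rfl)
      (fun k => by rw [extendPlan_apply hg])]
    exact hf.machine_le_one i t ht
  · rcases hcases j with ⟨k, rfl⟩ | hj
    · simp only [extendPlan_apply hg]; exact hf.volume_eq k
    · simp [extendPlan_of_notMem z _ hj, hx0 j hj]
  · rw [← I.lpValue_comap_injective hg hx hx0, ← hopt, lpCost, lpCost]
    congr 1
    · refine Finset.sum_congr rfl fun i _ => (Fintype.sum_of_injective g hg _ _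
        (fun j hj => ?_) (fun k => ?_)).symm
      · simp [extendPlan_of_notMem z i hj]
      · rw [extendPlan_apply hg]; rfl
    · refine Finset.sum_congr rfl fun i _ => (Fintype.sum_of_injective g hg _ _
        (fun j hj => ?_) (fun k => ?_)).symm
      · simp [extendPlan_of_notMem z i hj]
      · rw [extendPlan_apply hg]; rfl

lemma Instance.gdRate_extendPlan {M J K : Type} [Fintype J] [Fintype K] (I : Instance M J) {g : K → J} (hg : Function.Injective g)
    (z : M → K → ℝ → ℝ) (i : M) (k : K) :
    I.gdRate (extendPlan g z) i (g k) = (I.comap g).gdRate z i k := by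
  have hfr : I.fractionUpTo (extendPlan g z) i = (I.comap g).fractionUpTo z i := by
    ext t
    refine (Fintype.sum_of_injective g hg _ _ (fun j hj => ?_) (fun k => ?_)).symm
    · simp [extendPlan_of_notMem z i hj]
    · rw [extendPlan_apply hg]; rfl
  unfold Instance.gdRate Instance.cutTime
  rw [hfr, extendPlan_apply hg]
  rfl

lemma Instance.gdRate_extendPlan_of_notMem {M J K : Type} [Fintype J] (I : Instance M J) {g : K → J} (z : M → K → ℝ → ℝ)
    (i : M) {j : J} (hj : j ∉ Set.range g) : I.gdRate (extendPlan g z) i j = 0 := by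
  unfold Instance.gdRate
  rw [extendPlan_of_notMem z i hj]
  simp

end Extension

/-! ### Piecewise constant schedules, and stopping completed jobs -/

section Construction

variable {M J : Type} [Fintype M] [Fintype J] {I : Instance M J}

/-- A schedule that is constant between consecutive times of a sequence. -/
lemma exists_piecewise_schedule (I : Instance M J) {T : ℕ → ℝ} (h0 : T 0 = 0) (hT : StrictMono T)
    (hlim : Tendsto T atTop atTop) (g : ℕ → M → J → ℝ) (hg0 : ∀ k i j, 0 ≤ g k i j)
    (hg1 : ∀ k i, ∑ j, g k i j ≤ 1) (hg2 : ∀ k j, ∑ i, g k i j ≤ 1)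
    (hrel : ∀ k i j, T k < I.r j → g k i j = 0) :
    ∃ σ : Schedule I, (∀ k t, T k ≤ t → t < T (k + 1) → σ.rate t = g k) ∧
      ∀ t, t < 0 → σ.rate t = 0 := by
  have hex : ∀ t : ℝ, ∃ k, t < T (k + 1) := fun t =>
    ((hlim.comp (tendsto_add_atTop_nat 1)).eventually_gt_atTop t).exists
  classical
  set idx : ℝ → ℕ := fun t => Nat.find (hex t) with hidx
  have hidx_eq : ∀ k t, T k ≤ t → t < T (k + 1) → idx t = k := by
    intro k t h1 h2
    refine (Nat.find_eq_iff _).2 ⟨h2, fun l hl => not_lt.2 ?_⟩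
    exact (hT.monotone hl).trans h1
  have hidx_mem : ∀ t, 0 ≤ t → T (idx t) ≤ t := by
    intro t ht
    rcases Nat.eq_zero_or_pos (idx t) with h | h
    · rw [h, h0]; exact ht
    · have := Nat.find_min (hex t) (Nat.sub_lt h one_pos)
      rwa [not_lt, show Nat.find (hex t) - 1 + 1 = idx t from Nat.sub_add_cancel h] at this
  -- Monotonicity of the step index is what makes the rates measurable.
  have hmono : Monotone idx := fun s t hst => Nat.find_mono fun k hk => hst.trans_lt hk
  refine ⟨{
    rate := fun t i j => if t < 0 then 0 else g (idx t) i j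
    measurable_rate := fun i j => Measurable.ite (measurableSet_lt measurable_id measurable_const)
      measurable_const ((measurable_from_nat (f := fun k => g k i j)).comp hmono.measurable)
    rate_nonneg := fun t i j => ?_
    machine_le_one := fun t i => ?_
    job_le_one := fun t j => ?_
    rate_before_release := fun t i j ht => ?_ }, fun k t h1 h2 => ?_, fun t ht => ?_⟩
  · split
    · exact le_rfl
    · exact hg0 _ _ _
  · split
    · simp
    · exact hg1 _ _
  · split
    · simp
    · exact hg2 _ _
  · split
    · rfl
    · next h => exact hrel _ _ _ ((hidx_mem t (not_lt.1 h)).trans_lt ht)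
  · have ht0 : ¬t < 0 := not_lt.2 ((h0 ▸ hT.monotone (Nat.zero_le k)).trans h1)
    ext i j
    show (if t < 0 then 0 else g (idx t) i j) = g k i j
    rw [if_neg ht0, hidx_eq k t h1 h2]
  · ext i j
    exact if_pos ht

namespace Schedule

open Classical in
/-- Follow `ρ` on machines of speed `s`, but stop processing a job once it is completed. -/
def truncate (ρ : Schedule I) (s : ℝ) : Schedule I where
  rate t i j := if 0 < ρ.residual s t j then ρ.rate t i j else 0
  measurable_rate i j := Measurable.ite
    (measurableSet_lt measurable_const (ρ.measurable_residual s j)) (ρ.measurable_rate i j)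
    measurable_const
  rate_nonneg t i j := by
    split
    · exact ρ.rate_nonneg t i j
    · exact le_rfl
  machine_le_one t i := by
    refine (Finset.sum_le_sum fun j _ => ?_).trans (ρ.machine_le_one t i)
    split
    · exact le_rfl
    · exact ρ.rate_nonneg t i j
  job_le_one t j := by
    refine (Finset.sum_le_sum fun i _ => ?_).trans (ρ.job_le_one t j)
    split
    · exact le_rfl
    · exact ρ.rate_nonneg t i j
  rate_before_release t i j ht := by
    rw [ρ.rate_before_release t i j ht, ite_self]

lemma truncate_rate_of_pos (ρ : Schedule I) {s t : ℝ} {j : J} (h : 0 < ρ.residual s t j) (i : M) :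
    (ρ.truncate s).rate t i j = ρ.rate t i j := if_pos h

/-- Both schedules agree on a job until `ρ` completes it at speed `s`, so they complete it at the
same time. A rule stated through the residual of `ρ` thereby becomes one about the truncated
schedule itself. -/
lemma residual_truncate_pos_iff (ρ : Schedule I) {s : ℝ} (hs : 0 ≤ s) (t : ℝ) (j : J) :
    0 < (ρ.truncate s).residual s t j ↔ 0 < ρ.residual s t j := by
  have hint : ∀ c, I.r j ≤ c → (∀ u, I.r j ≤ u → u < c → 0 < ρ.residual s u j) →
      (ρ.truncate s).processed s j c = ρ.processed s j c := by
    intro c hrc hpos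
    have e1 := (ρ.truncate s).processed_sub s j (I.r j) c
    have e2 := ρ.processed_sub s j (I.r j) c
    rw [processed_of_le_release _ s le_rfl, sub_zero] at e1 e2
    rw [e1, e2]
    congr 1
    refine intervalIntegral.integral_congr_ae ?_
    have hne : ∀ᵐ u : ℝ, u ≠ c := by simp [ae_iff]
    filter_upwards [hne] with u hu hum
    rw [Set.uIoc_of_le hrc] at hum
    refine Finset.sum_congr rfl fun i _ => ?_
    rw [ρ.truncate_rate_of_pos (hpos u hum.1.le (lt_of_le_of_ne hum.2 hu))]
  constructor
  · intro h
    by_contra hcon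
    rw [residual_pos_iff] at h
    obtain ⟨c, hrc, hct, hceq, hpos⟩ := ρ.exists_effective_end hs (I.r j) h.1 j
    have hres : ∀ u, I.r j ≤ u → ρ.frozen s (I.r j) u j = ρ.residual s u j := fun u hu => by
      rw [← frozen_self, ρ.frozen_of_released s u le_rfl, ρ.frozen_of_released s u hu]
    have h1 := hint c hrc fun u hu huc => by
      rw [← hres u hu]; exact hpos u hu huc
    rw [hres t h.1, le_antisymm (not_lt.1 hcon) (ρ.residual_nonneg s t j), ← ρ.processed_sub,
      ρ.frozen_of_released s _ le_rfl, processed_of_le_release _ s le_rfl] at hceq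
    have h2 := (ρ.truncate s).processed_mono hs j hct
    rw [sub_zero, sub_zero, max_eq_right (I.p_pos j).le] at hceq
    rw [sub_zero] at hceq
    rw [h1, ← hceq] at h2
    exact not_lt.2 h2 h.2
  · intro h
    have h' := h
    rw [residual_pos_iff] at h ⊢
    refine ⟨h.1, ?_⟩
    rw [hint t h.1 fun u hu hut => ?_]
    · exact h.2
    · rw [residual_pos_iff]
      exact ⟨hu, (ρ.processed_mono hs j hut.le).trans_lt h.2⟩

lemma followsUntilDone_truncate (ρ : Schedule I) {s : ℝ} (hs : 0 ≤ s) :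
    FollowsUntilDone s (ρ.truncate s) ρ := by
  intro t i j
  simp only [ρ.residual_truncate_pos_iff hs]
  rfl

/-- On faster machines, the weight of the alive jobs is bounded by the fractional weight on the
slower machines. -/
lemma aliveWeight_truncate_le (ρ : Schedule I) {s s' : ℝ} (hs : 0 ≤ s) (hss : s < s') (t : ℝ) :
    (ρ.truncate s').aliveWeight s' t ≤ s' / (s' - s) * ρ.fracWeight s t := by
  classical
  have hs' : 0 < s' := hs.trans_lt hss
  have hd : 0 < s' - s := sub_pos.2 hss
  rw [aliveWeight, fracWeight, Finset.mul_sum]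
  refine Finset.sum_le_sum fun j _ => ?_
  have hc : 0 ≤ s' / (s' - s) * (I.w j / I.p j) :=
    mul_nonneg (div_nonneg hs'.le hd.le) (div_nonneg (I.w_pos j).le (I.p_pos j).le)
  rw [← mul_assoc]
  split
  · next h =>
    rw [ρ.residual_truncate_pos_iff hs'.le, residual_pos_iff] at h
    have h1 : ρ.processed s j t = s / s' * ρ.processed s' j t := by
      unfold processed
      field_simp
    -- A job unfinished at speed s' has received less than the share s/s' of its size at speed s.
    have h2 : I.p j * (1 - s / s') ≤ ρ.residual s t j := by
      rw [← frozen_self, ρ.frozen_of_released s t h.1]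
      refine le_max_of_le_right ?_
      rw [h1]
      have := mul_le_mul_of_nonneg_left h.2.le (div_nonneg hs hs'.le)
      linarith
    calc I.w j = s' / (s' - s) * (I.w j / I.p j) * (I.p j * (1 - s / s')) := by
          have := (I.p_pos j).ne'
          have := hd.ne'
          field_simp
      _ ≤ _ := mul_le_mul_of_nonneg_left h2 hc
  · exact mul_nonneg hc (ρ.residual_nonneg s t j)

lemma weightedFlow_truncate_le (ρ : Schedule I) {s s' : ℝ} (hs : 0 ≤ s) (hss : s < s') :
    (ρ.truncate s').weightedFlow s' ≤ ENNReal.ofReal (s' / (s' - s)) * ρ.fracFlow s := by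
  have hc : 0 ≤ s' / (s' - s) := div_nonneg (hs.trans hss.le) (sub_pos.2 hss).le
  have hm : Measurable fun t => ENNReal.ofReal (ρ.fracWeight s t) := by
    unfold fracWeight
    exact (Finset.measurable_fun_sum _ fun j _ =>
      (ρ.measurable_residual s j).const_mul _).ennreal_ofReal
  refine ((ρ.truncate s').weightedFlow_le s').trans ?_
  rw [fracFlow, ← lintegral_const_mul _ hm]
  refine lintegral_mono fun t => ?_
  rw [← ENNReal.ofReal_mul hc]
  exact ENNReal.ofReal_le_ofReal (ρ.aliveWeight_truncate_le hs hss t)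

end Schedule

end Construction

/-! ### Approximate gradient descent as a recursion on known data -/

section Policy

variable {M : Type} {S : Finset ℕ}

/-- The data of the jobs that are known to an online algorithm. -/
abbrev Knowledge (M : Type) : Type := Σ R : Finset ℕ, Instance M R

lemma Knowledge.ext {κ κ' : Knowledge M} (hR : ∀ j, j ∈ κ.1 ↔ j ∈ κ'.1)
    (hdata : ∀ j (h : j ∈ κ.1) (h' : j ∈ κ'.1), κ'.2.r ⟨j, h'⟩ = κ.2.r ⟨j, h⟩ ∧
      κ'.2.p ⟨j, h'⟩ = κ.2.p ⟨j, h⟩ ∧ κ'.2.w ⟨j, h'⟩ = κ.2.w ⟨j, h⟩ ∧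
      ∀ i, κ'.2.lam i ⟨j, h'⟩ = κ.2.lam i ⟨j, h⟩) : κ = κ' := by
  obtain ⟨R, I⟩ := κ
  obtain ⟨R', I'⟩ := κ'
  obtain rfl : R = R' := Finset.ext hR
  have h : I = I' := by
    cases I
    cases I'
    simp only [Instance.mk.injEq]
    refine ⟨funext fun j => ?_, funext fun j => ?_, funext fun j => ?_,
      funext fun i => funext fun j => ?_⟩
    · exact (hdata j j.2 j.2).1.symm
    · exact (hdata j j.2 j.2).2.1.symm
    · exact (hdata j j.2 j.2).2.2.1.symm
    · exact ((hdata j j.2 j.2).2.2.2 i).symm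
  rw [h]

/-- What is known at time `T`. -/
def Instance.known (I : Instance M S) (T : ℝ) : Knowledge M :=
  ⟨{j ∈ S.attach | I.r j ≤ T}.map (Function.Embedding.subtype _),
    I.comap fun j => ⟨j.1, by
      obtain ⟨k, -, hk⟩ := Finset.mem_map.1 j.2
      rw [← hk]
      exact k.2⟩⟩

lemma Instance.mem_known {I : Instance M S} {T : ℝ} {j : ℕ} :
    j ∈ (I.known T).1 ↔ ∃ h : j ∈ S, I.r ⟨j, h⟩ ≤ T := by
  simp [Instance.known]

/-- The inclusion of the known jobs. -/
def Instance.knownJob (I : Instance M S) (T : ℝ) (j : (I.known T).1) : S :=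
  ⟨j.1, (Instance.mem_known.1 j.2).1⟩

lemma Instance.knownJob_injective (I : Instance M S) (T : ℝ) :
    Function.Injective (I.knownJob T) := fun _ _ h =>
  Subtype.ext (congrArg (fun l : S => (l : ℕ)) h)

lemma Instance.mem_range_knownJob {I : Instance M S} {T : ℝ} {j : S} :
    j ∈ Set.range (I.knownJob T) ↔ I.r j ≤ T := by
  constructor
  · rintro ⟨k, rfl⟩
    exact (Instance.mem_known.1 k.2).2
  · intro h
    exact ⟨⟨j.1, Instance.mem_known.2 ⟨j.2, h⟩⟩, rfl⟩

lemma Instance.known_eq {S' : Finset ℕ} {I : Instance M S} {I' : Instance M S'} {T T' : ℝ}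
    (h : ∀ j (hj : j ∈ S), I.r ⟨j, hj⟩ ≤ T → ∃ hj' : j ∈ S', I'.r ⟨j, hj'⟩ ≤ T' ∧
      I'.r ⟨j, hj'⟩ = I.r ⟨j, hj⟩ ∧ I'.p ⟨j, hj'⟩ = I.p ⟨j, hj⟩ ∧
      I'.w ⟨j, hj'⟩ = I.w ⟨j, hj⟩ ∧ ∀ i, I'.lam i ⟨j, hj'⟩ = I.lam i ⟨j, hj⟩)
    (h' : ∀ j (hj : j ∈ S'), I'.r ⟨j, hj⟩ ≤ T' → ∃ hj' : j ∈ S, I.r ⟨j, hj'⟩ ≤ T) :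
    I.known T = I'.known T' := by
  refine Knowledge.ext (fun j => ?_) fun j hj hj' => ?_
  · rw [Instance.mem_known, Instance.mem_known]
    constructor
    · rintro ⟨hj, hr⟩
      obtain ⟨hj', hr', -⟩ := h j hj hr
      exact ⟨hj', hr'⟩
    · rintro ⟨hj, hr⟩
      exact h' j hj hr
  · obtain ⟨h1, h2⟩ := Instance.mem_known.1 hj
    obtain ⟨h3, -, h4⟩ := h j h1 h2
    exact h4

variable [Fintype M]

/-- The remaining sizes of the known jobs after the amounts `done` have been processed. -/
def Knowledge.remaining (κ : Knowledge M) (done : ℕ → ℝ) (j : κ.1) : ℝ := κ.2.p j - done j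

open Classical in
/-- An optimal solution of the residual program for the known jobs. -/
def Knowledge.plan (κ : Knowledge M) (done : ℕ → ℝ) : M → κ.1 → ℝ → ℝ :=
  -- Ties are broken by a choice that depends only on the known data and the amounts processed,
  -- which is what causality needs. The value 0 is not reached along a run of positive speed, by
  -- `Instance.gdRemaining_nonneg`.
  if h : 0 ≤ κ.remaining done then (κ.2.exists_lpOptimal h).choose else 0

lemma Knowledge.lpOptimal_plan (κ : Knowledge M) {done : ℕ → ℝ} (h : 0 ≤ κ.remaining done) :
    κ.2.LPOptimal (κ.remaining done) (κ.plan done) := by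
  rw [plan, dif_pos h]
  exact (κ.2.exists_lpOptimal h).choose_spec

/-- The rates of approximate gradient descent. -/
def Knowledge.rate (κ : Knowledge M) (done : ℕ → ℝ) (i : M) (j : ℕ) : ℝ :=
  if h : j ∈ κ.1 then κ.2.gdRate (κ.plan done) i ⟨j, h⟩ else 0

/-- The amount of job `j` that unit-speed machines process per time unit at these rates. -/
def Knowledge.work (κ : Knowledge M) (done : ℕ → ℝ) (j : ℕ) : ℝ :=
  if h : j ∈ κ.1 then ∑ i, κ.2.lam i ⟨j, h⟩ * κ.rate done i j else 0

/-- The durations after which planned fractions are completed on machines of speed `s`. -/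
def Knowledge.durations (κ : Knowledge M) (done : ℕ → ℝ) (s : ℝ) : Set ℝ :=
  {d | ∃ i j, 0 < κ.rate done i j ∧ ∃ h : j ∈ κ.1, d = κ.2.p ⟨j, h⟩ / κ.2.lam i ⟨j, h⟩ / s}

/-- The times at which the plan made at time `T` is revised. -/
def Instance.revisions (I : Instance M S) (s T : ℝ) (done : ℕ → ℝ) : Set ℝ :=
  {t | ∃ d ∈ (I.known T).durations done s, t = T + d} ∪ {t | T < t ∧ ∃ j, t = I.r j}

open Classical in
/-- The next decision time. -/
def Instance.nextTime (I : Instance M S) (s T : ℝ) (done : ℕ → ℝ) : ℝ :=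
  -- Without revision times all rates vanish, and `T + 1` merely keeps the sequence of decision
  -- times increasing.
  if (I.revisions s T done).Nonempty then sInf (I.revisions s T done) else T + 1

/-- The state of approximate gradient descent at its decision times: the time, and the amounts
processed so far. -/
def Instance.gdState (I : Instance M S) (s : ℝ) : ℕ → ℝ × (ℕ → ℝ)
  | 0 => (0, 0)
  | k + 1 =>
    let T := (I.gdState s k).1
    let done := (I.gdState s k).2
    (I.nextTime s T done,
      fun j => done j + s * (I.nextTime s T done - T) * (I.known T).work done j)

/-- The decision times. -/
def Instance.gdTime (I : Instance M S) (s : ℝ) (k : ℕ) : ℝ := (I.gdState s k).1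

/-- The amounts processed before the decision times. -/
def Instance.gdDone (I : Instance M S) (s : ℝ) (k : ℕ) : ℕ → ℝ := (I.gdState s k).2

/-- The rates chosen at the decision times. -/
def Instance.gdStepRate (I : Instance M S) (s : ℝ) (k : ℕ) : M → ℕ → ℝ :=
  (I.known (I.gdTime s k)).rate (I.gdDone s k)

lemma Instance.gdTime_zero (I : Instance M S) (s : ℝ) : I.gdTime s 0 = 0 := rfl

lemma Instance.gdDone_zero (I : Instance M S) (s : ℝ) : I.gdDone s 0 = 0 := rfl

lemma Instance.gdTime_succ (I : Instance M S) (s : ℝ) (k : ℕ) :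
    I.gdTime s (k + 1) = I.nextTime s (I.gdTime s k) (I.gdDone s k) := rfl

lemma Instance.gdDone_succ (I : Instance M S) (s : ℝ) (k : ℕ) (j : ℕ) :
    I.gdDone s (k + 1) j = I.gdDone s k j + s * (I.gdTime s (k + 1) - I.gdTime s k)
      * (I.known (I.gdTime s k)).work (I.gdDone s k) j := rfl

lemma Knowledge.exists_pos_of_mem_durations (κ : Knowledge M) {done : ℕ → ℝ} {s d : ℝ} (hs : 0 < s)
    (hd : d ∈ κ.durations done s) : 0 < d := by
  obtain ⟨i, j, hij, h, rfl⟩ := hd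
  rw [Knowledge.rate, dif_pos h] at hij
  exact div_pos (div_pos (κ.2.p_pos _) (Instance.lam_pos_of_gdRate_pos hij)) hs

lemma Knowledge.finite_durations (κ : Knowledge M) (done : ℕ → ℝ) (s : ℝ) :
    (κ.durations done s).Finite := by
  refine (Set.finite_range fun q : M × κ.1 => κ.2.p q.2 / κ.2.lam q.1 q.2 / s).subset ?_
  rintro d ⟨i, j, -, h, rfl⟩
  exact ⟨(i, ⟨j, h⟩), rfl⟩

lemma Instance.exists_of_mem_durations_known {I : Instance M S} {s T d : ℝ} {done : ℕ → ℝ}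
    (hd : d ∈ (I.known T).durations done s) :
    ∃ i j, 0 < I.lam i j ∧ d = I.p j / I.lam i j / s := by
  obtain ⟨i, j, hij, hj, rfl⟩ := hd
  rw [Knowledge.rate, dif_pos hj] at hij
  exact ⟨i, I.knownJob T ⟨j, hj⟩,
    Instance.lam_pos_of_gdRate_pos (I := (I.known T).2) hij, rfl⟩

lemma Instance.isLeast_nextTime (I : Instance M S) (s T : ℝ) (done : ℕ → ℝ)
    (h : (I.revisions s T done).Nonempty) :
    IsLeast (I.revisions s T done) (I.nextTime s T done) := by
  have hfin : (I.revisions s T done).Finite := by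
    refine Set.Finite.union ?_ ?_
    · refine (((I.known T).finite_durations done s).image fun d => T + d).subset ?_
      rintro t ⟨d, hd, rfl⟩
      exact ⟨d, hd, rfl⟩
    · refine (Set.finite_range I.r).subset ?_
      rintro t ⟨-, j, rfl⟩
      exact ⟨j, rfl⟩
  rw [Instance.nextTime, if_pos h]
  exact hfin.isClosed.isLeast_csInf h hfin.bddBelow

lemma Instance.lt_of_mem_revisions (I : Instance M S) {s T t : ℝ} {done : ℕ → ℝ} (hs : 0 < s)
    (ht : t ∈ I.revisions s T done) : T < t := by
  rcases ht with ⟨d, hd, rfl⟩ | ht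
  · linarith [(I.known T).exists_pos_of_mem_durations hs hd]
  · exact ht.1

lemma Instance.lt_nextTime (I : Instance M S) {s : ℝ} (T : ℝ) (done : ℕ → ℝ) (hs : 0 < s) :
    T < I.nextTime s T done := by
  by_cases h : (I.revisions s T done).Nonempty
  · exact I.lt_of_mem_revisions hs (I.isLeast_nextTime s T done h).1
  · rw [Instance.nextTime, if_neg h]; linarith

lemma Instance.gdTime_strictMono (I : Instance M S) {s : ℝ} (hs : 0 < s) :
    StrictMono (I.gdTime s) := strictMono_nat_of_lt_succ fun k => by
  rw [I.gdTime_succ]; exact I.lt_nextTime _ _ hs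

/-- Decision times do not accumulate. -/
lemma Instance.tendsto_gdTime (I : Instance M S) {s : ℝ} (hs : 0 < s) :
    Tendsto (I.gdTime s) atTop atTop := by
  rcases tendsto_atTop_of_monotone (I.gdTime_strictMono hs).monotone with h | ⟨l, hl⟩
  · exact h
  exfalso
  -- A common lower bound for all steps that do not end at a release: completions of planned
  -- fractions, and the default step 1.
  obtain ⟨c, hc0, hc1, hc⟩ : ∃ c : ℝ, 0 < c ∧ c ≤ 1 ∧
      ∀ i j, 0 < I.lam i j → c ≤ I.p j / I.lam i j / s := by
    have hfin : (insert (1 : ℝ) {d | ∃ i j, 0 < I.lam i j ∧ d = I.p j / I.lam i j / s}).Finite := by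
      refine Set.Finite.insert _ ((Set.finite_range fun q : M × S =>
        I.p q.2 / I.lam q.1 q.2 / s).subset ?_)
      rintro d ⟨i, j, -, rfl⟩
      exact ⟨(i, j), rfl⟩
    have hleast := hfin.isClosed.isLeast_csInf ⟨1, Set.mem_insert _ _⟩ hfin.bddBelow
    refine ⟨_, ?_, hleast.2 (Set.mem_insert _ _), fun i j hij =>
      hleast.2 (Set.mem_insert_of_mem _ ⟨i, j, hij, rfl⟩)⟩
    rcases hleast.1 with h | ⟨i, j, hij, h⟩
    · rw [h]; exact one_pos
    · rw [h]; exact div_pos (div_pos (I.p_pos j) hij) hs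
  have hdiff : Tendsto (fun k => I.gdTime s (k + 1) - I.gdTime s k) atTop (𝓝 0) := by
    have := (hl.comp (tendsto_add_atTop_nat 1)).sub hl
    rwa [sub_self] at this
  obtain ⟨K, hK⟩ := eventually_atTop.1 (hdiff.eventually (gt_mem_nhds hc0))
  -- If the decision times converged, the steps would eventually be shorter than `c`, so each would
  -- end at a release time; but there are only finitely many of these.
  have hmem : ∀ k, I.gdTime s (K + k + 1) ∈ Set.range I.r := by
    intro k
    have hlt := hK (K + k) (Nat.le_add_right K k)
    rw [I.gdTime_succ] at hlt ⊢
    by_cases hne : (I.revisions s (I.gdTime s (K + k)) (I.gdDone s (K + k))).Nonempty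
    · rcases (I.isLeast_nextTime s _ _ hne).1 with ⟨d, hd, ht⟩ | ⟨-, j, hj⟩
      · exfalso
        obtain ⟨i, j, hij, rfl⟩ := Instance.exists_of_mem_durations_known hd
        have h1 := hc i j hij
        linarith
      · exact ⟨j, hj.symm⟩
    · rw [Instance.nextTime, if_neg hne] at hlt
      linarith
  refine (Set.infinite_of_injective_forall_mem (f := fun k => I.gdTime s (K + k + 1)) ?_ hmem)
    (Set.finite_range I.r)
  intro a b hab
  have := (I.gdTime_strictMono hs).injective hab
  omega

/-- The current remaining sizes at the decision times. -/
def Instance.gdRemaining (I : Instance M S) (s : ℝ) (k : ℕ) (j : S) : ℝ :=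
  if I.r j ≤ I.gdTime s k then I.p j - I.gdDone s k j else 0

/-- The optimal solutions of the residual program chosen at the decision times. -/
def Instance.gdPlan (I : Instance M S) (s : ℝ) (k : ℕ) : M → S → ℝ → ℝ :=
  extendPlan (I.knownJob (I.gdTime s k)) ((I.known (I.gdTime s k)).plan (I.gdDone s k))

lemma Instance.gdRate_gdPlan (I : Instance M S) (s : ℝ) (k : ℕ) (i : M) (j : S) :
    I.gdRate (I.gdPlan s k) i j = I.gdStepRate s k i j := by
  unfold Instance.gdPlan Instance.gdStepRate Knowledge.rate
  by_cases h : I.r j ≤ I.gdTime s k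
  · have hj : (j : ℕ) ∈ (I.known (I.gdTime s k)).1 := Instance.mem_known.2 ⟨j.2, h⟩
    rw [dif_pos hj]
    exact I.gdRate_extendPlan (I.knownJob_injective _) _ i ⟨j, hj⟩
  · rw [dif_neg fun hj => h (Instance.mem_known.1 hj).2,
      I.gdRate_extendPlan_of_notMem _ _ fun hj => h (Instance.mem_range_knownJob.1 hj)]

lemma Instance.work_known (I : Instance M S) (s : ℝ) (k : ℕ) (j : S) :
    (I.known (I.gdTime s k)).work (I.gdDone s k) j
      = ∑ i, I.lam i j * I.gdRate (I.gdPlan s k) i j := by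
  simp only [I.gdRate_gdPlan]
  unfold Knowledge.work
  by_cases h : I.r j ≤ I.gdTime s k
  · rw [dif_pos (Instance.mem_known.2 ⟨j.2, h⟩)]
    rfl
  · rw [dif_neg fun hj => h (Instance.mem_known.1 hj).2]
    refine (Finset.sum_eq_zero fun i _ => ?_).symm
    rw [Instance.gdStepRate, Knowledge.rate, dif_neg fun hj => h (Instance.mem_known.1 hj).2,
      mul_zero]

lemma Instance.revisions_eq (I : Instance M S) (s : ℝ) (k : ℕ) :
    I.revisions s (I.gdTime s k) (I.gdDone s k)
      = I.revisionTimes s (I.gdTime s k) (I.gdPlan s k) := by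
  unfold Instance.revisions Instance.revisionTimes
  congr 1
  ext t
  constructor
  · rintro ⟨d, ⟨i, j, hij, hj, rfl⟩, rfl⟩
    refine ⟨i, I.knownJob _ ⟨j, hj⟩, ?_, rfl⟩
    rw [I.gdRate_gdPlan]
    exact hij
  · rintro ⟨i, j, hij, rfl⟩
    rw [I.gdRate_gdPlan] at hij
    have hj : (j : ℕ) ∈ (I.known (I.gdTime s k)).1 := by
      by_contra hj
      rw [Instance.gdStepRate, Knowledge.rate, dif_neg hj] at hij
      exact lt_irrefl _ hij
    exact ⟨_, ⟨i, j, hij, hj, rfl⟩, rfl⟩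

lemma Instance.lpOptimal_gdPlan (I : Instance M S) (s : ℝ) (k : ℕ)
    (h0 : 0 ≤ I.gdRemaining s k) : I.LPOptimal (I.gdRemaining s k) (I.gdPlan s k) := by
  refine Instance.LPOptimal.extendPlan (I.knownJob_injective _) h0 (fun j hj => ?_) ?_
  · exact if_neg fun h => hj (Instance.mem_range_knownJob.2 h)
  · have he : I.gdRemaining s k ∘ I.knownJob (I.gdTime s k)
        = (I.known (I.gdTime s k)).remaining (I.gdDone s k) := by
      ext j
      exact if_pos (Instance.mem_known.1 j.2).2
    rw [he]
    refine (I.known (I.gdTime s k)).lpOptimal_plan ?_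
    rw [← he]
    exact fun j => h0 _

/-- The amounts processed stay within the sizes of the jobs. -/
lemma Instance.gdDone_bounds (I : Instance M S) {s : ℝ} (hs : 0 < s) (k : ℕ) :
    ∀ j : S, I.gdDone s k j ≤ I.p j ∧ (I.gdTime s k < I.r j → I.gdDone s k j = 0) := by
  induction k with
  | zero => exact fun j => ⟨by rw [I.gdDone_zero]; exact (I.p_pos j).le, fun _ => rfl⟩
  | succ k ih =>
    have h0 : 0 ≤ I.gdRemaining s k := fun j => by
      show 0 ≤ ite _ _ _
      split
      · exact sub_nonneg.2 (ih j).1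
      · exact le_rfl
    have hopt := I.lpOptimal_gdPlan s k h0
    have hT := (I.gdTime_strictMono hs (Nat.lt_succ_self k)).le
    have hc : 0 ≤ s * (I.gdTime s (k + 1) - I.gdTime s k) :=
      mul_nonneg hs.le (sub_nonneg.2 hT)
    -- No planned fraction is used up before the next decision, so the work of this step is at most
    -- what remains.
    have hle := (hopt.value_sub_le h0 hc fun i j hij => by
      have hmem : I.gdTime s k + I.p j / I.lam i j / s
          ∈ I.revisions s (I.gdTime s k) (I.gdDone s k) := by
        rw [I.revisions_eq]
        exact Or.inl ⟨i, j, hij, rfl⟩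
      have h1 := (I.isLeast_nextTime s _ _ ⟨_, hmem⟩).2 hmem
      rw [← I.gdTime_succ] at h1
      have h2 : I.gdTime s (k + 1) - I.gdTime s k ≤ I.p j / I.lam i j / s := by linarith
      rw [le_div_iff₀ hs, le_div_iff₀ (Instance.lam_pos_of_gdRate_pos hij)] at h2
      linarith).1
    intro j
    rw [I.gdDone_succ, I.work_known]
    have hj := hle j
    have hw : 0 ≤ s * (I.gdTime s (k + 1) - I.gdTime s k)
        * ∑ i, I.lam i j * I.gdRate (I.gdPlan s k) i j := mul_nonneg hc
      (Finset.sum_nonneg fun i _ => mul_nonneg (I.lam_nonneg i j) (hopt.1.gdRate_nonneg i j))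
    by_cases hr : I.r j ≤ I.gdTime s k
    · rw [Instance.gdRemaining, if_pos hr] at hj
      exact ⟨by linarith, fun h => absurd (hr.trans hT) (not_le.2 h)⟩
    · rw [Instance.gdRemaining, if_neg hr] at hj
      have h1 := (ih j).2 (not_le.1 hr)
      have h2 := I.p_pos j
      exact ⟨by linarith, fun _ => by linarith⟩

lemma Instance.gdRemaining_nonneg (I : Instance M S) {s : ℝ} (hs : 0 < s) (k : ℕ) :
    0 ≤ I.gdRemaining s k := fun j => by
  show 0 ≤ ite _ _ _
  split
  · exact sub_nonneg.2 (I.gdDone_bounds hs k j).1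
  · exact le_rfl

lemma Instance.gdDone_nonneg (I : Instance M S) {s : ℝ} (hs : 0 < s) (k : ℕ) (j : S) :
    0 ≤ I.gdDone s k j := by
  induction k with
  | zero => exact le_rfl
  | succ k ih =>
    rw [I.gdDone_succ, I.work_known]
    have hopt := I.lpOptimal_gdPlan s k (I.gdRemaining_nonneg hs k)
    have hT := (I.gdTime_strictMono hs (Nat.lt_succ_self k)).le
    exact add_nonneg ih (mul_nonneg (mul_nonneg hs.le (sub_nonneg.2 hT))
      (Finset.sum_nonneg fun i _ => mul_nonneg (I.lam_nonneg i j) (hopt.1.gdRate_nonneg i j)))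

/-- The recursion predicts the amounts processed. Integrating the constant rates between decisions
confirms them, so the chosen plans are optimal for the actual residuals. -/
lemma Instance.exists_gdSchedule (I : Instance M S) {s : ℝ} (hs : 0 < s) :
    ∃ ρ : Schedule I, (∀ k t, I.gdTime s k ≤ t → t < I.gdTime s (k + 1) →
        ∀ i (j : S), ρ.rate t i j = I.gdStepRate s k i j) ∧
      (∀ t, t < 0 → ρ.rate t = 0) ∧ IsApproxGD s ρ (I.gdTime s) (I.gdPlan s) := by
  have hopt : ∀ k, I.LPOptimal (I.gdRemaining s k) (I.gdPlan s k) := fun k =>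
    I.lpOptimal_gdPlan s k (I.gdRemaining_nonneg hs k)
  have hlep : ∀ k, I.gdRemaining s k ≤ I.p := fun k j => by
    show ite _ _ _ ≤ _
    split
    · exact sub_le_self _ (I.gdDone_nonneg hs k j)
    · exact (I.p_pos j).le
  have hmono := I.gdTime_strictMono hs
  obtain ⟨ρ, hρ, hneg⟩ := exists_piecewise_schedule I (I.gdTime_zero s) hmono
    (I.tendsto_gdTime hs) (fun k => I.gdRate (I.gdPlan s k))
    (fun k => (hopt k).1.gdRate_nonneg)
    (fun k => by
      obtain ⟨y, a, -, -, -, -, -, h1, -⟩ := (hopt k).exists_cut (I.gdRemaining_nonneg hs k)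
      exact h1)
    (fun k j => ((hopt k).sum_gdRate_le (I.gdRemaining_nonneg hs k) j).trans
      (div_le_one_of_le₀ (hlep k j) (I.p_pos j).le))
    (fun k i j hj => by
      rw [I.gdRate_gdPlan, Instance.gdStepRate, Knowledge.rate,
        dif_neg fun h => not_le.2 hj (Instance.mem_known.1 h).2])
  have hproc : ∀ k (j : S), ρ.processed s j (I.gdTime s k) = I.gdDone s k j := by
    intro k j
    induction k with
    | zero => rw [I.gdTime_zero, I.gdDone_zero]; simp [Schedule.processed]
    | succ k ih =>
      have h1 := ρ.processed_sub s j (I.gdTime s k) (I.gdTime s (k + 1))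
      have hle := (hmono (Nat.lt_succ_self k)).le
      have h2 : ∫ t in (I.gdTime s k)..(I.gdTime s (k + 1)), ∑ i, I.lam i j * ρ.rate t i j
          = ∫ t in (I.gdTime s k)..(I.gdTime s (k + 1)),
            ∑ i, I.lam i j * I.gdRate (I.gdPlan s k) i j := by
        refine intervalIntegral.integral_congr_ae ?_
        have hne : ∀ᵐ t : ℝ, t ≠ I.gdTime s (k + 1) := by simp [ae_iff]
        filter_upwards [hne] with t ht htm
        rw [Set.uIoc_of_le hle] at htm
        rw [hρ k t htm.1.le (lt_of_le_of_ne htm.2 ht)]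
      rw [h2, intervalIntegral.integral_const, smul_eq_mul, ih] at h1
      rw [I.gdDone_succ, I.work_known]
      linarith
  have hres : ∀ k, ρ.residual s (I.gdTime s k) = I.gdRemaining s k := by
    intro k
    ext j
    rw [← Schedule.frozen_self, Schedule.frozen, Instance.gdRemaining, hproc]
    by_cases h : I.r j ≤ I.gdTime s k
    · rw [if_pos h, if_pos h, max_eq_right (sub_nonneg.2 (I.gdDone_bounds hs k j).1)]
    · rw [if_neg h, if_neg h]
  refine ⟨ρ, fun k t h1 h2 i j => by rw [hρ k t h1 h2, I.gdRate_gdPlan], hneg,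
    ⟨I.gdTime_zero s, hmono, I.tendsto_gdTime hs, fun k => ?_, fun k t h1 h2 i j => ?_,
      fun k hne => ?_⟩⟩
  · rw [hres]; exact hopt k
  · rw [hρ k t h1 h2]
  · rw [← I.revisions_eq] at hne ⊢
    exact I.isLeast_nextTime s _ _ hne

end Policy

/-! ### Causality -/

section Causality

variable {M : Type} {S S' : Finset ℕ}

lemma ReleasedWithin.known_eq {I : Instance M S} {I' : Instance M S'} {t : ℝ}
    (h : ReleasedWithin t I I') (h' : ReleasedWithin t I' I) {T : ℝ}
    (hT : T ≤ t) : I.known T = I'.known T := by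
  refine Instance.known_eq (fun j hj hr => ?_) fun j hj hr => ?_
  · obtain ⟨hj', hr', hrest⟩ := h j hj (hr.trans hT)
    exact ⟨hj', hr' ▸ hr, hr', hrest⟩
  · obtain ⟨hj', hr', -⟩ := h' j hj (hr.trans hT)
    exact ⟨hj', hr' ▸ hr⟩

variable [Fintype M]

lemma Instance.gdStepRate_nonneg (I : Instance M S) {s : ℝ} (hs : 0 < s) (k : ℕ) (i : M) (j : ℕ) :
    0 ≤ I.gdStepRate s k i j := by
  by_cases hj : j ∈ (I.known (I.gdTime s k)).1
  · have := (I.lpOptimal_gdPlan s k (I.gdRemaining_nonneg hs k)).1.gdRate_nonneg i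
      ⟨j, (Instance.mem_known.1 hj).1⟩
    rwa [I.gdRate_gdPlan] at this
  · rw [Instance.gdStepRate, Knowledge.rate, dif_neg hj]

/-- Once there are no revision times, the rates do not change. -/
lemma Instance.gdStepRate_of_revisions_eq_empty (I : Instance M S) {s : ℝ} (hs : 0 < s) {k : ℕ}
    (he : I.revisions s (I.gdTime s k) (I.gdDone s k) = ∅) {n : ℕ} (hn : k ≤ n) :
    I.gdStepRate s n = I.gdStepRate s k := by
  have hknown : ∀ m, k ≤ m → I.known (I.gdTime s m) = I.known (I.gdTime s k) := by
    intro m hm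
    refine (Instance.known_eq (fun j hj hr => ⟨hj, hr.trans ?_, rfl, rfl, rfl, fun _ => rfl⟩)
      fun j hj hr => ⟨hj, ?_⟩).symm
    · exact (I.gdTime_strictMono hs).monotone hm
    · by_contra hcon
      have : I.r ⟨j, hj⟩ ∈ I.revisions s (I.gdTime s k) (I.gdDone s k) :=
        Or.inr ⟨not_le.1 hcon, _, rfl⟩
      rw [he] at this
      exact this
  have hzero : ∀ i j, I.gdStepRate s k i j = 0 := by
    intro i j
    refine le_antisymm (not_lt.1 fun hpos => ?_) (I.gdStepRate_nonneg hs k i j)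
    have hj : j ∈ (I.known (I.gdTime s k)).1 := by
      by_contra hj
      rw [Instance.gdStepRate, Knowledge.rate, dif_neg hj] at hpos
      exact lt_irrefl _ hpos
    have : _ ∈ I.revisions s (I.gdTime s k) (I.gdDone s k) :=
      Or.inl ⟨_, ⟨i, j, hpos, hj, rfl⟩, rfl⟩
    rw [he] at this
    exact this
  have hwork : ∀ j, (I.known (I.gdTime s k)).work (I.gdDone s k) j = 0 := by
    intro j
    unfold Knowledge.work
    split
    · refine Finset.sum_eq_zero fun i _ => ?_
      have := hzero i j
      rw [Instance.gdStepRate] at this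
      rw [this, mul_zero]
    · rfl
  have hdone : I.gdDone s n = I.gdDone s k := by
    induction n, hn using Nat.le_induction with
    | base => rfl
    | succ m hm ih =>
      ext j
      rw [I.gdDone_succ, hknown m hm, ih, hwork, mul_zero, add_zero]
  rw [Instance.gdStepRate, Instance.gdStepRate, hknown n hn, hdone]

/-- The rates are kept as long as there is no revision time. -/
lemma Instance.gdStepRate_eq_of_lt_revisions (I : Instance M S) {s u : ℝ} (hs : 0 < s) {k m : ℕ}
    (hk : I.gdTime s k ≤ u)
    (hrev : ∀ v ∈ I.revisions s (I.gdTime s k) (I.gdDone s k), u < v)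
    (hm : I.gdTime s m ≤ u) (hm' : u < I.gdTime s (m + 1)) :
    I.gdStepRate s m = I.gdStepRate s k := by
  have hmono := I.gdTime_strictMono hs
  have hkm : k ≤ m := Nat.lt_succ_iff.1 (hmono.lt_iff_lt.1 (hk.trans_lt hm'))
  by_cases hne : (I.revisions s (I.gdTime s k) (I.gdDone s k)).Nonempty
  · have h1 := hrev _ (I.isLeast_nextTime s _ _ hne).1
    rw [← I.gdTime_succ] at h1
    have h2 : m ≤ k := Nat.lt_succ_iff.1 (hmono.lt_iff_lt.1 (hm.trans_lt h1))
    rw [le_antisymm h2 hkm]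
  · exact I.gdStepRate_of_revisions_eq_empty hs (Set.not_nonempty_iff_eq_empty.1 hne) hkm

variable {I : Instance M S} {I' : Instance M S'} {t : ℝ}

lemma ReleasedWithin.mem_revisions (h : ReleasedWithin t I I') (h' : ReleasedWithin t I' I)
    {s T u : ℝ} {done : ℕ → ℝ} (hT : T ≤ t) (hu : u ≤ t) (hmem : u ∈ I.revisions s T done) :
    u ∈ I'.revisions s T done := by
  rcases hmem with hd | ⟨hTu, j, hj⟩
  · left
    rwa [← h.known_eq h' hT]
  · obtain ⟨hj', hr', -⟩ := h j.1 j.2 (by rw [← hj]; exact hu)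
    exact Or.inr ⟨hTu, ⟨j.1, hj'⟩, by rw [hr', hj]⟩

/-- A revision that happens by time `t` is visible in both instances. -/
lemma ReleasedWithin.nextTime_le (h : ReleasedWithin t I I') (h' : ReleasedWithin t I' I)
    {s T u : ℝ} {done : ℕ → ℝ} (hT : T ≤ t) (hu : u ≤ t) (hmem : u ∈ I.revisions s T done) :
    I'.nextTime s T done ≤ I.nextTime s T done := by
  have h1 := I.isLeast_nextTime s T done ⟨u, hmem⟩
  have h2 := h.mem_revisions h' hT ((h1.2 hmem).trans hu) h1.1
  exact (I'.isLeast_nextTime s T done ⟨_, h2⟩).2 h2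

/-- The rates of approximate gradient descent at time `u` depend only on the jobs released by
time `u`. -/
lemma ReleasedWithin.gdStepRate_eq (h : ReleasedWithin t I I') (h' : ReleasedWithin t I' I)
    {s u : ℝ} (hs : 0 < s) (hu : u ≤ t) {m m' : ℕ}
    (hm : I.gdTime s m ≤ u) (hm1 : u < I.gdTime s (m + 1))
    (hm' : I'.gdTime s m' ≤ u) (hm1' : u < I'.gdTime s (m' + 1)) :
    I.gdStepRate s m = I'.gdStepRate s m' := by
  have hmono := I.gdTime_strictMono hs
  have hmono' := I'.gdTime_strictMono hs
  have hstep : ∀ k, I.gdTime s k ≤ u → I.gdTime s k = I'.gdTime s k →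
      I.gdDone s k = I'.gdDone s k → I.gdStepRate s k = I'.gdStepRate s k := by
    intro k hk hT hd
    rw [Instance.gdStepRate, Instance.gdStepRate, h.known_eq h' (hk.trans hu), hT, hd]
  by_contra hcon
  -- Agreement is carried one step past `m`, so that `u` lies before the next decision in both runs
  -- and m = m'. The indices may differ when no revision occurs by `t`, since the next decision
  -- times may then differ.
  have hagree : ∀ k, k ≤ m + 1 →
      I.gdTime s k = I'.gdTime s k ∧ I.gdDone s k = I'.gdDone s k := by
    intro k
    induction k with
    | zero => exact fun _ => ⟨rfl, rfl⟩
    | succ k ih =>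
      intro hk
      obtain ⟨hT, hd⟩ := ih (Nat.le_of_succ_le hk)
      have hku : I.gdTime s k ≤ u := (hmono.monotone (Nat.le_of_succ_le_succ hk)).trans hm
      have hkt := hku.trans hu
      -- If some revision occurs by `t`, both runs have the same next decision. If none does, both
      -- keep their current, equal rates up to `u`.
      by_cases hex : ∃ v ∈ I.revisions s (I.gdTime s k) (I.gdDone s k), v ≤ t
      · obtain ⟨v, hv, hvt⟩ := hex
        have hv' := h.mem_revisions h' hkt hvt hv
        have hnext : I.gdTime s (k + 1) = I'.gdTime s (k + 1) := by
          rw [I.gdTime_succ, I'.gdTime_succ, ← hT, ← hd]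
          exact le_antisymm (h'.nextTime_le h hkt hvt hv') (h.nextTime_le h' hkt hvt hv)
        refine ⟨hnext, ?_⟩
        ext j
        rw [I.gdDone_succ, I'.gdDone_succ, ← hnext, ← hT, ← hd, h.known_eq h' hkt]
      · exfalso
        refine hcon ?_
        rw [I.gdStepRate_eq_of_lt_revisions hs hku (fun v hv => not_le.1 fun hvu =>
            hex ⟨v, hv, hvu.trans hu⟩) hm hm1,
          I'.gdStepRate_eq_of_lt_revisions hs (k := k) (hT ▸ hku) (fun v hv => not_le.1 fun hvu =>
            hex ⟨v, ?_, hvu.trans hu⟩) hm' hm1']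
        · exact hstep k hku hT hd
        · rw [hT, hd]
          exact h'.mem_revisions h (hT ▸ hkt) (hvu.trans hu) hv
  obtain ⟨hT, hd⟩ := hagree m (Nat.le_succ m)
  obtain ⟨hT1, -⟩ := hagree (m + 1) le_rfl
  have hmm : m = m' := le_antisymm
    (Nat.lt_succ_iff.1 (hmono'.lt_iff_lt.1 ((hT ▸ hm).trans_lt hm1')))
    (Nat.lt_succ_iff.1 (hmono'.lt_iff_lt.1 (hm'.trans_lt (hT1 ▸ hm1))))
  subst hmm
  exact hcon (hstep m hm hT hd)

lemma IsApproxGD.exists_step {J : Type} [Fintype J] {K : Instance M J} {s u : ℝ} {σ : Schedule K}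
    {T : ℕ → ℝ} {z : ℕ → M → J → ℝ → ℝ} (hrun : IsApproxGD s σ T z) (hu : 0 ≤ u) :
    ∃ k, T k ≤ u ∧ u < T (k + 1) := by
  have hex : ∃ k, u < T k := (hrun.unbounded.eventually_gt_atTop u).exists
  classical
  obtain ⟨k, hk⟩ : ∃ k, Nat.find hex = k + 1 := by
    refine Nat.exists_eq_succ_of_ne_zero fun h => ?_
    have := Nat.find_spec hex
    rw [h, hrun.start] at this
    exact not_lt.2 hu this
  refine ⟨k, not_lt.1 (Nat.find_min hex (by omega)), ?_⟩
  rw [← hk]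
  exact Nat.find_spec hex

/-- The schedule produced by approximate gradient descent. -/
def Instance.gdSchedule (I : Instance M S) {s : ℝ} (hs : 0 < s) : Schedule I :=
  (I.exists_gdSchedule hs).choose

lemma Instance.isApproxGD_gdSchedule (I : Instance M S) {s : ℝ} (hs : 0 < s) :
    IsApproxGD s (I.gdSchedule hs) (I.gdTime s) (I.gdPlan s) :=
  (I.exists_gdSchedule hs).choose_spec.2.2

lemma ReleasedWithin.gdSchedule_rate (h : ReleasedWithin t I I') (h' : ReleasedWithin t I' I)
    {s u : ℝ} (hs : 0 < s) (hu : u ≤ t) (i : M) (j : ℕ) (hj : j ∈ S) (hj' : j ∈ S') :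
    (I.gdSchedule hs).rate u i ⟨j, hj⟩ = (I'.gdSchedule hs).rate u i ⟨j, hj'⟩ := by
  obtain ⟨hr, hneg, hI⟩ := (I.exists_gdSchedule hs).choose_spec
  obtain ⟨hr', hneg', hI'⟩ := (I'.exists_gdSchedule hs).choose_spec
  change (I.exists_gdSchedule hs).choose.rate u i _ = (I'.exists_gdSchedule hs).choose.rate u i _
  rcases lt_or_ge u 0 with hu0 | hu0
  · rw [hneg u hu0, hneg' u hu0]
    rfl
  · obtain ⟨m, hm, hm1⟩ := hI.exists_step hu0
    obtain ⟨m', hm', hm1'⟩ := hI'.exists_step hu0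
    rw [hr m u hm hm1, hr' m' u hm' hm1', h.gdStepRate_eq h' hs hu hm hm1 hm' hm1']

lemma ReleasedWithin.gdSchedule_residual (h : ReleasedWithin t I I') (h' : ReleasedWithin t I' I)
    {s u : ℝ} (hs : 0 < s) (s' : ℝ) (hu : u ≤ t) (j : ℕ) (hj : j ∈ S) (hj' : j ∈ S') :
    (I.gdSchedule hs).residual s' u ⟨j, hj⟩ = (I'.gdSchedule hs).residual s' u ⟨j, hj'⟩ := by
  unfold Schedule.residual
  by_cases hr : I.r ⟨j, hj⟩ ≤ u
  · obtain ⟨_, hr', hp, -, hlam⟩ := h j hj (hr.trans hu)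
    rw [if_pos hr, if_pos (hr' ▸ hr), hp]
    congr 2
    unfold Schedule.processed
    congr 1
    refine intervalIntegral.integral_congr fun v hv => ?_
    rw [Set.uIcc_of_le ((I.r_nonneg _).trans hr)] at hv
    refine Finset.sum_congr rfl fun i _ => ?_
    rw [hlam, h.gdSchedule_rate h' hs (hv.2.trans hu) i j hj hj']
  · have hr' : ¬ I'.r ⟨j, hj'⟩ ≤ u := fun hcon => by
      obtain ⟨_, hr', -⟩ := h' j hj' (hcon.trans hu)
      exact hr (hr' ▸ hcon)
    rw [if_neg hr, if_neg hr']

/-- Approximate gradient descent with speed `s`, run on machines of speed `s'`: a job is no longer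
processed once it is completed. -/
def gdAlgorithm (M : Type) [Fintype M] {s : ℝ} (hs : 0 < s) (s' : ℝ) : OnlineAlgorithm M where
  run I := (I.gdSchedule hs).truncate s'
  causal I I' t h h' u hu i j hj hj' := by
    change ite _ _ _ = ite _ _ _
    rw [h.gdSchedule_residual h' hs s' hu j hj hj', h.gdSchedule_rate h' hs hu i j hj hj']

end Causality

end UnrelatedFlow

end

/-! ### Assembly of the statement -/

theorem mainTheorem6 :
    ∃ C : ℝ, 0 < C ∧
      -- the residual program and the approximate gradient are well defined; substitutes;
      -- supermodularity
      (∀ (M J : Type) [Fintype M] [Fintype J] (I : UnrelatedFlow.Instance M J),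
        (∀ x : J → ℝ, 0 ≤ x → I.lpValue x ≠ ⊤ ∧ ∃ z, I.LPOptimal x z) ∧
        (∀ (x : J → ℝ) (z : M → J → ℝ → ℝ), 0 ≤ x → x ≤ I.p → I.LPOptimal x z →
          (∀ i j, 0 ≤ I.gdRate z i j) ∧ (∀ i, ∑ j, I.gdRate z i j ≤ 1) ∧
            ∀ j, ∑ i, I.gdRate z i j ≤ 1) ∧
        (∀ B t : ℝ, 0 ≤ t → UnrelatedFlow.LinearSubstitutes (I.flowValuation B t)) ∧
        (∀ x y : J → ℝ, 0 ≤ x → 0 ≤ y →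
          I.lpValue x + I.lpValue y ≤ I.lpValue (x ⊔ y) + I.lpValue (x ⊓ y)) ∧
        (∀ (x : J → ℝ) (S S' : Set J), 0 ≤ x →
          I.lpSetValue x S + I.lpSetValue x S' ≤
            I.lpSetValue x (S ∪ S') + I.lpSetValue x (S ∩ S'))) ∧
      -- drift of the potential, `ε = 1 / n < 1 / 8`, algorithm with speed `1 + 2 ε`
      (∀ (M J : Type) [Fintype M] [Fintype J] (I : UnrelatedFlow.Instance M J) (n : ℕ) (ε s : ℝ),
        ε = 1 / (n : ℝ) → 0 < ε → ε < 1 / 8 → s = 1 + 2 * ε →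
        ∀ σ τ : UnrelatedFlow.Schedule I,
          -- at every time at which the algorithm follows an approximate gradient of its state
          (∀ (t δ : ℝ) (z : M → J → ℝ → ℝ), 0 ≤ t → 0 < δ →
            I.LPOptimal (σ.residual s t) z →
            (∀ u, t ≤ u → u < t + δ → ∀ i j, σ.rate u i j = I.gdRate z i j) →
            ∀ᶠ h in 𝓝[>] (0 : ℝ),
              (UnrelatedFlow.potential I n (σ.residual s (t + h)) (τ.residual 1 (t + h))
                - UnrelatedFlow.potential I n (σ.residual s t) (τ.residual 1 t)) / h
                ≤ -σ.fracWeight s t + C / ε ^ 2 * τ.aliveWeight 1 t) ∧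
          -- in integrated form, between consecutive decision times of a run
          (∀ (T : ℕ → ℝ) (z : ℕ → M → J → ℝ → ℝ), UnrelatedFlow.IsApproxGD s σ T z →
            ∀ (k : ℕ) (t : ℝ), T k ≤ t → t < T (k + 1) →
              UnrelatedFlow.potential I n (σ.residual s t) (τ.residual 1 t)
                - UnrelatedFlow.potential I n (σ.residual s (T k)) (τ.residual 1 (T k))
                ≤ ∫ u in (T k)..t, (-σ.fracWeight s u + C / ε ^ 2 * τ.aliveWeight 1 u))) ∧
      -- fractional objective of every run with speed `1 + 2 ε`
      (∀ (M J : Type) [Fintype M] [Fintype J] (I : UnrelatedFlow.Instance M J) (ε : ℝ),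
        0 < ε → ε < 1 / 8 →
        ∀ (σ : UnrelatedFlow.Schedule I) (T : ℕ → ℝ) (z : ℕ → M → J → ℝ → ℝ),
          UnrelatedFlow.IsApproxGD (1 + 2 * ε) σ T z →
          σ.fracFlow (1 + 2 * ε) ≤ ENNReal.ofReal (C / ε ^ 2) * I.opt) ∧
      -- integral objective: an online algorithm with speed `1 + ε` that follows approximate
      -- gradient descent and is `C / ε ^ 3`-competitive
      (∀ (M : Type) [Fintype M] (ε : ℝ), 0 < ε → ε ≤ 1 →
        ∃ (A : UnrelatedFlow.OnlineAlgorithm M) (δ : ℝ),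
          0 < δ ∧ δ < 1 / 8 ∧ 1 + 2 * δ < 1 + ε ∧
          ∀ (S : Finset ℕ) (I : UnrelatedFlow.Instance M S),
            (∃ (ρ : UnrelatedFlow.Schedule I) (T : ℕ → ℝ) (z : ℕ → M → S → ℝ → ℝ),
              UnrelatedFlow.IsApproxGD (1 + 2 * δ) ρ T z ∧
              UnrelatedFlow.FollowsUntilDone (1 + ε) (A.run I) ρ) ∧
            (A.run I).weightedFlow (1 + ε) ≤ ENNReal.ofReal (C / ε ^ 3) * I.opt) := by
  refine ⟨4096, by norm_num, ?_, ?_, ?_, ?_⟩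
  · intro M J _ _ I
    have hsup : ∀ x y : J → ℝ, 0 ≤ x → 0 ≤ y →
        I.lpValue x + I.lpValue y ≤ I.lpValue (x ⊔ y) + I.lpValue (x ⊓ y) := by
      intro x y hx hy
      rw [← I.ofReal_value hx, ← I.ofReal_value hy, ← I.ofReal_value (hx.trans le_sup_left),
        ← I.ofReal_value (le_inf hx hy), ← ENNReal.ofReal_add (I.value_nonneg x) (I.value_nonneg y),
        ← ENNReal.ofReal_add (I.value_nonneg _) (I.value_nonneg _)]
      exact ENNReal.ofReal_le_ofReal (I.value_supermodular hx hy)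
    refine ⟨fun x hx => ⟨I.lpValue_ne_top hx, I.exists_lpOptimal hx⟩, fun x z hx hxp hz => ?_,
      fun B t _ => I.linearSubstitutes_flowValuation B t, hsup, fun x S S' hx => ?_⟩
    · obtain ⟨y, a, -, -, -, -, -, h1, -⟩ := hz.exists_cut hx
      exact ⟨hz.1.gdRate_nonneg, h1, fun j => (hz.sum_gdRate_le hx j).trans
        (div_le_one_of_le₀ (hxp j) (I.p_pos j).le)⟩
    · have h1 : S.indicator x ⊔ S'.indicator x = (S ∪ S').indicator x := by
        classical
        ext j
        have := hx j
        by_cases hS : j ∈ S <;> by_cases hS' : j ∈ S' <;> simp_all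
      have h2 : S.indicator x ⊓ S'.indicator x = (S ∩ S').indicator x := by
        classical
        ext j
        have := hx j
        by_cases hS : j ∈ S <;> by_cases hS' : j ∈ S' <;> simp_all
      have h3 := hsup (S.indicator x) (S'.indicator x) (Set.indicator_nonneg fun j _ => hx j)
        (Set.indicator_nonneg fun j _ => hx j)
      rwa [h1, h2] at h3
  · intro M J _ _ I n ε s hn hε hε8 hs σ τ
    have hC : (4 : ℝ) ≤ 4096 := by norm_num
    refine ⟨fun t δ z _ hδ hz hrate =>
      σ.potential_drift_eventually τ hε hε8 hs hC hn hδ hz hrate, fun T z hrun k t ht ht' =>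
      hrun.drift_integral τ hε hε8 hs hC hn k ht ht'⟩
  · intro M J _ _ I ε hε hε8 σ T z hrun
    refine (hrun.fracFlow_le hε hε8 rfl).trans (mul_le_mul_left (ENNReal.ofReal_le_ofReal ?_) _)
    gcongr
    norm_num
  · intro M _ ε hε hε1
    -- The gradient run uses speed 1 + ε/8, which leaves a surplus of 7ε/8 for the passage to the
    -- integral objective.
    have hs : 0 < 1 + 2 * (ε / 16) := by positivity
    refine ⟨UnrelatedFlow.gdAlgorithm M hs (1 + ε), ε / 16, by positivity, by linarith,
      by linarith, fun S I => ⟨⟨I.gdSchedule hs, _, _, I.isApproxGD_gdSchedule hs,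
        (I.gdSchedule hs).followsUntilDone_truncate (by positivity)⟩, ?_⟩⟩
    have h1 := (I.gdSchedule hs).weightedFlow_truncate_le hs.le
      (show 1 + 2 * (ε / 16) < 1 + ε by linarith)
    have h2 := (I.isApproxGD_gdSchedule hs).fracFlow_le (ε := ε / 16) (by positivity)
      (by linarith) rfl
    refine h1.trans ((mul_le_mul_right h2 _).trans ?_)
    rw [← mul_assoc, ← ENNReal.ofReal_mul (div_nonneg (by positivity) (by linarith))]
    refine mul_le_mul_left (ENNReal.ofReal_le_ofReal ?_) _
    -- For ε ≤ 1 the ratio is at most 16/(7ε). Together with 4/(ε/16)² = 1024/ε² the bound 4/ε gives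
    -- the constant 4096.
    have h3 : (1 + ε) / (1 + ε - (1 + 2 * (ε / 16))) ≤ 4 / ε := by
      rw [div_le_div_iff₀ (by linarith) hε]
      nlinarith
    calc (1 + ε) / (1 + ε - (1 + 2 * (ε / 16))) * (4 / (ε / 16) ^ 2)
        ≤ 4 / ε * (4 / (ε / 16) ^ 2) := mul_le_mul_of_nonneg_right h3 (by positivity)
      _ = 4096 / ε ^ 3 := by field_simp; norm_num
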